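/- Identify $\mathbb R^2$ with $\mathbb C$. Let $\Omega=\{|z|<1\}$, $\Gamma=\partial\Omega$, $\boldsymbol\theta=(\cos\theta,\sin\theta)$, $\boldsymbol\theta^\perp=(-\sin\theta,\cos\theta)$, $\partial=(\partial_x-i\partial_y)/2$, $\overline\partial=(\partial_x+i\partial_y)/2$. Write $w_n=\frac1{2\pi}\int_{-\pi}^{\pi}w(\theta)e^{-in\theta}\,d\theta$ for Fourier modes in the angle, and for a function $w$ on $\Gamma$ with Fourier coefficients $w_n$ put $\|w\|_{H^{1/2}(\Gamma)}^2=\sum_{n\in\mathbb Z}(1+n^2)^{1/2}|w_n|^2$. Let $s>1/2$, let $a\in C^{2,s}(\overline\Omega)$ be real, and let $k(z,\cos\theta)$ be a real scattering kernel such that the $2\pi$-periodic map $\theta\mapsto k(\cdot,\cos\theta)\in \mathrm{Lip}(\Omega)$ is of class $C^{1,s}$. Let $k_n(z)$ be its Fourier modes. Extend $a$ by zero outside $\Omega$ and put $$h(z,\theta)=\int_0^\infty a(z+t\boldsymbol\theta)\,dt-\tfrac12\,(I-iH)\,Ra(z\cdot\boldsymbol\theta^\perp,\boldsymbol\theta^\perp),\qquad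 Ra(r,\boldsymbol\theta^\perp)=\int_{-\infty}^{\infty}a(r\boldsymbol\theta^\perp+t\boldsymbol\theta)\,dt,$$ where $Hw(r)=\frac1\pi\,\mathrm{p.v.}\!\int\frac{w(t)}{r-t}\,dt$ acts in the first variable of $Ra$. For $j\ge0$ let $\alpha_j(z)$ and $\beta_j(z)$ be the $j$-th Fourier modes of $e^{-h(z,\cdot)}$ and $e^{h(z,\cdot)}$. For a sequence of functions put $\|\mathbf w\|_*=\sup_{z\in\Omega}\big(|w_0(z)|+\sum_{j\ge1}j|w_j(z)|\big)$, and let $\sigma=\max\{\|\boldsymbol\alpha\|_*,\|\partial\boldsymbol\alpha\|_*,\|\boldsymbol\beta\|_*,\|\partial\boldsymbol\beta\|_*\}$. Let $\mu=2$. Assume weakly anisotropic scattering: $$\gamma=\sup_{j\ge1}\,(1+j)\max\{\|k_{-j}\|_{L^\infty(\Omega)},\|\nabla k_{-j}\|_{L^\infty(\Omega)}\}<\frac{\sqrt2-1}{2\sqrt\mu\,\sigma^2}$$ (the right-hand side being $0$ if $\sigma=\infty$). Let $f\in H^1(\Omega)$ be real and let $u\in H^1(\Omega\times S^1)$ be a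 real solution of $$\boldsymbol\theta\cdot\nabla u+a\,u=\frac1{2\pi}\int_{-\pi}^{\pi}k\big(z,\cos(\theta-\theta')\big)\,u(z,\theta')\,d\theta'+f(z)\quad\text{in }\Omega\times S^1 .$$ Let $g_{-j}$ be the trace on $\Gamma$ of the mode $u_{-j}$ (the exact data), $j\ge0$. For $M\ge0$ and data $\widetilde{\mathbf g}=(\widetilde g_0,\widetilde g_{-1},\dots)$, say that $f^{(M)}$ is reconstructed from $\widetilde{\mathbf g}$ if there is a sequence $(u^{(M)}_{-j})_{j\ge0}$ in $l^2(\mathbb N;H^1(\Omega))$ with $u^{(M)}_{-j}|_\Gamma=\widetilde g_{-j}$ such that, for all $j\ge0$, $$\overline\partial u^{(M)}_{-j}+\partial u^{(M)}_{-j-2}+a\,u^{(M)}_{-j-1}=\begin{cases}k_{-j-1}u^{(M)}_{-j-1},& j+1\le M,\\ 0,& j+1>M,\end{cases}$$ and $f^{(M)}=2\,\mathrm{Re}\,\big(\partial u^{(M)}_{-1}\big)+(a-k_0)\,u^{(M)}_0$. Let $\rho_j\ge0$ be noise levels with $\sum_{j\ge0}(1+j^2)^{1/2}\rho_j^2<\infty$.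 Then for every $\varepsilon>0$ there is $M_0$ such that, for every $M\ge M_0$, every data sequence $\widetilde{\mathbf g}$ with $\widetilde g_{-j}=g_{-j}$ for $0\le j\le M$ and $\|\widetilde g_{-j}-g_{-j}\|_{H^{1/2}(\Gamma)}\le\rho_j$ for $j>M$, and every $f^{(M)}$ reconstructed from $\widetilde{\mathbf g}$, $$\|f^{(M)}-f\|_{L^2(\Omega)}\le\varepsilon .$$ In other words, if the modes $0,-1,\dots,-M$ of the data are exact and the higher modes are possibly noisy, then $\|f^{(M)}-f\|_{L^2(\Omega)}\to0$ as $M\to\infty$. -/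

import Mathlib

open MeasureTheory Set Filter Topology
open scoped ENNReal ContDiff

noncomputable section

namespace SourceRec

/-! ### The unit disc, Fourier modes, first order Sobolev spaces -/

/-- The domain: the open unit disc of the plane, the plane being identified with `ℂ`. -/
def disc : Set ℂ := Metric.ball 0 1

/-- Lebesgue measure on the disc. -/
def discMeasure : Measure ℂ := volume.restrict disc

/-- The interval `(-π, π]`, which parametrizes both the unit circle of directions and the
boundary circle, with Lebesgue measure. -/
def angleMeasure : Measure ℝ := volume.restrict (Ioc (-Real.pi) Real.pi)

/-- The `n`-th Fourier coefficient `(1/2π) ∫_{-π}^{π} w(θ) e^{-inθ} dθ`. -/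
def fourierMode (w : ℝ → ℂ) (n : ℤ) : ℂ :=
  (1 / (2 * Real.pi) : ℂ) * ∫ θ, w θ * Complex.exp (-(Complex.I * n * θ)) ∂angleMeasure

/-- `∂ = (∂_x - i ∂_y)/2`, as a combination of the two partial derivatives. -/
def del (vx vy : ℂ) : ℂ := (vx - Complex.I * vy) / 2

/-- `∂̄ = (∂_x + i ∂_y)/2`, as a combination of the two partial derivatives. -/
def delBar (vx vy : ℂ) : ℂ := (vx + Complex.I * vy) / 2

/-- `w` is the weak derivative of `v` on the disc in the direction `e`. -/
def IsWeakDeriv (e : ℂ) (v w : ℂ → ℂ) : Prop :=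
  ∀ φ : ℂ → ℝ, ContDiff ℝ ∞ φ → HasCompactSupport φ → tsupport φ ⊆ disc →
    ∫ z, v z * (fderiv ℝ φ z e : ℂ) ∂discMeasure = -∫ z, w z * (φ z : ℂ) ∂discMeasure

/-- `v ∈ H¹(Ω)`, with weak partial derivatives `vx` and `vy`. -/
structure IsH1 (v vx vy : ℂ → ℂ) : Prop where
  memLp : MemLp v 2 discMeasure
  memLp_dx : MemLp vx 2 discMeasure
  memLp_dy : MemLp vy 2 discMeasure
  weak_dx : IsWeakDeriv 1 v vx
  weak_dy : IsWeakDeriv Complex.I v vy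

/-- `‖v‖²_{H¹(Ω)} = ‖v‖² + ‖∂_x v‖² + ‖∂_y v‖²`. -/
def h1NormSq (v vx vy : ℂ → ℂ) : ℝ≥0∞ :=
  eLpNorm v 2 discMeasure ^ 2 + eLpNorm vx 2 discMeasure ^ 2 + eLpNorm vy 2 discMeasure ^ 2

/-- `g`, a function of the angle `β` of the boundary point `e^{iβ}`, is the trace on the unit circle
of the function `v` of `H¹(Ω)` with weak partial derivatives `vx` and `vy`: the divergence theorem
holds against every smooth function on the plane. This determines `g` almost everywhere. -/
structure IsTrace (v vx vy : ℂ → ℂ) (g : ℝ → ℂ) : Prop where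
  memLp : MemLp g 2 angleMeasure
  green_x : ∀ φ : ℂ → ℝ, ContDiff ℝ ∞ φ →
    ∫ z, (vx z * (φ z : ℂ) + v z * (fderiv ℝ φ z 1 : ℂ)) ∂discMeasure =
      ∫ β, g β * ((φ (Complex.exp (Complex.I * β)) * Real.cos β : ℝ) : ℂ) ∂angleMeasure
  green_y : ∀ φ : ℂ → ℝ, ContDiff ℝ ∞ φ →
    ∫ z, (vy z * (φ z : ℂ) + v z * (fderiv ℝ φ z Complex.I : ℂ)) ∂discMeasure =
      ∫ β, g β * ((φ (Complex.exp (Complex.I * β)) * Real.sin β : ℝ) : ℂ) ∂angleMeasure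

/-- `‖w‖²_{H^{1/2}(Γ)} = ∑_{n ∈ ℤ} (1 + n²)^{1/2} |w_n|²` for a function `w` on the unit circle. -/
def halfNormSq (w : ℝ → ℂ) : ℝ≥0∞ :=
  ∑' n : ℤ, ENNReal.ofReal (Real.sqrt (1 + (n : ℝ) ^ 2)) * ‖fourierMode w n‖ₑ ^ 2

/-! ### The coefficients -/

/-- `a ∈ C^{2,s}(Ω̄)`: on the disc, `a` is of class `C²`, bounded together with its derivatives up to
order two, and its second derivative is `s`-Hölder. -/
def IsC2Holder (s : ℝ) (a : ℂ → ℝ) : Prop :=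
  ContDiffOn ℝ 2 a disc ∧ ∃ C : ℝ, ∀ z ∈ disc,
    |a z| ≤ C ∧ ‖fderiv ℝ a z‖ ≤ C ∧ ‖iteratedFDeriv ℝ 2 a z‖ ≤ C ∧
    ∀ w ∈ disc, ‖iteratedFDeriv ℝ 2 a z - iteratedFDeriv ℝ 2 a w‖ ≤ C * ‖z - w‖ ^ s

/-- The norm of `b` in `Lip(Ω)` (the supremum and the Lipschitz constant) is at most `C`. -/
def LipBound (b : ℂ → ℝ) (C : ℝ) : Prop :=
  (∀ z ∈ disc, |b z| ≤ C) ∧ ∀ z ∈ disc, ∀ w ∈ disc, |b z - b w| ≤ C * ‖z - w‖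

/-- `k ∈ C^{1,s}_{per}([-1,1]; Lip(Ω))`: the periodic map `θ ↦ k(·, cos θ)` is of class `C^{1,s}` with
values in `Lip(Ω)`; `k'` is its derivative in `θ`. -/
def IsC1HolderKernel (s : ℝ) (k : ℂ → ℝ → ℝ) : Prop :=
  ∃ (k' : ℂ → ℝ → ℝ) (C : ℝ),
    (∀ z ∈ disc, ∀ θ : ℝ, HasDerivAt (fun t : ℝ => k z (Real.cos t)) (k' z θ) θ) ∧
    (∀ θ : ℝ, LipBound (fun z => k z (Real.cos θ)) C) ∧
    (∀ θ : ℝ, LipBound (fun z => k' z θ) C) ∧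
    ∀ θ t : ℝ, LipBound (fun z => k' z θ - k' z t) (C * |θ - t| ^ s)

/-- `k_n(z) = (1/2π) ∫_{-π}^{π} k(z, cos θ) e^{-inθ} dθ`. -/
def kernelMode (k : ℂ → ℝ → ℝ) (n : ℤ) (z : ℂ) : ℂ :=
  fourierMode (fun θ => (k z (Real.cos θ) : ℂ)) n

/-- `γ = sup_{j ≥ 1} (1 + j) max {‖k_{-j}‖_∞, ‖∇k_{-j}‖_∞}`. -/
def gammaConst (k : ℂ → ℝ → ℝ) : ℝ≥0∞ :=
  ⨆ (j : ℕ) (_ : 1 ≤ j), (1 + (j : ℝ≥0∞)) *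
    max (eLpNorm (kernelMode k (-(j : ℤ))) ∞ discMeasure)
      (eLpNorm (fun z => fderiv ℝ (kernelMode k (-(j : ℤ))) z) ∞ discMeasure)

/-! ### The integrating factor `e^{-h}` -/

/-- The direction `(cos θ, sin θ)`. -/
def dir (θ : ℝ) : ℂ := Complex.exp (Complex.I * θ)

/-- The direction `(-sin θ, cos θ)` orthogonal to `dir θ`. -/
def dirPerp (θ : ℝ) : ℂ := Complex.I * dir θ

/-- The extension of `a` by zero outside the disc. -/
def zeroExt (a : ℂ → ℝ) : ℂ → ℝ := disc.indicator a

/-- The divergent beam transform `Da(z, θ) = ∫_0^∞ a(z + tθ) dt`. -/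
def divBeam (a : ℂ → ℝ) (z : ℂ) (θ : ℝ) : ℝ := ∫ t in Ioi (0 : ℝ), zeroExt a (z + t * dir θ)

/-- The Radon transform `Ra(s, θ^⊥) = ∫_{-∞}^∞ a(sθ^⊥ + tθ) dt`. -/
def radon (a : ℂ → ℝ) (θ s : ℝ) : ℝ := ∫ t : ℝ, zeroExt a (s * dirPerp θ + t * dir θ)

/-- The Hilbert transform `(1/π) p.v. ∫ w(t)/(s - t) dt`; the principal value is written as
`(1/π) ∫_0^∞ (w(s - t) - w(s + t))/t dt`. -/
def hilbert (w : ℝ → ℝ) (s : ℝ) : ℝ :=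
  1 / Real.pi * ∫ t in Ioi (0 : ℝ), (w (s - t) - w (s + t)) / t

/-- `h(z, θ) = Da(z, θ) - (1/2)(I - iH)Ra(z · θ^⊥, θ^⊥)`. -/
def hFun (a : ℂ → ℝ) (z : ℂ) (θ : ℝ) : ℂ :=
  (divBeam a z θ : ℂ) - 1 / 2 * ((radon a θ (inner ℝ z (dirPerp θ)) : ℂ) -
    Complex.I * (hilbert (radon a θ) (inner ℝ z (dirPerp θ)) : ℂ))

/-- `α_j(z)`, the Fourier modes of `e^{-h(z, ·)}` of index `j ≥ 0`. -/
def alpha (a : ℂ → ℝ) (j : ℕ) (z : ℂ) : ℂ := fourierMode (fun θ => Complex.exp (-hFun a z θ)) j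

/-- `β_j(z)`, the Fourier modes of `e^{h(z, ·)}` of index `j ≥ 0`. -/
def beta (a : ℂ → ℝ) (j : ℕ) (z : ℂ) : ℂ := fourierMode (fun θ => Complex.exp (hFun a z θ)) j

/-- `∂v` for a differentiable function `v`. -/
def delFun (v : ℂ → ℂ) (z : ℂ) : ℂ := del (fderiv ℝ v z 1) (fderiv ℝ v z Complex.I)

/-- `sup_{z ∈ Ω} (|w_0(z)| + ∑_{j ≥ 1} j |w_j(z)|)`. -/
def seqNorm (w : ℕ → ℂ → ℂ) : ℝ≥0∞ :=
  ⨆ z ∈ disc, (‖w 0 z‖ₑ + ∑' j : ℕ, (j : ℝ≥0∞) * ‖w j z‖ₑ)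

/-- `σ = max {‖α‖, ‖∂α‖, ‖β‖, ‖∂β‖}`. -/
def sigmaConst (a : ℂ → ℝ) : ℝ≥0∞ :=
  max (max (seqNorm (alpha a)) (seqNorm fun j => delFun (alpha a j)))
    (max (seqNorm (beta a)) (seqNorm fun j => delFun (beta a j)))

/-- The value `μ = 2` that the threshold uses for the unit disc. -/
def muConst : ℝ := 2

/-! ### The transport equation -/

/-- `w` is the weak derivative of `u` on `Ω × S¹` in the direction `e`. The test functions are smooth,
`2π`-periodic in the angle, and vanish outside a compact subset of the disc. -/
def IsWeakDerivPhase (e : ℂ × ℝ) (u w : ℂ → ℝ → ℝ) : Prop :=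
  ∀ φ : ℂ × ℝ → ℝ, ContDiff ℝ ∞ φ → (∀ z θ, φ (z, θ + 2 * Real.pi) = φ (z, θ)) →
    (∃ K : Set ℂ, IsCompact K ∧ K ⊆ disc ∧ ∀ z ∉ K, ∀ θ, φ (z, θ) = 0) →
    ∫ p, u p.1 p.2 * fderiv ℝ φ p e ∂(discMeasure.prod angleMeasure) =
      -∫ p, w p.1 p.2 * φ p ∂(discMeasure.prod angleMeasure)

/-- `u ∈ H¹(Ω × S¹)`, with weak partial derivatives `ux`, `uy`, `uθ`. Only the values for angles in
`(-π, π]` matter. -/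
structure IsH1Phase (u ux uy uθ : ℂ → ℝ → ℝ) : Prop where
  memLp : MemLp (Function.uncurry u) 2 (discMeasure.prod angleMeasure)
  memLp_dx : MemLp (Function.uncurry ux) 2 (discMeasure.prod angleMeasure)
  memLp_dy : MemLp (Function.uncurry uy) 2 (discMeasure.prod angleMeasure)
  memLp_dθ : MemLp (Function.uncurry uθ) 2 (discMeasure.prod angleMeasure)
  weak_dx : IsWeakDerivPhase (1, 0) u ux
  weak_dy : IsWeakDerivPhase (Complex.I, 0) u uy
  weak_dθ : IsWeakDerivPhase (0, 1) u uθ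

/-- The stationary transport equation `θ · ∇u + a u = ∫_{S¹} k(z, θ · θ') u(z, θ') dθ' + f` on `Ω × S¹`,
the measure `dθ'` on the circle of directions being normalized to total mass one, so that the
scattering operator multiplies the `n`-th angular mode by `k_n`. -/
def IsTransportSolution (a : ℂ → ℝ) (k : ℂ → ℝ → ℝ) (f : ℂ → ℝ) (u ux uy : ℂ → ℝ → ℝ) : Prop :=
  ∀ᵐ p : ℂ × ℝ ∂(discMeasure.prod angleMeasure),
    Real.cos p.2 * ux p.1 p.2 + Real.sin p.2 * uy p.1 p.2 + a p.1 * u p.1 p.2 =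
      1 / (2 * Real.pi) * (∫ t, k p.1 (Real.cos (p.2 - t)) * u p.1 t ∂angleMeasure) + f p.1

/-- The `n`-th angular mode `u_n(z)` of a real function `u(z, θ)`. -/
def angularMode (u : ℂ → ℝ → ℝ) (n : ℤ) (z : ℂ) : ℂ := fourierMode (fun θ => (u z θ : ℂ)) n

/-! ### The reconstructed source -/

/-- The multiplier `k_{-n}` for `n ≤ M`, and `0` for `n > M`. -/
def truncMode (k : ℂ → ℝ → ℝ) (M n : ℕ) (z : ℂ) : ℂ :=
  if n ≤ M then kernelMode k (-(n : ℤ)) z else 0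

/-- `F` is the source `f^{(M)}` reconstructed from the boundary data `g = (g_0, g_{-1}, g_{-2}, …)`
(here `g j` stands for `g_{-j}`, and `U j` for `u^{(M)}_{-j}`): there is a sequence
`u^{(M)} ∈ l²(ℕ; H¹(Ω))` with trace `g` that solves `∂̄u + L²∂u + aLu = LK^{(M)}u`, and
`F = 2 Re (∂u_{-1}) + (a - k_0) u_0`. -/
def IsReconstruction (a : ℂ → ℝ) (k : ℂ → ℝ → ℝ) (M : ℕ) (g : ℕ → ℝ → ℂ) (F : ℂ → ℂ) : Prop :=
  ∃ U Ux Uy : ℕ → ℂ → ℂ,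
    (∀ j, IsH1 (U j) (Ux j) (Uy j)) ∧
    (∑' j, h1NormSq (U j) (Ux j) (Uy j) < ⊤) ∧
    (∀ j, IsTrace (U j) (Ux j) (Uy j) (g j)) ∧
    (∀ j, ∀ᵐ z ∂discMeasure,
      delBar (Ux j z) (Uy j z) + del (Ux (j + 2) z) (Uy (j + 2) z) + a z * U (j + 1) z =
        truncMode k M (j + 1) z * U (j + 1) z) ∧
    ∀ᵐ z ∂discMeasure,
      F z = 2 * ((del (Ux 1 z) (Uy 1 z)).re : ℂ) + (a z - kernelMode k 0 z) * U 0 z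

/-- The data `gt` agree with the exact data `g` in the modes `0, -1, …, -M`; in every mode `-j` with
`j > M` the noise is at most `ρ j` in `H^{1/2}(Γ)`. -/
structure IsNoisyData (g : ℕ → ℝ → ℂ) (ρ : ℕ → ℝ≥0∞) (M : ℕ) (gt : ℕ → ℝ → ℂ) : Prop where
  exact_modes : ∀ j ≤ M, gt j =ᵐ[angleMeasure] g j
  noise : ∀ j, M < j → halfNormSq (fun β => gt j β - g j β) ≤ ρ j ^ 2

end SourceRec

end

noncomputable section

namespace SourceRec

/-! ### Plancherel's theorem for integrable square integrable functions -/

/-! Let q_j be the difference between the reconstructed and the exact mode of index -j. Subtracting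
the two systems gives ∂̄q_j + ∂q_{j+2} + a q_{j+1} = G_j, where G_j equals k_{-(j+1)} q_{j+1} for
j+1 ≤ M and -k_{-(j+1)} u_{-(j+1)} for j+1 > M. The trace of q_j vanishes for j ≤ M and is the noise
for j > M. Since f^{(M)} - f = 2 Re ∂q_1 + (a - k_0) q_0, it is enough to bound q_0 and ∂q_1 by the
tails over j > M of Σ (1+j)ρ_j² and of Σ ‖u_{-j}‖², which both tend to 0.

Energy. A zero trace function extended by zero satisfies ‖∂v‖ = ‖∂̄v‖, because the Fourier symbols
of ∂ and ∂̄ have the same modulus (`IsZeroTrace.nsq_del`). If the trace is carried by a lift w, this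
becomes ‖∂(v+w)‖² ≤ ‖∂̄(v+w)‖² + ‖∂w‖² (`IsZeroTrace.nsq_del_add_le`); the lift is the harmonic
extension of the noise (`exists_lift`).

Attenuation. Convolution in the mode index with the modes α of an integrating factor removes the
term with a (`tsum_conjugated_equation`) and is inverted by convolution with the modes β of the
reciprocal factor. Such a pair, bounded in ℓ¹ together with its gradients, is built by
exponentiating the odd positive modes of a beam transform (`exists_phase`,
`exists_isIntegratingPair`).

Recursion. For p = α * q and x_j = ‖∂p_j‖ the energy inequality and the conjugated equation give
x_j² ≤ (x_{j+2} + f_j)² + b_j, with b_j from the lift and f_j from scattering. As x_j tends to 0,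
this is solved from infinity downwards (`le_add_tsum_of_sq_le`). Summation over j turns the first
part into Σ (n+1) b_n, which is the weight in the hypothesis on the noise, and the second into a
multiple of Σ_j (Σ_m κ_{j+m})². Here κ_j is of order j^{-(1+s)} by the regularity of the kernel
(`exists_kernelMode_bound`), so this double sum is finite exactly in the range s > 1/2.

Absorption and descent. The double sum started at a large index J is so small that the scattering
term is absorbed in the left-hand side, with the help of the Poincaré inequality
(`IsIntegratingPair.exists_tail_bound`). For the finitely many j < J the trace of q_j is zero as
soon as M ≥ J. Then ‖q_j‖ ≤ 4‖∂q_j‖ = 4‖∂̄q_j‖, and the equation expresses ∂̄q_j through ∂q_{j+2},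
q_{j+1} and G_j. Finitely many such backward steps lose only a constant (`exists_descent_bound`,
`IsIntegratingPair.exists_error_bound`). -/

open scoped FourierTransform SchwartzMap ComplexConjugate in
-- Two locally integrable functions agree almost everywhere once they agree against every smooth
-- compactly supported `g`. Such a `g` is a Schwartz function; the `L²` transform is dual to the
-- transform of Schwartz functions, and the integral transform satisfies the same duality by Fubini.
theorem coeFn_fourier_toLp {f : ℂ → ℂ} (h1 : Integrable f) (h2 : MemLp f 2) :
    (𝓕 (h2.toLp f) : Lp ℂ 2 (volume : Measure ℂ)) =ᵐ[volume] 𝓕 f := by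
  have hc : Continuous (𝓕 f) := by
    have := VectorFourier.fourierIntegral_continuous (μ := (volume : Measure ℂ))
      Real.continuous_fourierChar (L := innerₗ ℂ) (by exact continuous_inner) h1
    exact this
  refine ae_eq_of_integral_contDiff_smul_eq ?_ hc.locallyIntegrable ?_
  · exact (Lp.memLp _).locallyIntegrable (by norm_num)
  intro g hg hgs
  have hs : HasCompactSupport (fun x => (g x : ℂ)) := hgs.comp_left Complex.ofReal_zero
  let G : 𝓢(ℂ, ℂ) := hs.toSchwartzMap (Complex.ofRealCLM.contDiff.comp hg)
  have hG : ∀ x, G x = (g x : ℂ) := fun x => rfl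
  have e1 := congrArg (fun T : 𝓢'(ℂ, ℂ) => T G) (Lp.fourier_toTemperedDistribution_eq (h2.toLp f))
  simp only [TemperedDistribution.fourier_apply, Lp.toTemperedDistribution_apply] at e1
  have e2 : ∫ x, (g x) • ((𝓕 (h2.toLp f) : Lp ℂ 2 (volume : Measure ℂ)) x) =
      ∫ x, G x • ((𝓕 (h2.toLp f) : Lp ℂ 2 (volume : Measure ℂ)) x) := by
    congr 1
  have e3 : ∫ x, (g x) • (𝓕 f x) = ∫ x, G x • 𝓕 f x := by
    congr 1
  rw [e2, e3, ← e1]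
  have e4 := VectorFourier.integral_fourierIntegral_smul_eq_flip (μ := (volume : Measure ℂ))
    (ν := (volume : Measure ℂ)) (L := innerₗ ℂ) (f := G) (g := f) Real.continuous_fourierChar
    (by exact continuous_inner) G.integrable h1
  rw [flip_innerₗ] at e4
  rw [← show _ = ∫ x, G x • 𝓕 f x from e4]
  refine integral_congr_ae ?_
  filter_upwards [h2.coeFn_toLp] with x hx
  rw [hx]
  rfl

open scoped FourierTransform ComplexConjugate in
theorem integral_mul_conj_eq_fourier {f g : ℂ → ℂ} (f1 : Integrable f) (f2 : MemLp f 2)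
    (g1 : Integrable g) (g2 : MemLp g 2) :
    ∫ x, f x * conj (g x) = ∫ ξ, 𝓕 f ξ * conj (𝓕 g ξ) := by
  have h := Lp.inner_fourier_eq (g2.toLp g) (f2.toLp f)
  rw [L2.inner_def, L2.inner_def] at h
  simp only [RCLike.inner_apply] at h
  rw [integral_congr_ae (g := fun ξ => 𝓕 f ξ * conj (𝓕 g ξ))
    (by filter_upwards [coeFn_fourier_toLp f1 f2, coeFn_fourier_toLp g1 g2] with x h1 h2
        rw [h1, h2])] at h
  rw [h]
  refine integral_congr_ae ?_
  filter_upwards [f2.coeFn_toLp, g2.coeFn_toLp] with x h1 h2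
  rw [h1, h2]

/-! ### Functions whose derivatives are seen by the Fourier transform -/

open scoped ComplexConjugate

/-- Square integrable functions with zero trace on the unit circle: Green's formula without boundary
term against every `C¹` function of the plane. -/
structure IsZeroTrace (v vx vy : ℂ → ℂ) : Prop where
  memLp : MemLp v 2 discMeasure
  memLp_dx : MemLp vx 2 discMeasure
  memLp_dy : MemLp vy 2 discMeasure
  green_x : ∀ φ : ℂ → ℂ, ContDiff ℝ 1 φ →
    ∫ z, (vx z * φ z + v z * fderiv ℝ φ z 1) ∂discMeasure = 0
  green_y : ∀ φ : ℂ → ℂ, ContDiff ℝ 1 φ →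
    ∫ z, (vy z * φ z + v z * fderiv ℝ φ z Complex.I) ∂discMeasure = 0

open scoped FourierTransform in
/-- Integrable and square integrable functions `v`, `vx`, `vy` on the plane, the Fourier transforms of
the last two being those of the partial derivatives of the first. -/
structure HasFourierDeriv (v vx vy : ℂ → ℂ) : Prop where
  int : Integrable v
  int_dx : Integrable vx
  int_dy : Integrable vy
  memLp : MemLp v 2
  memLp_dx : MemLp vx 2
  memLp_dy : MemLp vy 2
  fourier_dx : ∀ ξ : ℂ, 𝓕 vx ξ = 2 * Real.pi * Complex.I * ξ.re * 𝓕 v ξ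
  fourier_dy : ∀ ξ : ℂ, 𝓕 vy ξ = 2 * Real.pi * Complex.I * ξ.im * 𝓕 v ξ

theorem measurableSet_disc : MeasurableSet disc := measurableSet_ball

instance : IsFiniteMeasure discMeasure :=
  ⟨by rw [discMeasure, Measure.restrict_apply_univ]; exact measure_ball_lt_top⟩

instance : IsFiniteMeasure angleMeasure :=
  ⟨by rw [angleMeasure, Measure.restrict_apply_univ]; exact measure_Ioc_lt_top⟩

theorem integral_indicator_disc_mul (v φ : ℂ → ℂ) :
    ∫ z, disc.indicator v z * φ z = ∫ z, v z * φ z ∂discMeasure := by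
  rw [discMeasure, ← integral_indicator measurableSet_disc]
  congr 1; ext z
  by_cases h : z ∈ disc <;> simp [h]

theorem memLp_indicator_disc {v : ℂ → ℂ} (h : MemLp v 2 discMeasure) :
    MemLp (disc.indicator v) 2 volume :=
  (memLp_indicator_iff_restrict measurableSet_disc).2 h

theorem integrable_indicator_disc {v : ℂ → ℂ} (h : MemLp v 2 discMeasure) :
    Integrable (disc.indicator v) volume :=
  (integrable_indicator_iff measurableSet_disc).2 (h.integrable (by norm_num))

/-- The character `x ↦ e^{-2πi⟨x, ξ⟩}`. -/
def planeWave (ξ x : ℂ) : ℂ := Complex.exp (-(2 * Real.pi * Complex.I * (inner ℝ x ξ : ℝ)))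

theorem contDiff_planeWave (ξ : ℂ) : ContDiff ℝ ∞ (planeWave ξ) := by
  unfold planeWave
  refine ContDiff.cexp (ContDiff.neg (contDiff_const.mul ?_))
  exact Complex.ofRealCLM.contDiff.comp (contDiff_id.inner ℝ contDiff_const)

theorem fderiv_planeWave (ξ x e : ℂ) : fderiv ℝ (planeWave ξ) x e =
    -(2 * Real.pi * Complex.I * (inner ℝ e ξ : ℝ)) * planeWave ξ x := by
  have h1 : HasFDerivAt (fun y : ℂ => (inner ℝ y ξ : ℝ)) ((innerSL ℝ).flip ξ) x :=
    ((innerSL ℝ).flip ξ).hasFDerivAt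
  have h2 := (((Complex.ofRealCLM.hasFDerivAt.comp x h1).const_mul
    (2 * Real.pi * Complex.I)).neg).cexp
  have h3 : HasFDerivAt (planeWave ξ) _ x := h2
  rw [h3.fderiv]
  have h4 : ((innerSL ℝ).flip ξ) e = (inner ℝ e ξ : ℝ) := rfl
  simp only [planeWave, smul_apply, neg_apply, ContinuousLinearMap.comp_apply, h4, smul_eq_mul,
    Pi.neg_apply, Function.comp_apply, Complex.ofRealCLM_apply]
  ring

open scoped FourierTransform in
theorem fourier_eq_integral_planeWave (f : ℂ → ℂ) (ξ : ℂ) :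
    𝓕 f ξ = ∫ x, f x * planeWave ξ x := by
  rw [Real.fourier_eq']
  congr 1; ext x
  rw [smul_eq_mul, mul_comm, planeWave]
  congr 2
  push_cast
  ring

theorem norm_planeWave (ξ x : ℂ) : ‖planeWave ξ x‖ = 1 := by
  rw [planeWave, Complex.norm_exp]; simp

theorem inner_one_left (ξ : ℂ) : (inner ℝ 1 ξ : ℝ) = ξ.re := by simp [Complex.inner]

theorem inner_I_left (ξ : ℂ) : (inner ℝ Complex.I ξ : ℝ) = ξ.im := by simp [Complex.inner]

theorem integrable_mul_continuous {v φ : ℂ → ℂ} (h : MemLp v 2 discMeasure) (hφ : Continuous φ) :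
    Integrable (fun z => v z * φ z) discMeasure := by
  obtain ⟨C, hC⟩ := (isCompact_closedBall (0 : ℂ) 1).exists_bound_of_continuousOn hφ.continuousOn
  refine Integrable.mul_bdd (c := C) (h.integrable (by norm_num)) hφ.aestronglyMeasurable ?_
  rw [discMeasure]
  filter_upwards [ae_restrict_mem measurableSet_disc] with z hz
  exact hC z (Metric.ball_subset_closedBall hz)

/-- Green's formula without boundary term, tested against plane waves, says that extension by zero
creates no singular part of the gradient on the circle. -/
theorem IsZeroTrace.hasFourierDeriv {v vx vy : ℂ → ℂ} (h : IsZeroTrace v vx vy) :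
    HasFourierDeriv (disc.indicator v) (disc.indicator vx) (disc.indicator vy) where
  int := integrable_indicator_disc h.memLp
  int_dx := integrable_indicator_disc h.memLp_dx
  int_dy := integrable_indicator_disc h.memLp_dy
  memLp := memLp_indicator_disc h.memLp
  memLp_dx := memLp_indicator_disc h.memLp_dx
  memLp_dy := memLp_indicator_disc h.memLp_dy
  fourier_dx ξ := by
    have hw := (contDiff_planeWave ξ).continuous
    have := h.green_x (planeWave ξ) ((contDiff_planeWave ξ).of_le (by simp))
    rw [fourier_eq_integral_planeWave, fourier_eq_integral_planeWave, integral_indicator_disc_mul,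
      integral_indicator_disc_mul]
    simp only [fderiv_planeWave, inner_one_left] at this
    simp only [mul_left_comm (v _)] at this
    rw [integral_add (integrable_mul_continuous h.memLp_dx hw)
      ((integrable_mul_continuous h.memLp hw).const_mul _), integral_const_mul] at this
    linear_combination this
  fourier_dy ξ := by
    have hw := (contDiff_planeWave ξ).continuous
    have := h.green_y (planeWave ξ) ((contDiff_planeWave ξ).of_le (by simp))
    rw [fourier_eq_integral_planeWave, fourier_eq_integral_planeWave, integral_indicator_disc_mul,
      integral_indicator_disc_mul]
    simp only [fderiv_planeWave, inner_I_left] at this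
    simp only [mul_left_comm (v _)] at this
    rw [integral_add (integrable_mul_continuous h.memLp_dy hw)
      ((integrable_mul_continuous h.memLp hw).const_mul _), integral_const_mul] at this
    linear_combination this

theorem fourier_fderiv_eq {w : ℂ → ℂ} (hw : ContDiff ℝ 1 w) (hc : HasCompactSupport w) (e ξ : ℂ) :
    ∫ x, fderiv ℝ w x e * planeWave ξ x =
      2 * Real.pi * Complex.I * (inner ℝ e ξ : ℝ) * ∫ x, w x * planeWave ξ x := by
  have hp := contDiff_planeWave ξ
  have hcd : HasCompactSupport (fun x => fderiv ℝ w x e) := hc.fderiv_apply ℝ e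
  have hdc : Continuous (fun x => fderiv ℝ w x e) :=
    (hw.continuous_fderiv one_ne_zero).clm_apply continuous_const
  have hpd : Continuous (fun x => fderiv ℝ (planeWave ξ) x e) :=
    ((hp.continuous_fderiv (by simp)).clm_apply continuous_const)
  have := integral_mul_fderiv_eq_neg_fderiv_mul_of_integrable (μ := (volume : Measure ℂ))
    (f := w) (g := planeWave ξ) (v := e)
    ((hdc.mul hp.continuous).integrable_of_hasCompactSupport hcd.mul_right)
    ((hw.continuous.mul hpd).integrable_of_hasCompactSupport hc.mul_right)
    ((hw.continuous.mul hp.continuous).integrable_of_hasCompactSupport hc.mul_right)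
    (fun x _ => (hw.differentiable (by simp)).differentiableAt)
    (fun x _ => (hp.differentiable (by simp)).differentiableAt)
  simp only [fderiv_planeWave, mul_left_comm (w _)] at this
  rw [integral_const_mul] at this
  linear_combination this

theorem hasFourierDeriv_of_contDiff {w : ℂ → ℂ} (hw : ContDiff ℝ 1 w) (hc : HasCompactSupport w) :
    HasFourierDeriv w (fun z => fderiv ℝ w z 1) (fun z => fderiv ℝ w z Complex.I) := by
  have hcd (e : ℂ) : HasCompactSupport (fun x => fderiv ℝ w x e) := hc.fderiv_apply ℝ e
  have hdc (e : ℂ) : Continuous (fun x => fderiv ℝ w x e) :=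
    (hw.continuous_fderiv one_ne_zero).clm_apply continuous_const
  refine ⟨hw.continuous.integrable_of_hasCompactSupport hc,
    (hdc _).integrable_of_hasCompactSupport (hcd _), (hdc _).integrable_of_hasCompactSupport (hcd _),
    hw.continuous.memLp_of_hasCompactSupport hc, (hdc _).memLp_of_hasCompactSupport (hcd _),
    (hdc _).memLp_of_hasCompactSupport (hcd _), fun ξ => ?_, fun ξ => ?_⟩
  · rw [fourier_eq_integral_planeWave, fourier_eq_integral_planeWave, fourier_fderiv_eq hw hc,
      inner_one_left]
  · rw [fourier_eq_integral_planeWave, fourier_eq_integral_planeWave, fourier_fderiv_eq hw hc,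
      inner_I_left]

open scoped FourierTransform in
theorem fourier_del {v w : ℂ → ℂ} (hv : Integrable v) (hw : Integrable w) (ξ : ℂ) :
    𝓕 (fun z => del (v z) (w z)) ξ = del (𝓕 v ξ) (𝓕 w ξ) := by
  have h (f : ℂ → ℂ) (hf : Integrable f) : Integrable (fun x => f x * planeWave ξ x) := by
    refine hf.mul_bdd (c := 1) (contDiff_planeWave ξ).continuous.aestronglyMeasurable ?_
    exact ae_of_all _ fun x => (norm_planeWave ξ x).le
  simp only [fourier_eq_integral_planeWave, del]
  rw [← integral_const_mul, ← integral_sub (h v hv) ((h w hw).const_mul _), ← integral_div]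
  congr 1; ext x; ring

open scoped FourierTransform in
theorem fourier_delBar {v w : ℂ → ℂ} (hv : Integrable v) (hw : Integrable w) (ξ : ℂ) :
    𝓕 (fun z => delBar (v z) (w z)) ξ = delBar (𝓕 v ξ) (𝓕 w ξ) := by
  have h (f : ℂ → ℂ) (hf : Integrable f) : Integrable (fun x => f x * planeWave ξ x) := by
    refine hf.mul_bdd (c := 1) (contDiff_planeWave ξ).continuous.aestronglyMeasurable ?_
    exact ae_of_all _ fun x => (norm_planeWave ξ x).le
  simp only [fourier_eq_integral_planeWave, delBar]
  rw [← integral_const_mul, ← integral_add (h v hv) ((h w hw).const_mul _), ← integral_div]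
  congr 1; ext x; ring

theorem memLp_del {μ : Measure ℂ} {v w : ℂ → ℂ} (hv : MemLp v 2 μ) (hw : MemLp w 2 μ) :
    MemLp (fun z => del (v z) (w z)) 2 μ := by
  have := (hv.sub (hw.const_mul Complex.I)).const_mul (1 / 2)
  refine this.congr_norm ?_ (ae_of_all _ fun z => ?_)
  · simp only [del]
    exact ((hv.1.sub (hw.1.const_mul Complex.I)).mul_const (2⁻¹)).congr
      (ae_of_all _ fun z => by simp [div_eq_mul_inv])
  · simp [del, div_eq_inv_mul]

theorem memLp_delBar {μ : Measure ℂ} {v w : ℂ → ℂ} (hv : MemLp v 2 μ) (hw : MemLp w 2 μ) :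
    MemLp (fun z => delBar (v z) (w z)) 2 μ := by
  have := memLp_del hv hw.neg
  refine this.congr_norm ?_ (ae_of_all _ fun z => by simp [del, delBar])
  refine this.1.congr (ae_of_all _ fun z => by simp [del, delBar])

theorem integrable_del {μ : Measure ℂ} {v w : ℂ → ℂ} (hv : Integrable v μ) (hw : Integrable w μ) :
    Integrable (fun z => del (v z) (w z)) μ :=
  ((hv.sub (hw.const_mul Complex.I)).div_const 2).congr (ae_of_all _ fun z => by simp [del])

theorem integrable_delBar {μ : Measure ℂ} {v w : ℂ → ℂ} (hv : Integrable v μ)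
    (hw : Integrable w μ) : Integrable (fun z => delBar (v z) (w z)) μ :=
  ((hv.add (hw.const_mul Complex.I)).div_const 2).congr (ae_of_all _ fun z => by simp [delBar])

/-- On the Fourier side ∂ and ∂̄ are multiplication by πi times the conjugate of ξ and by πi ξ.
Either way the product with a conjugate carries the factor π²|ξ|². -/
theorem HasFourierDeriv.integral_del_mul_conj {v vx vy w wx wy : ℂ → ℂ}
    (hv : HasFourierDeriv v vx vy) (hw : HasFourierDeriv w wx wy) :
    ∫ z, del (vx z) (vy z) * conj (del (wx z) (wy z)) =
      ∫ z, delBar (vx z) (vy z) * conj (delBar (wx z) (wy z)) := by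
  rw [integral_mul_conj_eq_fourier (integrable_del hv.int_dx hv.int_dy)
    (memLp_del hv.memLp_dx hv.memLp_dy) (integrable_del hw.int_dx hw.int_dy)
    (memLp_del hw.memLp_dx hw.memLp_dy),
    integral_mul_conj_eq_fourier (integrable_delBar hv.int_dx hv.int_dy)
    (memLp_delBar hv.memLp_dx hv.memLp_dy) (integrable_delBar hw.int_dx hw.int_dy)
    (memLp_delBar hw.memLp_dx hw.memLp_dy)]
  congr 1; ext ξ
  rw [fourier_del hv.int_dx hv.int_dy, fourier_del hw.int_dx hw.int_dy,
    fourier_delBar hv.int_dx hv.int_dy, fourier_delBar hw.int_dx hw.int_dy,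
    hv.fourier_dx, hv.fourier_dy, hw.fourier_dx, hw.fourier_dy]
  simp only [del, delBar, map_div₀, map_sub, map_add, map_mul, Complex.conj_I, Complex.conj_ofReal,
    Complex.conj_ofNat]
  ring

theorem HasFourierDeriv.integral_dx_mul_conj {v vx vy w wx wy : ℂ → ℂ}
    (hv : HasFourierDeriv v vx vy) (hw : HasFourierDeriv w wx wy) :
    ∫ z, vx z * conj (w z) = - ∫ z, v z * conj (wx z) := by
  rw [integral_mul_conj_eq_fourier hv.int_dx hv.memLp_dx hw.int hw.memLp,
    integral_mul_conj_eq_fourier hv.int hv.memLp hw.int_dx hw.memLp_dx, ← integral_neg]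
  congr 1; ext ξ
  rw [hv.fourier_dx, hw.fourier_dx]
  simp only [map_mul, Complex.conj_I, Complex.conj_ofReal, Complex.conj_ofNat]
  ring

/-! ### Energy estimates -/

open scoped ComplexConjugate

/-- The squared `L²(Ω)` norm. -/
def nsq (v : ℂ → ℂ) : ℝ≥0∞ := ∫⁻ z, ‖v z‖ₑ ^ 2 ∂discMeasure

theorem nsq_eq_eLpNorm_sq (v : ℂ → ℂ) : nsq v = eLpNorm v 2 discMeasure ^ 2 := by
  rw [eLpNorm_eq_lintegral_rpow_enorm_toReal (by norm_num) (by norm_num), nsq,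
    ← ENNReal.rpow_natCast, ← ENNReal.rpow_mul]
  simp

theorem nsq_lt_top {v : ℂ → ℂ} (h : MemLp v 2 discMeasure) : nsq v < ⊤ := by
  rw [nsq_eq_eLpNorm_sq]; exact ENNReal.pow_lt_top h.2

theorem nsq_congr {v w : ℂ → ℂ} (h : v =ᵐ[discMeasure] w) : nsq v = nsq w :=
  lintegral_congr_ae (h.mono fun z hz => by simp only [hz])

theorem integrable_mul_conj {v w : ℂ → ℂ} (hv : MemLp v 2 discMeasure)
    (hw : MemLp w 2 discMeasure) : Integrable (fun z => v z * conj (w z)) discMeasure := by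
  have : MemLp (fun z => conj (w z)) 2 discMeasure := hw.star
  exact hv.integrable_mul this

theorem ofReal_nsq {v : ℂ → ℂ} (hv : MemLp v 2 discMeasure) :
    ((nsq v).toReal : ℂ) = ∫ z, v z * conj (v z) ∂discMeasure := by
  have : ∀ z, v z * conj (v z) = ((‖v z‖ ^ 2 : ℝ) : ℂ) := fun z => by
    rw [Complex.mul_conj, Complex.normSq_eq_norm_sq]
  simp only [this]
  rw [integral_complex_ofReal, integral_eq_lintegral_of_nonneg_ae (ae_of_all _ fun z => by positivity)
    (by exact hv.1.norm.pow 2)]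
  congr 2
  refine lintegral_congr fun z => ?_
  rw [← ofReal_norm, ENNReal.ofReal_pow (norm_nonneg _)]

theorem integral_indicator_disc_mul_conj (v w : ℂ → ℂ) :
    ∫ z, disc.indicator v z * conj (w z) = ∫ z, v z * conj (w z) ∂discMeasure :=
  integral_indicator_disc_mul v fun z => conj (w z)

theorem indicator_del (v w : ℂ → ℂ) (z : ℂ) :
    del (disc.indicator v z) (disc.indicator w z) = disc.indicator (fun z => del (v z) (w z)) z := by
  by_cases h : z ∈ disc <;> simp [h, del]

theorem indicator_delBar (v w : ℂ → ℂ) (z : ℂ) :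
    delBar (disc.indicator v z) (disc.indicator w z) =
      disc.indicator (fun z => delBar (v z) (w z)) z := by
  by_cases h : z ∈ disc <;> simp [h, delBar]

theorem integral_congr_disc {F G : ℂ → ℂ} (h : ∀ z ∈ disc, F z = G z) :
    ∫ z, F z ∂discMeasure = ∫ z, G z ∂discMeasure :=
  setIntegral_congr_fun measurableSet_disc h

theorem IsZeroTrace.nsq_del {v vx vy : ℂ → ℂ} (h : IsZeroTrace v vx vy) :
    nsq (fun z => del (vx z) (vy z)) = nsq (fun z => delBar (vx z) (vy z)) := by
  have m1 := memLp_del h.memLp_dx h.memLp_dy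
  have m2 := memLp_delBar h.memLp_dx h.memLp_dy
  rw [← ENNReal.toReal_eq_toReal_iff' (nsq_lt_top m1).ne (nsq_lt_top m2).ne, ← Complex.ofReal_inj,
    ofReal_nsq m1, ofReal_nsq m2]
  have := h.hasFourierDeriv.integral_del_mul_conj h.hasFourierDeriv
  simp only [indicator_del, indicator_delBar] at this
  rw [integral_indicator_disc_mul_conj, integral_indicator_disc_mul_conj] at this
  refine (integral_congr_disc fun z hz => ?_).trans (this.trans (integral_congr_disc fun z hz => ?_))
  · simp [hz]
  · simp [hz]

/-- The gradient `(wx, wy)` has the same pairing in terms of `∂` and of `∂̄` with every zero trace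
function. -/
def CrossIdentity (wx wy : ℂ → ℂ) : Prop := ∀ v vx vy : ℂ → ℂ, IsZeroTrace v vx vy →
  ∫ z, del (vx z) (vy z) * conj (del (wx z) (wy z)) ∂discMeasure =
    ∫ z, delBar (vx z) (vy z) * conj (delBar (wx z) (wy z)) ∂discMeasure

theorem exists_cutoff : ∃ χ : ℂ → ℝ, ContDiff ℝ ∞ χ ∧ HasCompactSupport χ ∧
    (∀ z ∈ Metric.closedBall (0 : ℂ) 1, χ z = 1) ∧ (∀ z, 11 / 10 ≤ ‖z‖ → χ z = 0) ∧
    ∀ z, χ z ∈ Icc (0 : ℝ) 1 := by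
  let b : ContDiffBump (0 : ℂ) := ⟨1, 11 / 10, by norm_num, by norm_num⟩
  refine ⟨b, b.contDiff, b.hasCompactSupport, fun z hz => b.one_of_mem_closedBall hz, fun z hz => ?_,
    fun z => ⟨b.nonneg, b.le_one⟩⟩
  exact b.zero_of_le_dist (by simpa using hz)

theorem isOpen_disc : IsOpen disc := Metric.isOpen_ball

/-- Only `v` has to be extended by zero. A cutoff equal to 1 on the disc makes `w` compactly
supported without changing its gradient where `v` lives, so `w` needs no boundary condition. -/
theorem crossIdentity_of_contDiff {w : ℂ → ℂ} (hw : ContDiff ℝ 1 w) :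
    CrossIdentity (fun z => fderiv ℝ w z 1) (fun z => fderiv ℝ w z Complex.I) := by
  intro v vx vy h
  obtain ⟨χ, hχ, hχc, hχ1, -⟩ := exists_cutoff
  have hW : ContDiff ℝ 1 (fun z => (χ z : ℂ) * w z) :=
    ((Complex.ofRealCLM.contDiff.comp hχ).of_le (by simp)).mul hw
  have hWc : HasCompactSupport (fun z => (χ z : ℂ) * w z) :=
    (hχc.comp_left (g := ((↑) : ℝ → ℂ)) Complex.ofReal_zero).mul_right
  have hd : ∀ z ∈ disc, fderiv ℝ (fun z => (χ z : ℂ) * w z) z = fderiv ℝ w z := fun z hz => by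
    refine Filter.EventuallyEq.fderiv_eq ?_
    filter_upwards [isOpen_disc.mem_nhds hz] with y hy
    rw [hχ1 y (Metric.ball_subset_closedBall hy)]; simp
  have := h.hasFourierDeriv.integral_del_mul_conj (hasFourierDeriv_of_contDiff hW hWc)
  simp only [indicator_del, indicator_delBar] at this
  rw [integral_indicator_disc_mul_conj, integral_indicator_disc_mul_conj] at this
  refine (integral_congr_disc fun z hz => ?_).trans (this.trans (integral_congr_disc fun z hz => ?_))
  · simp [hd z hz]
  · simp [hd z hz]

/-- When both squares are expanded, the cross terms agree by `CrossIdentity` and the terms in `v`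
alone by `IsZeroTrace.nsq_del`. Hence ‖∂(v+w)‖² - ‖∂̄(v+w)‖² = ‖∂w‖² - ‖∂̄w‖², and the last term is
dropped. -/
theorem IsZeroTrace.nsq_del_add_le {v vx vy wx wy : ℂ → ℂ} (h : IsZeroTrace v vx vy)
    (hwx : MemLp wx 2 discMeasure) (hwy : MemLp wy 2 discMeasure) (hw : CrossIdentity wx wy) :
    nsq (fun z => del (vx z + wx z) (vy z + wy z)) ≤
      nsq (fun z => delBar (vx z + wx z) (vy z + wy z)) + nsq (fun z => del (wx z) (wy z)) := by
  have v1 := memLp_del h.memLp_dx h.memLp_dy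
  have v2 := memLp_delBar h.memLp_dx h.memLp_dy
  have w1 := memLp_del hwx hwy
  have w2 := memLp_delBar hwx hwy
  have s1 := memLp_del (h.memLp_dx.add hwx) (h.memLp_dy.add hwy)
  have s2 := memLp_delBar (h.memLp_dx.add hwx) (h.memLp_dy.add hwy)
  simp only [Pi.add_apply] at s1 s2
  have expand (f g k : ℂ → ℂ) (hf : MemLp f 2 discMeasure) (hg : MemLp g 2 discMeasure)
      (hk : ∀ z, k z = f z + g z) : ∫ z, k z * conj (k z) ∂discMeasure =
      ∫ z, f z * conj (f z) ∂discMeasure + ∫ z, f z * conj (g z) ∂discMeasure +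
      conj (∫ z, f z * conj (g z) ∂discMeasure) + ∫ z, g z * conj (g z) ∂discMeasure := by
    have i1 := integrable_mul_conj hf hf
    have i2 := integrable_mul_conj hf hg
    have i3 : Integrable (fun z => conj (f z * conj (g z))) discMeasure :=
      (integrable_mul_conj hg hf).congr (ae_of_all _ fun z => by simp [mul_comm])
    have i4 := integrable_mul_conj hg hg
    have i12 : Integrable (fun z => f z * conj (f z) + f z * conj (g z)) discMeasure := i1.add i2
    have i123 : Integrable (fun z => f z * conj (f z) + f z * conj (g z) + conj (f z * conj (g z)))
      discMeasure := i12.add i3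
    rw [← integral_conj, ← integral_add i1 i2, ← integral_add i12 i3, ← integral_add i123 i4]
    congr 1; ext z; simp [hk z]; ring
  have e1 := expand _ _ (fun z => del (vx z + wx z) (vy z + wy z)) v1 w1
    (fun z => by simp only [del]; ring)
  have e2 := expand _ _ (fun z => delBar (vx z + wx z) (vy z + wy z)) v2 w2
    (fun z => by simp only [delBar]; ring)
  rw [hw v vx vy h, ← ofReal_nsq s1, ← ofReal_nsq v1, ← ofReal_nsq w1] at e1
  rw [← ofReal_nsq s2, ← ofReal_nsq v2, ← ofReal_nsq w2, ← h.nsq_del] at e2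
  have e3 : ((nsq (fun z => del (vx z + wx z) (vy z + wy z))).toReal : ℂ) =
      ((nsq (fun z => delBar (vx z + wx z) (vy z + wy z))).toReal -
      (nsq fun z => delBar (wx z) (wy z)).toReal + (nsq fun z => del (wx z) (wy z)).toReal : ℝ) := by
    push_cast
    linear_combination e1 - e2
  rw [Complex.ofReal_inj] at e3
  rw [← ENNReal.toReal_le_toReal (nsq_lt_top s1).ne
    (ENNReal.add_ne_top.2 ⟨(nsq_lt_top s2).ne, (nsq_lt_top w1).ne⟩),
    ENNReal.toReal_add (nsq_lt_top s2).ne (nsq_lt_top w1).ne, e3]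
  linarith [ENNReal.toReal_nonneg (a := nsq fun z => delBar (wx z) (wy z))]

theorem memLp_continuous_mul {v φ : ℂ → ℂ} (h : MemLp v 2 discMeasure) (hφ : Continuous φ) :
    MemLp (fun z => φ z * v z) 2 discMeasure := by
  obtain ⟨C, hC⟩ := (isCompact_closedBall (0 : ℂ) 1).exists_bound_of_continuousOn hφ.continuousOn
  refine MemLp.of_le_mul (c := C) h (hφ.aestronglyMeasurable.mul h.1) ?_
  rw [discMeasure]
  filter_upwards [ae_restrict_mem measurableSet_disc] with z hz
  rw [norm_mul]
  gcongr
  exact hC z (Metric.ball_subset_closedBall hz)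

/-- The factor moves to the test function. This is why zero traces are tested against `C¹`
functions: the coefficients of the integrating factor are only `C¹`. -/
theorem IsZeroTrace.contDiff_mul {v vx vy α : ℂ → ℂ} (h : IsZeroTrace v vx vy)
    (hα : ContDiff ℝ 1 α) : IsZeroTrace (fun z => α z * v z)
      (fun z => α z * vx z + fderiv ℝ α z 1 * v z)
      (fun z => α z * vy z + fderiv ℝ α z Complex.I * v z) := by
  have hd (e : ℂ) : Continuous (fun x => fderiv ℝ α x e) :=
    (hα.continuous_fderiv one_ne_zero).clm_apply continuous_const
  have hp (φ : ℂ → ℂ) (hφ : ContDiff ℝ 1 φ) (z e : ℂ) :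
      fderiv ℝ (fun z => α z * φ z) z e = α z * fderiv ℝ φ z e + φ z * fderiv ℝ α z e := by
    rw [fderiv_fun_mul (hα.differentiable one_ne_zero).differentiableAt
      (hφ.differentiable one_ne_zero).differentiableAt]
    simp
  refine ⟨memLp_continuous_mul h.memLp hα.continuous,
    (memLp_continuous_mul h.memLp_dx hα.continuous).add (memLp_continuous_mul h.memLp (hd 1)),
    (memLp_continuous_mul h.memLp_dy hα.continuous).add
      (memLp_continuous_mul h.memLp (hd Complex.I)), fun φ hφ => ?_, fun φ hφ => ?_⟩
  · rw [← h.green_x _ (hα.mul hφ)]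
    congr 1; ext z; rw [hp φ hφ]; ring
  · rw [← h.green_y _ (hα.mul hφ)]
    congr 1; ext z; rw [hp φ hφ]; ring

/-! ### The Poincaré inequality for zero trace functions -/

theorem norm_integral_mul_conj_le {v w : ℂ → ℂ} (hv : MemLp v 2 discMeasure)
    (hw : MemLp w 2 discMeasure) : ‖∫ z, v z * conj (w z) ∂discMeasure‖ ≤
      (eLpNorm v 2 discMeasure).toReal * (eLpNorm w 2 discMeasure).toReal := by
  have e : ∫ z, v z * conj (w z) ∂discMeasure = inner ℂ (hw.toLp w) (hv.toLp v) := by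
    rw [L2.inner_def]
    refine integral_congr_ae ?_
    filter_upwards [hv.coeFn_toLp, hw.coeFn_toLp] with z h1 h2
    rw [h1, h2, RCLike.inner_apply]
  rw [e]
  refine (norm_inner_le_norm _ _).trans ?_
  rw [Lp.norm_toLp, Lp.norm_toLp, mul_comm]

/-- Pairing the x-derivative of `x v` with `v` and using |x| ≤ 1 gives ‖v‖² ≤ 2‖v‖‖v_x‖. Since v_x =
∂v + ∂̄v and the two parts have equal norms, the constant is 2 · 2 = 4. -/
theorem IsZeroTrace.eLpNorm_le {v vx vy : ℂ → ℂ} (h : IsZeroTrace v vx vy) :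
    eLpNorm v 2 discMeasure ≤ 4 * eLpNorm (fun z => del (vx z) (vy z)) 2 discMeasure := by
  have hx : ContDiff ℝ 1 (fun z : ℂ => (z.re : ℂ)) :=
    (Complex.ofRealCLM.comp Complex.reCLM).contDiff
  have hx' (z : ℂ) : fderiv ℝ (fun z : ℂ => (z.re : ℂ)) z 1 = 1 := by
    rw [show (fun z : ℂ => (z.re : ℂ)) = (Complex.ofRealCLM.comp Complex.reCLM) from rfl,
      ContinuousLinearMap.fderiv]
    simp
  have hX := h.contDiff_mul hx
  have e1 := hX.hasFourierDeriv.integral_dx_mul_conj h.hasFourierDeriv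
  rw [integral_indicator_disc_mul_conj, integral_indicator_disc_mul_conj] at e1
  have m1 := memLp_continuous_mul h.memLp_dx hx.continuous
  have m2 := memLp_continuous_mul h.memLp hx.continuous
  have e2 : ∫ z, v z * conj (v z) ∂discMeasure =
      -(∫ z, (z.re * v z) * conj (vx z) ∂discMeasure) -
        ∫ z, (z.re * vx z) * conj (v z) ∂discMeasure := by
    rw [eq_sub_iff_add_eq, ← integral_add (integrable_mul_conj h.memLp h.memLp)
      (integrable_mul_conj m1 h.memLp)]
    refine (integral_congr_disc fun z hz => ?_).trans
      (e1.trans (congrArg Neg.neg (integral_congr_disc fun z hz => ?_)))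
    · simp only [hx', indicator_of_mem hz]; ring
    · simp only [indicator_of_mem hz]
  have b (u : ℂ → ℂ) : eLpNorm (fun z : ℂ => (z.re : ℂ) * u z) 2 discMeasure ≤
      eLpNorm u 2 discMeasure := by
    refine eLpNorm_mono_ae ?_
    rw [discMeasure]
    filter_upwards [ae_restrict_mem measurableSet_disc] with z hz
    rw [norm_mul]
    have h1 : ‖z‖ ≤ 1 := by simpa [disc] using (Metric.ball_subset_closedBall hz)
    have h2 : ‖(z.re : ℂ)‖ ≤ 1 := by
      rw [Complex.norm_real]; exact (Complex.abs_re_le_norm z).trans h1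
    nlinarith [norm_nonneg (u z), norm_nonneg (z.re : ℂ)]
  set N := (eLpNorm v 2 discMeasure).toReal with hN
  set X := (eLpNorm vx 2 discMeasure).toReal with hXd
  have e3 : N ^ 2 ≤ 2 * (N * X) := by
    have e4 : ‖∫ z, v z * conj (v z) ∂discMeasure‖ = N ^ 2 := by
      rw [← ofReal_nsq h.memLp, nsq_eq_eLpNorm_sq, ENNReal.toReal_pow, Complex.norm_real,
        Real.norm_of_nonneg (by positivity)]
    rw [← e4, e2]
    refine (norm_sub_le _ _).trans ?_
    rw [norm_neg, two_mul]
    refine add_le_add ((norm_integral_mul_conj_le m2 h.memLp_dx).trans ?_)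
      ((norm_integral_mul_conj_le m1 h.memLp).trans ?_)
    · gcongr
      exact ENNReal.toReal_mono h.memLp.2.ne (b v)
    · rw [mul_comm]
      gcongr
      exact ENNReal.toReal_mono h.memLp_dx.2.ne (b vx)
  have e5 : N ≤ 2 * X := by
    rcases (ENNReal.toReal_nonneg (a := eLpNorm v 2 discMeasure)).eq_or_lt with h0 | h0
    · rw [hN, ← h0]; positivity
    · rw [← hN] at h0; nlinarith
  have e6 : eLpNorm vx 2 discMeasure ≤ 2 * eLpNorm (fun z => del (vx z) (vy z)) 2 discMeasure := by
    have : vx = (fun z => del (vx z) (vy z)) + (fun z => delBar (vx z) (vy z)) := by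
      ext z; simp [del, delBar]; ring
    have h2 := h.nsq_del
    rw [nsq_eq_eLpNorm_sq, nsq_eq_eLpNorm_sq] at h2
    have h3 : eLpNorm (fun z => del (vx z) (vy z)) 2 discMeasure =
        eLpNorm (fun z => delBar (vx z) (vy z)) 2 discMeasure :=
      (ENNReal.pow_right_strictMono two_ne_zero).injective h2
    have h4 := eLpNorm_add_le (p := 2) (memLp_del h.memLp_dx h.memLp_dy).1
      (memLp_delBar h.memLp_dx h.memLp_dy).1 (by norm_num)
    rwa [← this, ← h3, ← two_mul] at h4
  calc eLpNorm v 2 discMeasure = ENNReal.ofReal N := (ENNReal.ofReal_toReal h.memLp.2.ne).symm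
    _ ≤ ENNReal.ofReal (2 * X) := ENNReal.ofReal_le_ofReal e5
    _ = 2 * eLpNorm vx 2 discMeasure := by
        rw [ENNReal.ofReal_mul (by norm_num), hXd, ENNReal.ofReal_toReal h.memLp_dx.2.ne]; simp
    _ ≤ 2 * (2 * eLpNorm (fun z => del (vx z) (vy z)) 2 discMeasure) := by gcongr
    _ = _ := by rw [← mul_assoc]; norm_num

/-! ### Zero traces: smooth test functions suffice, and limits -/

open scoped ComplexConjugate

open scoped Convolution in
-- Mollification at scale 1/(n+1). The gradient of the convolution is the convolution of the
-- gradient, so values and gradients both converge pointwise and stay bounded, as dominated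
-- convergence requires.
theorem exists_smooth_approx {w : ℂ → ℂ} (hw : ContDiff ℝ 1 w) (hc : HasCompactSupport w) :
    ∃ (W : ℕ → ℂ → ℂ) (C : ℝ), (∀ n, ContDiff ℝ ∞ (W n)) ∧ (∀ n z, ‖W n z‖ ≤ C) ∧
      (∀ n z, ‖fderiv ℝ (W n) z‖ ≤ C) ∧ (∀ z, Tendsto (fun n => W n z) atTop (𝓝 (w z))) ∧
      ∀ z, Tendsto (fun n => fderiv ℝ (W n) z) atTop (𝓝 (fderiv ℝ w z)) := by
  let b : ℕ → ContDiffBump (0 : ℂ) := fun n =>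
    ⟨1 / (n + 2), 1 / (n + 1), by positivity, by gcongr; norm_num⟩
  have hb : Tendsto (fun n => (b n).rOut) atTop (𝓝 0) := tendsto_one_div_add_atTop_nhds_zero_nat
  have hdc := hw.continuous_fderiv one_ne_zero
  obtain ⟨C₁, hC₁⟩ := hw.continuous.bounded_above_of_compact_support hc
  obtain ⟨C₂, hC₂⟩ := hdc.bounded_above_of_compact_support (hc.fderiv ℝ)
  have hL : (ContinuousLinearMap.lsmul ℝ ℝ : ℝ →L[ℝ] ℂ →L[ℝ] ℂ).precompR ℂ =
      (ContinuousLinearMap.lsmul ℝ ℝ : ℝ →L[ℝ] (ℂ →L[ℝ] ℂ) →L[ℝ] (ℂ →L[ℝ] ℂ)) := rfl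
  have hi (n : ℕ) : LocallyIntegrable ((b n).normed volume) volume :=
    (b n).continuous_normed.locallyIntegrable
  let W : ℕ → ℂ → ℂ := fun n => (b n).normed volume ⋆[ContinuousLinearMap.lsmul ℝ ℝ, volume] w
  have hd (n : ℕ) (z : ℂ) : fderiv ℝ (W n) z =
      ((b n).normed volume ⋆[ContinuousLinearMap.lsmul ℝ ℝ, volume] fderiv ℝ w) z := by
    rw [← hL]
    exact (hc.hasFDerivAt_convolution_right _ (hi n) hw z).fderiv
  refine ⟨W, max (2 * C₁ + C₁) (2 * C₂ + C₂), fun n => ?_, fun n z => ?_, fun n z => ?_, fun z => ?_,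
    fun z => ?_⟩
  · exact (b n).hasCompactSupport_normed.contDiff_convolution_left _ (b n).contDiff_normed
      hw.continuous.locallyIntegrable
  · refine le_trans ?_ (le_max_left _ _)
    have h1 := (b n).dist_normed_convolution_le (μ := volume) (x₀ := z) (ε := 2 * C₁)
      hw.continuous.aestronglyMeasurable (fun x _ => by
        rw [dist_eq_norm]; linarith [norm_sub_le (w x) (w z), hC₁ x, hC₁ z])
    rw [dist_eq_norm] at h1
    calc ‖W n z‖ = ‖(W n z - w z) + w z‖ := by rw [sub_add_cancel]
      _ ≤ _ := (norm_add_le _ _).trans (add_le_add h1 (hC₁ z))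
  · refine le_trans ?_ (le_max_right _ _)
    have h1 := (b n).dist_normed_convolution_le (μ := volume) (x₀ := z) (ε := 2 * C₂)
      hdc.aestronglyMeasurable (fun x _ => by
        rw [dist_eq_norm]; linarith [norm_sub_le (fderiv ℝ w x) (fderiv ℝ w z), hC₂ x, hC₂ z])
    rw [dist_eq_norm, ← hd n z] at h1
    calc ‖fderiv ℝ (W n) z‖ = ‖(fderiv ℝ (W n) z - fderiv ℝ w z) + fderiv ℝ w z‖ := by
          rw [sub_add_cancel]
      _ ≤ _ := (norm_add_le _ _).trans (add_le_add h1 (hC₂ z))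
  · exact ContDiffBump.convolution_tendsto_right_of_continuous hb hw.continuous z
  · simp only [hd]
    exact ContDiffBump.convolution_tendsto_right_of_continuous hb hdc z

theorem contDiff_cutoff_mul {χ : ℂ → ℝ} {φ : ℂ → ℂ} (hχ : ContDiff ℝ ∞ χ)
    (hφ : ContDiff ℝ 1 φ) : ContDiff ℝ 1 (fun z => (χ z : ℂ) * φ z) :=
  ((Complex.ofRealCLM.contDiff.comp hχ).of_le (by simp)).mul hφ

theorem fderiv_cutoff_mul {χ : ℂ → ℝ} (hχ1 : ∀ z ∈ Metric.closedBall (0 : ℂ) 1, χ z = 1)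
    (φ : ℂ → ℂ) {z : ℂ} (hz : z ∈ disc) : fderiv ℝ (fun z => (χ z : ℂ) * φ z) z = fderiv ℝ φ z := by
  refine Filter.EventuallyEq.fderiv_eq ?_
  filter_upwards [isOpen_disc.mem_nhds hz] with y hy
  rw [hχ1 y (Metric.ball_subset_closedBall hy)]; simp

/-- Traces are defined with smooth test functions, whereas multiplication by `C¹` coefficients asks
for `C¹` ones. The test function is cut off outside the disc and mollified. -/
theorem green_of_contDiff_infty {e : ℂ} {v w : ℂ → ℂ} (hv : MemLp v 2 discMeasure)
    (hw : MemLp w 2 discMeasure)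
    (h : ∀ φ : ℂ → ℂ, ContDiff ℝ ∞ φ → ∫ z, (w z * φ z + v z * fderiv ℝ φ z e) ∂discMeasure = 0)
    (φ : ℂ → ℂ) (hφ : ContDiff ℝ 1 φ) :
    ∫ z, (w z * φ z + v z * fderiv ℝ φ z e) ∂discMeasure = 0 := by
  obtain ⟨χ, hχ, hχc, hχ1, -⟩ := exists_cutoff
  obtain ⟨W, C, hW, hWb, hWd, hWt, hWdt⟩ := exists_smooth_approx
    (contDiff_cutoff_mul hχ hφ)
    ((hχc.comp_left (g := ((↑) : ℝ → ℂ)) Complex.ofReal_zero).mul_right (f' := φ))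
  have key : Tendsto (fun n => ∫ z, (w z * W n z + v z * fderiv ℝ (W n) z e) ∂discMeasure) atTop
      (𝓝 (∫ z, (w z * φ z + v z * fderiv ℝ φ z e) ∂discMeasure)) := by
    refine tendsto_integral_of_dominated_convergence (fun z => ‖w z‖ * C + ‖v z‖ * (C * ‖e‖))
      (fun n => ?_) ?_ (fun n => ae_of_all _ fun z => ?_) ?_
    · exact (hw.1.mul (hW n).continuous.aestronglyMeasurable).add (hv.1.mul
        (((hW n).continuous_fderiv (by simp)).clm_apply continuous_const).aestronglyMeasurable)
    · exact ((hw.integrable (by norm_num)).norm.mul_const _).add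
        ((hv.integrable (by norm_num)).norm.mul_const _)
    · refine (norm_add_le _ _).trans ?_
      rw [norm_mul, norm_mul]
      have := (fderiv ℝ (W n) z).le_opNorm e
      gcongr
      · exact hWb n z
      · exact this.trans (by gcongr; exact hWd n z)
    · rw [discMeasure]
      filter_upwards [ae_restrict_mem measurableSet_disc] with z hz
      have h1 := hWt z
      have h2 := hWdt z
      rw [hχ1 z (Metric.ball_subset_closedBall hz), Complex.ofReal_one, one_mul] at h1
      rw [fderiv_cutoff_mul hχ1 φ hz] at h2
      exact (h1.const_mul _).add (((ContinuousLinearMap.apply ℝ ℂ e).continuous.tendsto _ |>.comp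
        h2).const_mul _)
  refine tendsto_nhds_unique key ?_
  simp only [h _ (hW _)]
  exact tendsto_const_nhds

theorem green_complex {e : ℂ} {v w : ℂ → ℂ} (hv : MemLp v 2 discMeasure)
    (hw : MemLp w 2 discMeasure)
    (h : ∀ φ : ℂ → ℝ, ContDiff ℝ ∞ φ →
      ∫ z, (w z * (φ z : ℂ) + v z * (fderiv ℝ φ z e : ℂ)) ∂discMeasure = 0)
    (φ : ℂ → ℂ) (hφ : ContDiff ℝ ∞ φ) :
    ∫ z, (w z * φ z + v z * fderiv ℝ φ z e) ∂discMeasure = 0 := by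
  have h1 := Complex.reCLM.contDiff.comp hφ
  have h2 := Complex.imCLM.contDiff.comp hφ
  have hint (ψ : ℂ → ℝ) (hψ : ContDiff ℝ ∞ ψ) :
      Integrable (fun z => w z * (ψ z : ℂ) + v z * (fderiv ℝ ψ z e : ℂ)) discMeasure :=
    (integrable_mul_continuous hw (Complex.continuous_ofReal.comp hψ.continuous)).add
      (integrable_mul_continuous hv (Complex.continuous_ofReal.comp
        ((hψ.continuous_fderiv (by simp)).clm_apply continuous_const)))
  have e1 := h _ h1
  have e2 := h _ h2
  have hd : ∀ z, DifferentiableAt ℝ φ z := fun z => (hφ.differentiable (by simp)).differentiableAt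
  have : ∫ z, (w z * φ z + v z * fderiv ℝ φ z e) ∂discMeasure =
      ∫ z, ((w z * ((Complex.reCLM ∘ φ) z : ℂ) + v z * (fderiv ℝ (Complex.reCLM ∘ φ) z e : ℂ)) +
      Complex.I * (w z * ((Complex.imCLM ∘ φ) z : ℂ) +
        v z * (fderiv ℝ (Complex.imCLM ∘ φ) z e : ℂ))) ∂discMeasure := by
    congr 1; ext z
    rw [fderiv_comp z Complex.reCLM.differentiableAt (hd z),
      fderiv_comp z Complex.imCLM.differentiableAt (hd z), ContinuousLinearMap.fderiv,
      ContinuousLinearMap.fderiv]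
    simp only [Function.comp_apply, ContinuousLinearMap.comp_apply, Complex.reCLM_apply,
      Complex.imCLM_apply]
    conv_lhs => rw [← Complex.re_add_im (φ z), ← Complex.re_add_im (fderiv ℝ φ z e)]
    ring
  rw [this, integral_add (hint _ h1) ((hint _ h2).const_mul _), integral_const_mul, e1, e2]
  simp

theorem isZeroTrace_of_isTrace {v vx vy w wx wy : ℂ → ℂ} {g d : ℝ → ℂ}
    (hv : MemLp v 2 discMeasure) (hvx : MemLp vx 2 discMeasure) (hvy : MemLp vy 2 discMeasure)
    (hw : MemLp w 2 discMeasure) (hwx : MemLp wx 2 discMeasure) (hwy : MemLp wy 2 discMeasure)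
    (hg : IsTrace v vx vy g) (hd : IsTrace w wx wy d) (h : g =ᵐ[angleMeasure] d) :
    IsZeroTrace (fun z => v z - w z) (fun z => vx z - wx z) (fun z => vy z - wy z) := by
  have hint (e : ℂ) (u U : ℂ → ℂ) (hu : MemLp u 2 discMeasure) (hU : MemLp U 2 discMeasure)
      (ψ : ℂ → ℝ) (hψ : ContDiff ℝ ∞ ψ) :
      Integrable (fun z => U z * (ψ z : ℂ) + u z * (fderiv ℝ ψ z e : ℂ)) discMeasure :=
    (integrable_mul_continuous hU (Complex.continuous_ofReal.comp hψ.continuous)).add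
      (integrable_mul_continuous hu (Complex.continuous_ofReal.comp
        ((hψ.continuous_fderiv (by simp)).clm_apply continuous_const)))
  have s : MemLp (fun z => v z - w z) 2 discMeasure := hv.sub hw
  have sx : MemLp (fun z => vx z - wx z) 2 discMeasure := hvx.sub hwx
  have sy : MemLp (fun z => vy z - wy z) 2 discMeasure := hvy.sub hwy
  refine ⟨s, sx, sy, green_of_contDiff_infty s sx (green_complex s sx fun φ hφ => ?_),
    green_of_contDiff_infty s sy (green_complex s sy fun φ hφ => ?_)⟩
  · have e := congrArg₂ (· - ·) (hg.green_x φ hφ) (hd.green_x φ hφ)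
    beta_reduce at e
    have e' : ∫ β, g β * ((φ (Complex.exp (Complex.I * β)) * Real.cos β : ℝ) : ℂ) ∂angleMeasure =
        ∫ β, d β * ((φ (Complex.exp (Complex.I * β)) * Real.cos β : ℝ) : ℂ) ∂angleMeasure :=
      integral_congr_ae (h.mono fun β hβ => by simp only [hβ])
    rw [← integral_sub (hint _ _ _ hv hvx φ hφ) (hint _ _ _ hw hwx φ hφ), e', sub_self] at e
    rw [← e]; congr 1; ext z; ring
  · have e := congrArg₂ (· - ·) (hg.green_y φ hφ) (hd.green_y φ hφ)
    beta_reduce at e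
    have e' : ∫ β, g β * ((φ (Complex.exp (Complex.I * β)) * Real.sin β : ℝ) : ℂ) ∂angleMeasure =
        ∫ β, d β * ((φ (Complex.exp (Complex.I * β)) * Real.sin β : ℝ) : ℂ) ∂angleMeasure :=
      integral_congr_ae (h.mono fun β hβ => by simp only [hβ])
    rw [← integral_sub (hint _ _ _ hv hvy φ hφ) (hint _ _ _ hw hwy φ hφ), e', sub_self] at e
    rw [← e]; congr 1; ext z; ring

theorem tendsto_integral_mul_of_tendsto_eLpNorm {X : Type*} [MeasurableSpace X] {μ : Measure X}
    {F : ℕ → X → ℂ} {f ψ : X → ℂ} (hF : ∀ n, MemLp (F n) 2 μ) (hf : MemLp f 2 μ) (hψ : MemLp ψ 2 μ)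
    (h : Tendsto (fun n => eLpNorm (fun x => F n x - f x) 2 μ) atTop (𝓝 0)) :
    Tendsto (fun n => ∫ x, F n x * ψ x ∂μ) atTop (𝓝 (∫ x, f x * ψ x ∂μ)) := by
  refine tendsto_integral_of_L1' _ (hf.integrable_mul hψ).aestronglyMeasurable
    (Eventually.of_forall fun n => (hF n).integrable_mul hψ) ?_
  have hb : ∀ n, eLpNorm ((fun x => F n x * ψ x) - fun x => f x * ψ x) 1 μ ≤
      eLpNorm (fun x => F n x - f x) 2 μ * eLpNorm ψ 2 μ := fun n => by
    have := eLpNorm_smul_le_mul_eLpNorm (p := 2) (q := 2) (r := 1) hψ.1 ((hF n).sub hf).1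
    refine le_trans (le_of_eq ?_) this
    congr 1
    ext x
    simp [sub_mul]
  refine tendsto_of_tendsto_of_tendsto_of_le_of_le tendsto_const_nhds ?_ (fun _ => zero_le) hb
  simpa using ENNReal.Tendsto.mul_const h (Or.inr hψ.eLpNorm_ne_top)

theorem IsZeroTrace.of_tendsto {V Vx Vy : ℕ → ℂ → ℂ} {v vx vy : ℂ → ℂ}
    (h : ∀ n, IsZeroTrace (V n) (Vx n) (Vy n)) (hv : MemLp v 2 discMeasure)
    (hvx : MemLp vx 2 discMeasure) (hvy : MemLp vy 2 discMeasure)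
    (t : Tendsto (fun n => eLpNorm (fun z => V n z - v z) 2 discMeasure) atTop (𝓝 0))
    (tx : Tendsto (fun n => eLpNorm (fun z => Vx n z - vx z) 2 discMeasure) atTop (𝓝 0))
    (ty : Tendsto (fun n => eLpNorm (fun z => Vy n z - vy z) 2 discMeasure) atTop (𝓝 0)) :
    IsZeroTrace v vx vy := by
  have hc (φ : ℂ → ℂ) (hφ : Continuous φ) : MemLp φ 2 discMeasure := by
    simpa using memLp_continuous_mul (v := fun _ => 1) (memLp_const 1) hφ
  have hd (φ : ℂ → ℂ) (hφ : ContDiff ℝ 1 φ) (e : ℂ) : Continuous (fun z => fderiv ℝ φ z e) :=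
    (hφ.continuous_fderiv one_ne_zero).clm_apply continuous_const
  refine ⟨hv, hvx, hvy, fun φ hφ => ?_, fun φ hφ => ?_⟩
  · have e := (tendsto_integral_mul_of_tendsto_eLpNorm (fun n => (h n).memLp_dx) hvx
      (hc φ hφ.continuous) tx).add (tendsto_integral_mul_of_tendsto_eLpNorm (fun n => (h n).memLp) hv
      (hc _ (hd φ hφ 1)) t)
    rw [← integral_add (integrable_mul_continuous hvx hφ.continuous)
      (integrable_mul_continuous hv (hd φ hφ 1))] at e
    refine tendsto_nhds_unique e ?_
    simp only [← integral_add (integrable_mul_continuous (h _).memLp_dx hφ.continuous)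
      (integrable_mul_continuous (h _).memLp (hd φ hφ 1)), (h _).green_x φ hφ]
    exact tendsto_const_nhds
  · have e := (tendsto_integral_mul_of_tendsto_eLpNorm (fun n => (h n).memLp_dy) hvy
      (hc φ hφ.continuous) ty).add (tendsto_integral_mul_of_tendsto_eLpNorm (fun n => (h n).memLp) hv
      (hc _ (hd φ hφ Complex.I)) t)
    rw [← integral_add (integrable_mul_continuous hvy hφ.continuous)
      (integrable_mul_continuous hv (hd φ hφ Complex.I))] at e
    refine tendsto_nhds_unique e ?_
    simp only [← integral_add (integrable_mul_continuous (h _).memLp_dy hφ.continuous)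
      (integrable_mul_continuous (h _).memLp (hd φ hφ Complex.I)), (h _).green_y φ hφ]
    exact tendsto_const_nhds

theorem IsZeroTrace.sum {V Vx Vy : ℕ → ℂ → ℂ} (h : ∀ k, IsZeroTrace (V k) (Vx k) (Vy k)) (n : ℕ) :
    IsZeroTrace (fun z => ∑ k ∈ Finset.range n, V k z) (fun z => ∑ k ∈ Finset.range n, Vx k z)
      (fun z => ∑ k ∈ Finset.range n, Vy k z) := by
  have hd (φ : ℂ → ℂ) (hφ : ContDiff ℝ 1 φ) (e : ℂ) : Continuous (fun z => fderiv ℝ φ z e) :=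
    (hφ.continuous_fderiv one_ne_zero).clm_apply continuous_const
  refine ⟨memLp_finsetSum _ fun k _ => (h k).memLp, memLp_finsetSum _ fun k _ => (h k).memLp_dx,
    memLp_finsetSum _ fun k _ => (h k).memLp_dy, fun φ hφ => ?_, fun φ hφ => ?_⟩
  · simp only [Finset.sum_mul, ← Finset.sum_add_distrib]
    have hi (k : ℕ) : Integrable (fun z => Vx k z * φ z + V k z * fderiv ℝ φ z 1) discMeasure :=
      (integrable_mul_continuous (h k).memLp_dx hφ.continuous).add
        (integrable_mul_continuous (h k).memLp (hd φ hφ 1))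
    rw [integral_finsetSum _ fun k _ => hi k]
    exact Finset.sum_eq_zero fun k _ => (h k).green_x φ hφ
  · simp only [Finset.sum_mul, ← Finset.sum_add_distrib]
    have hi (k : ℕ) : Integrable (fun z => Vy k z * φ z + V k z * fderiv ℝ φ z Complex.I) discMeasure :=
      (integrable_mul_continuous (h k).memLp_dy hφ.continuous).add
        (integrable_mul_continuous (h k).memLp (hd φ hφ Complex.I))
    rw [integral_finsetSum _ fun k _ => hi k]
    exact Finset.sum_eq_zero fun k _ => (h k).green_y φ hφ

theorem CrossIdentity.sum {Vx Vy : ℕ → ℂ → ℂ} (h : ∀ k, CrossIdentity (Vx k) (Vy k))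
    (hx : ∀ k, MemLp (Vx k) 2 discMeasure) (hy : ∀ k, MemLp (Vy k) 2 discMeasure) (n : ℕ) :
    CrossIdentity (fun z => ∑ k ∈ Finset.range n, Vx k z) (fun z => ∑ k ∈ Finset.range n, Vy k z) := by
  intro v vx vy hv
  have e1 (z : ℂ) : del (∑ k ∈ Finset.range n, Vx k z) (∑ k ∈ Finset.range n, Vy k z) =
      ∑ k ∈ Finset.range n, del (Vx k z) (Vy k z) := by
    simp only [del, Finset.mul_sum, ← Finset.sum_sub_distrib, Finset.sum_div]
  have e2 (z : ℂ) : delBar (∑ k ∈ Finset.range n, Vx k z) (∑ k ∈ Finset.range n, Vy k z) =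
      ∑ k ∈ Finset.range n, delBar (Vx k z) (Vy k z) := by
    simp only [delBar, Finset.mul_sum, ← Finset.sum_add_distrib, Finset.sum_div]
  simp only [e1, e2, map_sum, Finset.mul_sum]
  rw [integral_finsetSum _ fun k _ => integrable_mul_conj (memLp_del hv.memLp_dx hv.memLp_dy)
      (memLp_del (hx k) (hy k)),
    integral_finsetSum _ fun k _ => integrable_mul_conj (memLp_delBar hv.memLp_dx hv.memLp_dy)
      (memLp_delBar (hx k) (hy k))]
  exact Finset.sum_congr rfl fun k _ => h k v vx vy hv

theorem eLpNorm_del_le {v w : ℂ → ℂ} (hv : MemLp v 2 discMeasure) (hw : MemLp w 2 discMeasure) :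
    eLpNorm (fun z => del (v z) (w z)) 2 discMeasure ≤
      eLpNorm v 2 discMeasure + eLpNorm w 2 discMeasure := by
  refine le_trans (eLpNorm_mono (g := fun z => v z + (-Complex.I) * w z) fun z => ?_)
    ((eLpNorm_add_le hv.1 (hw.const_mul _).1 (by norm_num)).trans ?_)
  · simp only [del, norm_div, Complex.norm_ofNat]
    rw [sub_eq_add_neg, ← neg_mul]
    linarith [norm_nonneg (v z + -Complex.I * w z)]
  · gcongr
    exact eLpNorm_mono fun z => by simp

theorem eLpNorm_delBar_le {v w : ℂ → ℂ} (hv : MemLp v 2 discMeasure) (hw : MemLp w 2 discMeasure) :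
    eLpNorm (fun z => delBar (v z) (w z)) 2 discMeasure ≤
      eLpNorm v 2 discMeasure + eLpNorm w 2 discMeasure := by
  have := eLpNorm_del_le hv hw.neg
  simpa [del, delBar] using this

theorem CrossIdentity.of_tendsto {Vx Vy : ℕ → ℂ → ℂ} {wx wy : ℂ → ℂ}
    (h : ∀ n, CrossIdentity (Vx n) (Vy n))
    (hx : ∀ n, MemLp (Vx n) 2 discMeasure) (hy : ∀ n, MemLp (Vy n) 2 discMeasure)
    (hwx : MemLp wx 2 discMeasure) (hwy : MemLp wy 2 discMeasure)
    (tx : Tendsto (fun n => eLpNorm (fun z => Vx n z - wx z) 2 discMeasure) atTop (𝓝 0))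
    (ty : Tendsto (fun n => eLpNorm (fun z => Vy n z - wy z) 2 discMeasure) atTop (𝓝 0)) :
    CrossIdentity wx wy := by
  intro v vx vy hv
  have t := tx.add ty
  rw [add_zero] at t
  have d1 : Tendsto (fun n => eLpNorm (fun z => conj (del (Vx n z) (Vy n z)) -
      conj (del (wx z) (wy z))) 2 discMeasure) atTop (𝓝 0) := by
    refine tendsto_of_tendsto_of_tendsto_of_le_of_le tendsto_const_nhds t (fun n => zero_le)
      fun n => ?_
    refine le_trans (eLpNorm_mono fun z => ?_) (eLpNorm_del_le ((hx n).sub hwx) ((hy n).sub hwy))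
    rw [← map_sub, RCLike.norm_conj]
    refine le_of_eq (congrArg norm ?_)
    simp only [del]; ring
  have d2 : Tendsto (fun n => eLpNorm (fun z => conj (delBar (Vx n z) (Vy n z)) -
      conj (delBar (wx z) (wy z))) 2 discMeasure) atTop (𝓝 0) := by
    refine tendsto_of_tendsto_of_tendsto_of_le_of_le tendsto_const_nhds t (fun n => zero_le)
      fun n => ?_
    refine le_trans (eLpNorm_mono fun z => ?_) (eLpNorm_delBar_le ((hx n).sub hwx) ((hy n).sub hwy))
    rw [← map_sub, RCLike.norm_conj]
    refine le_of_eq (congrArg norm ?_)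
    simp only [delBar]; ring
  have e1 := tendsto_integral_mul_of_tendsto_eLpNorm (fun n => (memLp_del (hx n) (hy n)).star)
    (memLp_del hwx hwy).star (memLp_del hv.memLp_dx hv.memLp_dy) d1
  have e2 := tendsto_integral_mul_of_tendsto_eLpNorm (fun n => (memLp_delBar (hx n) (hy n)).star)
    (memLp_delBar hwx hwy).star (memLp_delBar hv.memLp_dx hv.memLp_dy) d2
  simp only [Pi.star_apply, RCLike.star_def, mul_comm (conj _)] at e1 e2
  refine tendsto_nhds_unique e1 ?_
  simp only [h _ v vx vy hv]
  exact e2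

/-! ### Fourier modes -/

open scoped ComplexConjugate

theorem fourierMode_eq_intervalIntegral (w : ℝ → ℂ) (n : ℤ) : fourierMode w n =
    (1 / (2 * Real.pi) : ℂ) *
      ∫ θ in (-Real.pi)..Real.pi, w θ * Complex.exp (-(Complex.I * n * θ)) := by
  rw [fourierMode, angleMeasure, intervalIntegral.integral_of_le (by linarith [Real.pi_pos])]

theorem fourierMode_congr {v w : ℝ → ℂ} (h : v =ᵐ[angleMeasure] w) (n : ℤ) :
    fourierMode v n = fourierMode w n := by
  rw [fourierMode, fourierMode]
  congr 1
  exact integral_congr_ae (h.mono fun θ hθ => by simp only [hθ])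

theorem norm_exp_neg_I_mul (n : ℤ) (θ : ℝ) : ‖Complex.exp (-(Complex.I * n * θ))‖ = 1 := by
  rw [show -(Complex.I * n * θ) = ((-(n * θ) : ℝ) : ℂ) * Complex.I by push_cast; ring]
  exact Complex.norm_exp_ofReal_mul_I _

theorem continuous_exp_neg_I_mul (n : ℤ) :
    Continuous fun θ : ℝ => Complex.exp (-(Complex.I * n * θ)) := by fun_prop

theorem integrable_mul_exp {w : ℝ → ℂ} (hw : Integrable w angleMeasure) (n : ℤ) :
    Integrable (fun θ => w θ * Complex.exp (-(Complex.I * n * θ))) angleMeasure :=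
  hw.mul_bdd (c := 1) (continuous_exp_neg_I_mul n).aestronglyMeasurable
    (ae_of_all _ fun θ => (norm_exp_neg_I_mul n θ).le)

theorem fourierMode_add {v w : ℝ → ℂ} (hv : Integrable v angleMeasure)
    (hw : Integrable w angleMeasure) (n : ℤ) :
    fourierMode (fun θ => v θ + w θ) n = fourierMode v n + fourierMode w n := by
  simp only [fourierMode, add_mul]
  rw [integral_add (integrable_mul_exp hv n) (integrable_mul_exp hw n), mul_add]

theorem fourierMode_sub {v w : ℝ → ℂ} (hv : Integrable v angleMeasure)
    (hw : Integrable w angleMeasure) (n : ℤ) :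
    fourierMode (fun θ => v θ - w θ) n = fourierMode v n - fourierMode w n := by
  simp only [fourierMode, sub_mul]
  rw [integral_sub (integrable_mul_exp hv n) (integrable_mul_exp hw n), mul_sub]

theorem fourierMode_const_mul (c : ℂ) (w : ℝ → ℂ) (n : ℤ) :
    fourierMode (fun θ => c * w θ) n = c * fourierMode w n := by
  simp only [fourierMode, mul_assoc]
  rw [integral_const_mul]; ring

theorem fourierMode_exp_mul (w : ℝ → ℂ) (m n : ℤ) :
    fourierMode (fun θ => Complex.exp (Complex.I * m * θ) * w θ) n = fourierMode w (n - m) := by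
  simp only [fourierMode]
  congr 2; ext θ
  rw [mul_comm (Complex.exp _), mul_assoc, ← Complex.exp_add]
  congr 2; push_cast; ring

theorem norm_fourierMode_le {w : ℝ → ℂ} {C : ℝ} (h : ∀ θ, ‖w θ‖ ≤ C) (n : ℤ) :
    ‖fourierMode w n‖ ≤ C := by
  have hC : 0 ≤ C := (norm_nonneg _).trans (h 0)
  have h1 : ‖∫ θ, w θ * Complex.exp (-(Complex.I * n * θ)) ∂angleMeasure‖ ≤
      C * angleMeasure.real univ := norm_integral_le_of_norm_le_const
    (ae_of_all _ fun θ => by rw [norm_mul, norm_exp_neg_I_mul, mul_one]; exact h θ)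
  have h2 : angleMeasure.real univ = 2 * Real.pi := by
    rw [angleMeasure, measureReal_restrict_apply_univ, Real.volume_real_Ioc_of_le
      (by linarith [Real.pi_pos])]; ring
  rw [fourierMode, norm_mul, show ‖(1 / (2 * Real.pi) : ℂ)‖ = 1 / (2 * Real.pi) by
    rw [show (1 / (2 * Real.pi) : ℂ) = ((1 / (2 * Real.pi) : ℝ) : ℂ) by push_cast; rfl,
      Complex.norm_real, Real.norm_of_nonneg (by positivity)]]
  rw [h2] at h1
  calc 1 / (2 * Real.pi) * _ ≤ 1 / (2 * Real.pi) * (C * (2 * Real.pi)) := by gcongr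
    _ = C := by field_simp

theorem fourierMode_shift {w : ℝ → ℂ} (hw : Function.Periodic w (2 * Real.pi)) (δ : ℝ) (n : ℤ) :
    fourierMode (fun θ => w (θ + δ)) n = Complex.exp (Complex.I * n * δ) * fourierMode w n := by
  rw [fourierMode_eq_intervalIntegral, fourierMode_eq_intervalIntegral]
  let F : ℝ → ℂ := fun θ => w θ * Complex.exp (-(Complex.I * n * θ))
  have hF : Function.Periodic F (2 * Real.pi) := fun θ => by
    simp only [F, hw θ]
    congr 1
    rw [show -(Complex.I * n * ((θ + 2 * Real.pi : ℝ) : ℂ)) =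
      -(Complex.I * n * θ) + (-n : ℤ) * (2 * Real.pi * Complex.I) by push_cast; ring,
      Complex.exp_add, Complex.exp_int_mul_two_pi_mul_I, mul_one]
  have e : ∀ θ : ℝ, w (θ + δ) * Complex.exp (-(Complex.I * n * θ)) =
      Complex.exp (Complex.I * n * δ) * F (θ + δ) := fun θ => by
    simp only [F]
    rw [mul_left_comm, ← Complex.exp_add]
    congr 2; push_cast; ring
  simp only [e]
  rw [intervalIntegral.integral_const_mul, intervalIntegral.integral_comp_add_right F,
    show Real.pi + δ = (-Real.pi + δ) + 2 * Real.pi by ring,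
    hF.intervalIntegral_add_eq (-Real.pi + δ) (-Real.pi),
    show -Real.pi + 2 * Real.pi = Real.pi by ring]
  ring

/-! ### Bessel's inequality and absolute summability of the modes of Lipschitz functions -/

theorem integral_exp_angle (n : ℤ) : ∫ θ, Complex.exp (Complex.I * n * θ) ∂angleMeasure =
    if n = 0 then 2 * Real.pi else 0 := by
  rw [angleMeasure, ← intervalIntegral.integral_of_le (by linarith [Real.pi_pos])]
  split_ifs with h
  · simp [h]; ring
  · rw [integral_exp_mul_complex (by simp [h]), show Complex.I * n * (Real.pi : ℂ) =
      Complex.I * n * ((-Real.pi : ℝ) : ℂ) + (n : ℤ) * (2 * Real.pi * Complex.I) by push_cast; ring,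
      Complex.exp_add, Complex.exp_int_mul_two_pi_mul_I]
    simp

theorem memLp_exp_angle (n : ℤ) :
    MemLp (fun θ : ℝ => Complex.exp (Complex.I * n * θ)) 2 angleMeasure := by
  refine MemLp.of_bound (by fun_prop) 1 (ae_of_all _ fun θ => ?_)
  have := norm_exp_neg_I_mul (-n) θ
  push_cast at this
  rw [show -(Complex.I * -(n : ℂ) * θ) = Complex.I * n * θ by ring] at this
  exact this.le

/-- The normalized exponential as an element of `L²`. -/
def expLp (n : ℤ) : Lp ℂ 2 angleMeasure := ((√(2 * Real.pi))⁻¹ : ℂ) • (memLp_exp_angle n).toLp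

theorem inner_expLp {w : ℝ → ℂ} (hw : MemLp w 2 angleMeasure) (n : ℤ) :
    inner ℂ (expLp n) (hw.toLp w) = √(2 * Real.pi) * fourierMode w n := by
  rw [expLp, inner_smul_left, L2.inner_def, fourierMode,
    integral_congr_ae (g := fun θ => w θ * Complex.exp (-(Complex.I * n * θ)))]
  · have : ((√(2 * Real.pi) : ℝ) : ℂ) * (√(2 * Real.pi) : ℝ) = 2 * Real.pi := by
      rw [← Complex.ofReal_mul, Real.mul_self_sqrt (by positivity)]; push_cast; ring
    have h0 : ((√(2 * Real.pi) : ℝ) : ℂ) ≠ 0 := by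
      rw [Complex.ofReal_ne_zero]; positivity
    rw [map_inv₀, Complex.conj_ofReal, ← mul_assoc]
    congr 1
    rw [← this]; field_simp
  · filter_upwards [hw.coeFn_toLp, (memLp_exp_angle n).coeFn_toLp] with θ h1 h2
    rw [h1, h2, RCLike.inner_apply]
    congr 1
    rw [← Complex.exp_conj]
    simp

theorem orthonormal_expLp : Orthonormal ℂ expLp := by
  rw [orthonormal_iff_ite]
  intro m n
  rw [show expLp n = ((√(2 * Real.pi))⁻¹ : ℂ) • (memLp_exp_angle n).toLp from rfl, inner_smul_right,
    inner_expLp, fourierMode]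
  have h0 : ((√(2 * Real.pi) : ℝ) : ℂ) ≠ 0 := by rw [Complex.ofReal_ne_zero]; positivity
  have e : ∀ θ : ℝ, Complex.exp (Complex.I * n * θ) * Complex.exp (-(Complex.I * m * θ)) =
      Complex.exp (Complex.I * (n - m : ℤ) * θ) := fun θ => by
    rw [← Complex.exp_add]; congr 1; push_cast; ring
  simp only [e]
  rw [integral_exp_angle]
  have h1 : (Real.pi : ℂ) ≠ 0 := Complex.ofReal_ne_zero.2 Real.pi_ne_zero
  by_cases h : m = n
  · simp only [h, sub_self, if_true]; field_simp; push_cast; rfl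
  · rw [if_neg h, if_neg (by omega)]; simp

theorem sum_sq_fourierMode_le {w : ℝ → ℂ} (hw : MemLp w 2 angleMeasure) (s : Finset ℤ) :
    2 * Real.pi * ∑ n ∈ s, ‖fourierMode w n‖ ^ 2 ≤ (eLpNorm w 2 angleMeasure).toReal ^ 2 := by
  have := orthonormal_expLp.sum_inner_products_le (s := s) (hw.toLp w)
  rw [Lp.norm_toLp] at this
  refine le_trans (le_of_eq ?_) this
  rw [Finset.mul_sum]
  refine Finset.sum_congr rfl fun n _ => ?_
  rw [inner_expLp, norm_mul, mul_pow, Complex.norm_real, Real.norm_of_nonneg (by positivity),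
    Real.sq_sqrt (by positivity)]

theorem eLpNorm_angle_sq (w : ℝ → ℂ) :
    eLpNorm w 2 angleMeasure ^ 2 = ∫⁻ θ, ‖w θ‖ₑ ^ 2 ∂angleMeasure := by
  rw [eLpNorm_eq_lintegral_rpow_enorm_toReal (by norm_num) (by norm_num),
    ← ENNReal.rpow_natCast, ← ENNReal.rpow_mul]
  simp

theorem tsum_enorm_fourierMode_sq_le {w : ℝ → ℂ} (hw : MemLp w 2 angleMeasure) :
    ∑' n : ℤ, ‖fourierMode w n‖ₑ ^ 2 ≤ ∫⁻ θ, ‖w θ‖ₑ ^ 2 ∂angleMeasure := by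
  rw [← eLpNorm_angle_sq]
  refine ENNReal.summable.tsum_le_of_sum_le fun s => ?_
  have h1 := sum_sq_fourierMode_le hw s
  have h2 : ∑ n ∈ s, ‖fourierMode w n‖ ^ 2 ≤ (eLpNorm w 2 angleMeasure).toReal ^ 2 := by
    have h0 : 0 ≤ ∑ n ∈ s, ‖fourierMode w n‖ ^ 2 := by positivity
    nlinarith [Real.pi_gt_three]
  have h3 := ENNReal.ofReal_le_ofReal h2
  rw [ENNReal.ofReal_sum_of_nonneg (fun _ _ => by positivity), ENNReal.ofReal_pow
    ENNReal.toReal_nonneg, ENNReal.ofReal_toReal hw.2.ne] at h3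
  simpa only [ENNReal.ofReal_pow (norm_nonneg _), ofReal_norm] using h3

/-- The modes of w(· + δ) - w are (e^{inδ} - 1) w_n, and this difference is at most L|δ|. Bessel's
inequality, division by δ² and the limit δ → 0 give the bound without differentiating `w`. -/
theorem sum_sq_mul_fourierMode_le {w : ℝ → ℂ} (hw : Function.Periodic w (2 * Real.pi)) {L : ℝ}
    (hL : ∀ θ t, ‖w θ - w t‖ ≤ L * |θ - t|) (s : Finset ℤ) :
    ∑ n ∈ s, (n : ℝ) ^ 2 * ‖fourierMode w n‖ ^ 2 ≤ L ^ 2 := by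
  have hLn : 0 ≤ L := by simpa using (norm_nonneg _).trans (hL 1 0)
  have hc : Continuous w := by
    refine LipschitzWith.continuous (K := ⟨L, hLn⟩) (LipschitzWith.of_dist_le_mul fun θ t => ?_)
    rw [dist_eq_norm, Real.dist_eq]; exact hL θ t
  have hm (δ : ℝ) : MemLp (fun θ => w (θ + δ) - w θ) 2 angleMeasure :=
    MemLp.of_bound (by fun_prop) (L * |δ|) (ae_of_all _ fun θ => by simpa using hL (θ + δ) θ)
  have hint : Integrable w angleMeasure := by
    have := hc.integrableOn_Ioc (a := -Real.pi) (b := Real.pi) (μ := volume)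
    exact this
  have hint' (δ : ℝ) : Integrable (fun θ => w (θ + δ)) angleMeasure := by
    have : Continuous fun θ => w (θ + δ) := by fun_prop
    exact this.integrableOn_Ioc (a := -Real.pi) (b := Real.pi) (μ := volume)
  have key (δ : ℝ) : ∑ n ∈ s, ‖Complex.exp (Complex.I * n * δ) - 1‖ ^ 2 * ‖fourierMode w n‖ ^ 2 ≤
      L ^ 2 * δ ^ 2 := by
    have h1 := sum_sq_fourierMode_le (hm δ) s
    have h2 : (eLpNorm (fun θ => w (θ + δ) - w θ) 2 angleMeasure).toReal ^ 2 ≤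
        2 * Real.pi * (L ^ 2 * δ ^ 2) := by
      rw [← ENNReal.toReal_pow, eLpNorm_angle_sq]
      refine ENNReal.toReal_le_of_le_ofReal (by positivity) ?_
      calc ∫⁻ θ, ‖w (θ + δ) - w θ‖ₑ ^ 2 ∂angleMeasure
          ≤ ∫⁻ _, ENNReal.ofReal (L ^ 2 * δ ^ 2) ∂angleMeasure := by
            refine lintegral_mono fun θ => ?_
            rw [← ofReal_norm, ← ENNReal.ofReal_pow (norm_nonneg _)]
            refine ENNReal.ofReal_le_ofReal ?_
            have := hL (θ + δ) θ
            rw [add_sub_cancel_left] at this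
            calc _ ≤ (L * |δ|) ^ 2 := by gcongr
              _ = _ := by rw [mul_pow, sq_abs]
        _ = _ := by
            rw [lintegral_const, angleMeasure, Measure.restrict_apply_univ, Real.volume_Ioc,
              ← ENNReal.ofReal_mul (by positivity)]
            congr 1; ring
    have h3 := h1.trans h2
    have h4 : ∑ n ∈ s, ‖fourierMode (fun θ => w (θ + δ) - w θ) n‖ ^ 2 ≤ L ^ 2 * δ ^ 2 := by
      have := Real.pi_pos
      by_contra hcon
      push Not at hcon
      have := mul_lt_mul_of_pos_left hcon (show 0 < 2 * Real.pi by positivity)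
      linarith
    refine le_trans (le_of_eq (Finset.sum_congr rfl fun n _ => ?_)) h4
    rw [fourierMode_sub (hint' δ) hint, fourierMode_shift hw, ← mul_pow, ← norm_mul, sub_mul,
      one_mul]
  have lim : Tendsto (fun δ : ℝ => ∑ n ∈ s, (‖Complex.exp (Complex.I * n * δ) - 1‖ / ‖δ‖) ^ 2 *
      ‖fourierMode w n‖ ^ 2) (𝓝[≠] 0) (𝓝 (∑ n ∈ s, (n : ℝ) ^ 2 * ‖fourierMode w n‖ ^ 2)) := by
    refine tendsto_finsetSum _ fun n _ => Tendsto.mul_const _ ?_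
    have hd : HasDerivAt (fun δ : ℝ => Complex.exp (Complex.I * n * δ)) (Complex.I * n) 0 := by
      have := ((Complex.ofRealCLM.hasDerivAt (x := 0)).const_mul (Complex.I * n)).cexp
      simpa using this
    have := (hasDerivAt_iff_tendsto_slope.1 hd).norm.pow 2
    have e : ‖Complex.I * (n : ℂ)‖ ^ 2 = (n : ℝ) ^ 2 := by simp
    rw [e] at this
    refine this.congr fun δ => ?_
    simp [slope_def_module, div_eq_inv_mul]
  refine le_of_tendsto lim ?_
  filter_upwards [self_mem_nhdsWithin] with δ hδ
  have hδ2 : 0 < δ ^ 2 := by have : δ ≠ 0 := hδ; positivity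
  have h5 := key δ
  rw [← div_le_iff₀ hδ2] at h5
  refine le_trans (le_of_eq ?_) h5
  rw [Finset.sum_div]
  refine Finset.sum_congr rfl fun n _ => ?_
  rw [div_pow, Real.norm_eq_abs, sq_abs]; ring

/-- The value of `∑ 1 / (n + 1)²`. -/
def invSqSum : ℝ := ∑' n : ℕ, 1 / ((n : ℝ) + 1) ^ 2

theorem summable_inv_sq : Summable fun n : ℕ => 1 / ((n : ℝ) + 1) ^ 2 := by
  have := (summable_nat_add_iff 1).2 (Real.summable_one_div_nat_pow.2 one_lt_two)
  simpa using this

/-- For x = |w_{n+1}|, 2x ≤ ((n+1)x)² + (n+1)^{-2}, and both terms on the right have bounded sums.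
-/
theorem sum_norm_fourierMode_le {w : ℝ → ℂ} (hw : Function.Periodic w (2 * Real.pi)) {L : ℝ}
    (hL : ∀ θ t, ‖w θ - w t‖ ≤ L * |θ - t|) (N : ℕ) :
    ∑ n ∈ Finset.range N, ‖fourierMode w (n + 1)‖ ≤ L ^ 2 + invSqSum := by
  have h1 : ∑ n ∈ Finset.range N, ((n : ℝ) + 1) ^ 2 * ‖fourierMode w (n + 1)‖ ^ 2 ≤ L ^ 2 := by
    have h := sum_sq_mul_fourierMode_le hw hL
      ((Finset.range N).map ⟨fun n : ℕ => (n : ℤ) + 1, fun a b h => by simpa using h⟩)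
    rw [Finset.sum_map] at h
    refine le_trans (le_of_eq (Finset.sum_congr rfl fun n _ => ?_)) h
    change _ = (((n : ℤ) + 1 : ℤ) : ℝ) ^ 2 * _
    push_cast
    rfl
  have h2 : ∑ n ∈ Finset.range N, 1 / ((n : ℝ) + 1) ^ 2 ≤ invSqSum :=
    summable_inv_sq.sum_le_tsum _ fun n _ => by positivity
  refine le_trans ?_ (add_le_add h1 h2)
  rw [← Finset.sum_add_distrib]
  refine Finset.sum_le_sum fun n _ => ?_
  set x := ‖fourierMode w (n + 1)‖
  have hx : 0 ≤ x := norm_nonneg _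
  have hn : (0 : ℝ) < n + 1 := by positivity
  have e : x = ((n : ℝ) + 1) * x * (1 / ((n : ℝ) + 1)) := by field_simp
  have := two_mul_le_add_sq (((n : ℝ) + 1) * x) (1 / ((n : ℝ) + 1))
  rw [mul_assoc, ← e, mul_pow, div_pow, one_pow] at this
  linarith

/-! ### Decay of the modes of the scattering kernel -/

theorem fourierMode_deriv {w w' : ℝ → ℂ} (hd : ∀ θ, HasDerivAt w (w' θ) θ) (hc : Continuous w')
    (hw : Function.Periodic w (2 * Real.pi)) (n : ℤ) :
    fourierMode w' n = Complex.I * n * fourierMode w n := by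
  have he (θ : ℝ) : HasDerivAt (fun θ : ℝ => Complex.exp (-(Complex.I * n * θ)))
      (-(Complex.I * n) * Complex.exp (-(Complex.I * n * θ))) θ := by
    have := ((Complex.ofRealCLM.hasDerivAt (x := θ)).const_mul (Complex.I * n)).neg.cexp
    refine this.congr_deriv ?_
    simp only [Pi.neg_apply, Complex.ofRealCLM_apply, Complex.ofReal_one]
    ring
  have := intervalIntegral.integral_deriv_mul_eq_sub (a := -Real.pi) (b := Real.pi)
    (fun θ _ => hd θ) (fun θ _ => he θ) (hc.intervalIntegrable _ _)
    (Continuous.intervalIntegrable (by fun_prop) _ _)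
  have hwc : Continuous w := continuous_iff_continuousAt.2 fun θ => (hd θ).continuousAt
  have hb : w Real.pi * Complex.exp (-(Complex.I * n * (Real.pi : ℝ))) =
      w (-Real.pi) * Complex.exp (-(Complex.I * n * ((-Real.pi : ℝ) : ℂ))) := by
    rw [show w Real.pi = w (-Real.pi) by rw [← hw (-Real.pi)]; congr 1; ring,
      show -(Complex.I * n * ((-Real.pi : ℝ) : ℂ)) =
      -(Complex.I * n * Real.pi) + (n : ℤ) * (2 * Real.pi * Complex.I) by push_cast; ring,
      Complex.exp_add, Complex.exp_int_mul_two_pi_mul_I, mul_one]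
  rw [hb, sub_self, intervalIntegral.integral_add
    (Continuous.intervalIntegrable (by fun_prop) _ _)
    (Continuous.intervalIntegrable (by fun_prop) _ _)] at this
  simp only [mul_left_comm (w _)] at this
  rw [intervalIntegral.integral_const_mul] at this
  rw [fourierMode_eq_intervalIntegral, fourierMode_eq_intervalIntegral]
  linear_combination (1 / (2 * Real.pi) : ℂ) * this

/-- Translation by π/n reverses the sign of the n-th mode, so -2w_n is a mode of w(· + π/n) - w,
which is small by Hölder continuity. -/
theorem norm_fourierMode_le_of_holder {w : ℝ → ℂ} (hc : Continuous w)
    (hw : Function.Periodic w (2 * Real.pi)) {C s : ℝ}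
    (hH : ∀ θ t, ‖w θ - w t‖ ≤ C * |θ - t| ^ s) {n : ℤ} (hn : n ≠ 0) :
    ‖fourierMode w n‖ ≤ C * |Real.pi / n| ^ s := by
  have hi : Integrable w angleMeasure := hc.integrableOn_Ioc (a := -Real.pi) (b := Real.pi)
  have hi' : Integrable (fun θ => w (θ + Real.pi / n)) angleMeasure := by
    have : Continuous fun θ => w (θ + Real.pi / n) := by fun_prop
    exact this.integrableOn_Ioc (a := -Real.pi) (b := Real.pi)
  have h1 := norm_fourierMode_le (w := fun θ => w (θ + Real.pi / n) - w θ)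
    (C := C * |Real.pi / n| ^ s) (fun θ => by simpa using hH (θ + Real.pi / n) θ) n
  have hn' : (n : ℂ) ≠ 0 := Int.cast_ne_zero.2 hn
  rw [fourierMode_sub hi' hi, fourierMode_shift hw,
    show Complex.I * n * ((Real.pi / n : ℝ) : ℂ) = Real.pi * Complex.I by
      push_cast; field_simp, Complex.exp_pi_mul_I,
    show -1 * fourierMode w n - fourierMode w n = -2 * fourierMode w n by ring, norm_mul] at h1
  have : ‖(-2 : ℂ)‖ = 2 := by simp
  rw [this] at h1
  linarith [norm_nonneg (fourierMode w n)]

/-- Integration by parts gains one power of n, and the Hölder continuity of the derivative gains s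
more. -/
theorem exists_kernelMode_bound {s : ℝ} (hs : 0 < s) {k : ℂ → ℝ → ℝ} (hk : IsC1HolderKernel s k) :
    ∃ C : ℝ, 0 ≤ C ∧ ∀ n : ℕ, ∀ z ∈ disc,
      ‖kernelMode k (-(n : ℤ)) z‖ ≤ C * ((n : ℝ) + 1) ^ (-(1 + s)) := by
  obtain ⟨k', C, hd, hb, hb', hH⟩ := hk
  have h0 : (0 : ℂ) ∈ disc := by simp [disc]
  have hC : 0 ≤ C := (abs_nonneg _).trans ((hb 0).1 0 h0)
  -- The summand 1 covers n = 0. For n ≥ 1, π^s comes from the translation by π/n and 2^{1+s} from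
  -- 1/n ≤ 2/(n+1).
  refine ⟨C * (1 + Real.pi ^ s * 2 ^ (1 + s)), by positivity, fun n z hz => ?_⟩
  rcases Nat.eq_zero_or_pos n with rfl | hn
  · have : ‖kernelMode k (-((0 : ℕ) : ℤ)) z‖ ≤ C := norm_fourierMode_le (fun θ => by
      rw [Complex.norm_real]; exact (hb θ).1 z hz) _
    refine this.trans ?_
    simp only [Nat.cast_zero, zero_add, Real.one_rpow, mul_one]
    have : 0 ≤ Real.pi ^ s * 2 ^ (1 + s) := by positivity
    nlinarith
  have hd' (θ : ℝ) : HasDerivAt (fun t : ℝ => (k z (Real.cos t) : ℂ)) (k' z θ : ℂ) θ :=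
    (hd z hz θ).ofReal_comp
  have hH' (θ t : ℝ) : ‖(k' z θ : ℂ) - k' z t‖ ≤ C * |θ - t| ^ s := by
    rw [← Complex.ofReal_sub, Complex.norm_real]; exact (hH θ t).1 z hz
  have hper : Function.Periodic (fun t : ℝ => (k z (Real.cos t) : ℂ)) (2 * Real.pi) := fun t => by
    simp only [Real.cos_add_two_pi]
  have hper' : Function.Periodic (fun t : ℝ => (k' z t : ℂ)) (2 * Real.pi) := fun t => by
    have h1 := (hd' (t + 2 * Real.pi)).scomp t ((hasDerivAt_id t).add_const (2 * Real.pi))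
    have h2 : HasDerivAt (fun t : ℝ => (k z (Real.cos t) : ℂ))
        ((1 : ℝ) • (k' z (t + 2 * Real.pi) : ℂ)) t := by
      refine h1.congr_of_eventuallyEq (Eventually.of_forall fun x => ?_)
      simp [Function.comp_apply]
    have := h2.unique (hd' t)
    simpa using this
  have hcont : Continuous (fun t : ℝ => (k' z t : ℂ)) := by
    refine continuous_iff_continuousAt.2 fun t => tendsto_iff_norm_sub_tendsto_zero.2 ?_
    have hz : Tendsto (fun θ : ℝ => C * |θ - t| ^ s) (𝓝 t) (𝓝 0) := by
      have : ContinuousAt (fun θ : ℝ => C * |θ - t| ^ s) t := by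
        refine continuousAt_const.mul (ContinuousAt.rpow_const (by fun_prop) (Or.inr hs.le))
      have h2 := this.tendsto
      simpa [Real.zero_rpow hs.ne'] using h2
    exact squeeze_zero (fun θ => norm_nonneg _) (fun θ => hH' θ t) hz
  have hn0 : (-(n : ℤ)) ≠ 0 := by omega
  have e1 := fourierMode_deriv hd' hcont hper (-(n : ℤ))
  have e2 := norm_fourierMode_le_of_holder hcont hper' hH' hn0
  have hnr : (0 : ℝ) < n := by exact_mod_cast hn
  rw [e1, norm_mul, norm_mul, Complex.norm_I, one_mul] at e2
  have e3 : ‖((-(n : ℤ) : ℤ) : ℂ)‖ = n := by simp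
  have e4 : |Real.pi / ((-(n : ℤ) : ℤ) : ℝ)| = Real.pi * (n : ℝ)⁻¹ := by
    push_cast
    rw [div_neg, abs_neg, abs_of_pos (by positivity), div_eq_mul_inv]
  rw [e3, e4, Real.mul_rpow Real.pi_pos.le (by positivity)] at e2
  have e5 : ((n : ℝ)⁻¹) ≤ 2 * ((n : ℝ) + 1)⁻¹ := by
    have : (1 : ℝ) ≤ n := by exact_mod_cast hn
    rw [← div_eq_mul_inv, inv_eq_one_div, div_le_div_iff₀ hnr (by positivity)]; linarith
  have e6 : (n : ℝ)⁻¹ * ((n : ℝ)⁻¹) ^ s ≤ 2 ^ (1 + s) * ((n : ℝ) + 1) ^ (-(1 + s)) := by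
    calc (n : ℝ)⁻¹ * ((n : ℝ)⁻¹) ^ s = ((n : ℝ)⁻¹) ^ (1 + s) := by
          rw [Real.rpow_add (by positivity), Real.rpow_one]
      _ ≤ (2 * ((n : ℝ) + 1)⁻¹) ^ (1 + s) := by gcongr
      _ = _ := by
          rw [Real.mul_rpow (by norm_num) (by positivity), Real.inv_rpow (by positivity),
            Real.rpow_neg (by positivity)]
  have e7 : ‖kernelMode k (-(n : ℤ)) z‖ ≤ C * Real.pi ^ s * ((n : ℝ)⁻¹ * ((n : ℝ)⁻¹) ^ s) := by
    rw [kernelMode, ← mul_le_mul_iff_right₀ hnr]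
    refine e2.trans (le_of_eq ?_)
    field_simp
  refine e7.trans ((mul_le_mul_of_nonneg_left e6 (by positivity)).trans ?_)
  have : 0 ≤ C * ((n : ℝ) + 1) ^ (-(1 + s)) := by positivity
  nlinarith

/-! ### The angular modes of a solution of the transport equation -/

open scoped ComplexConjugate

/-- After Fubini the inner integral is a mode of a translate of `K`, which is a phase times the mode
of `K`. -/
theorem fourierMode_conv {K w : ℝ → ℂ} (hK : Continuous K) (hp : Function.Periodic K (2 * Real.pi))
    (hw : Integrable w angleMeasure) (n : ℤ) :
    fourierMode (fun θ => 1 / (2 * Real.pi) * ∫ t, K (θ - t) * w t ∂angleMeasure) n =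
      fourierMode K n * fourierMode w n := by
  have hKb : ∃ C, ∀ θ, ‖K θ‖ ≤ C := by
    obtain ⟨C, hC⟩ := isCompact_Icc.exists_bound_of_continuousOn (s := Icc 0 (2 * Real.pi))
      hK.continuousOn
    refine ⟨C, fun θ => ?_⟩
    obtain ⟨t, ht, h⟩ := hp.exists_mem_Ico₀ Real.two_pi_pos θ
    rw [h]; exact hC t ⟨ht.1, ht.2.le⟩
  obtain ⟨C, hC⟩ := hKb
  have hI : Integrable (Function.uncurry fun (θ t : ℝ) =>
      K (θ - t) * w t * Complex.exp (-(Complex.I * n * θ))) (angleMeasure.prod angleMeasure) := by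
    have h1 : Integrable (fun p : ℝ × ℝ => w p.2) (angleMeasure.prod angleMeasure) :=
      hw.comp_snd angleMeasure
    have h2 := h1.mul_bdd (c := C) (f := fun p : ℝ × ℝ => w p.2)
      (g := fun p : ℝ × ℝ => K (p.1 - p.2) * Complex.exp (-(Complex.I * n * p.1)))
      (by fun_prop) (ae_of_all _ fun p => by
        rw [norm_mul, norm_exp_neg_I_mul, mul_one]; exact hC _)
    refine h2.congr (ae_of_all _ fun p => ?_)
    simp only [Function.uncurry]; ring
  have hpi : (Real.pi : ℂ) ≠ 0 := Complex.ofReal_ne_zero.2 Real.pi_ne_zero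
  have hin (t : ℝ) : ∫ θ, K (θ - t) * w t * Complex.exp (-(Complex.I * n * θ)) ∂angleMeasure =
      w t * (Complex.exp (-(Complex.I * n * t)) * (2 * Real.pi * fourierMode K n)) := by
    have h := fourierMode_shift hp (-t) n
    rw [fourierMode] at h
    simp only [← sub_eq_add_neg] at h
    rw [show Complex.I * n * ((-t : ℝ) : ℂ) = -(Complex.I * n * t) by push_cast; ring] at h
    rw [show (fun θ : ℝ => K (θ - t) * w t * Complex.exp (-(Complex.I * n * θ))) = fun θ =>
      w t * (K (θ - t) * Complex.exp (-(Complex.I * n * θ))) by ext θ; ring, integral_const_mul]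
    congr 1
    field_simp at h
    rw [h]; ring
  rw [fourierMode_const_mul, fourierMode]
  simp only [← integral_mul_const]
  rw [integral_integral_swap hI]
  have e : ∫ t, ∫ θ, K (θ - t) * w t * Complex.exp (-(Complex.I * n * θ)) ∂angleMeasure
      ∂angleMeasure = (∫ t, w t * Complex.exp (-(Complex.I * n * t)) ∂angleMeasure) *
        (2 * Real.pi * fourierMode K n) := by
    rw [← integral_mul_const]
    congr 1; ext t; rw [hin]; ring
  rw [e, show fourierMode w n = 1 / (2 * Real.pi) *
    ∫ θ, w θ * Complex.exp (-(Complex.I * n * θ)) ∂angleMeasure from rfl]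
  field_simp

theorem fourierMode_cos_mul {w : ℝ → ℂ} (hw : Integrable w angleMeasure) (n : ℤ) :
    fourierMode (fun θ => Real.cos θ * w θ) n =
      (fourierMode w (n - 1) + fourierMode w (n + 1)) / 2 := by
  have hi (m : ℤ) : Integrable (fun θ : ℝ => Complex.exp (Complex.I * m * θ) * w θ)
      angleMeasure := by
    refine (integrable_mul_exp hw (-m)).congr (ae_of_all _ fun θ => ?_)
    push_cast
    rw [mul_comm]; congr 2; ring
  have e : (fun θ : ℝ => (Real.cos θ : ℂ) * w θ) = fun θ : ℝ =>
      1 / 2 * (Complex.exp (Complex.I * (1 : ℤ) * θ) * w θ +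
        Complex.exp (Complex.I * (-1 : ℤ) * θ) * w θ) := by
    ext θ
    rw [Complex.ofReal_cos, Complex.cos]
    push_cast
    rw [show Complex.I * 1 * (θ : ℂ) = θ * Complex.I by ring,
      show Complex.I * -1 * (θ : ℂ) = -θ * Complex.I by ring]
    ring
  rw [e, fourierMode_const_mul, fourierMode_add (hi 1) (hi (-1)), fourierMode_exp_mul,
    fourierMode_exp_mul, sub_neg_eq_add]
  ring

theorem fourierMode_sin_mul {w : ℝ → ℂ} (hw : Integrable w angleMeasure) (n : ℤ) :
    fourierMode (fun θ => Real.sin θ * w θ) n =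
      Complex.I * (fourierMode w (n + 1) - fourierMode w (n - 1)) / 2 := by
  have hi (m : ℤ) : Integrable (fun θ : ℝ => Complex.exp (Complex.I * m * θ) * w θ)
      angleMeasure := by
    refine (integrable_mul_exp hw (-m)).congr (ae_of_all _ fun θ => ?_)
    push_cast
    rw [mul_comm]; congr 2; ring
  have e : (fun θ : ℝ => (Real.sin θ : ℂ) * w θ) = fun θ : ℝ =>
      Complex.I / 2 * (Complex.exp (Complex.I * (-1 : ℤ) * θ) * w θ -
        Complex.exp (Complex.I * (1 : ℤ) * θ) * w θ) := by
    ext θ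
    rw [Complex.ofReal_sin, Complex.sin]
    push_cast
    rw [show Complex.I * 1 * (θ : ℂ) = θ * Complex.I by ring,
      show Complex.I * -1 * (θ : ℂ) = -θ * Complex.I by ring]
    ring
  rw [e, fourierMode_const_mul, fourierMode_sub (hi (-1)) (hi 1), fourierMode_exp_mul,
    fourierMode_exp_mul, sub_neg_eq_add]
  ring

theorem fourierMode_const (c : ℂ) (n : ℤ) : fourierMode (fun _ => c) n = if n = 0 then c else 0 := by
  have hpi : (Real.pi : ℂ) ≠ 0 := Complex.ofReal_ne_zero.2 Real.pi_ne_zero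
  have h := integral_exp_angle (-n)
  rw [fourierMode, integral_const_mul]
  rw [show (fun θ : ℝ => Complex.exp (-(Complex.I * n * θ))) = fun θ : ℝ =>
    Complex.exp (Complex.I * (-n : ℤ) * θ) by ext θ; congr 1; push_cast; ring, h]
  simp only [neg_eq_zero]
  split_ifs
  · push_cast; field_simp
  · simp

theorem fourierMode_neg_of_real (w : ℝ → ℝ) (n : ℤ) :
    fourierMode (fun θ => (w θ : ℂ)) (-n) = conj (fourierMode (fun θ => (w θ : ℂ)) n) := by
  rw [fourierMode, fourierMode, map_mul, ← integral_conj]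
  congr 1
  · simp [Complex.conj_ofNat]
  · congr 1; ext θ
    rw [map_mul, Complex.conj_ofReal, ← Complex.exp_conj]
    simp

theorem ae_memLp_slice {u : ℂ → ℝ → ℝ}
    (h : MemLp (Function.uncurry u) 2 (discMeasure.prod angleMeasure)) :
    ∀ᵐ z ∂discMeasure, MemLp (fun θ => (u z θ : ℂ)) 2 angleMeasure := by
  have h1 := h.integrable_norm_pow (by norm_num)
  filter_upwards [h1.prod_right_ae, h.1.prodMk_left] with z h2 h3
  refine MemLp.ofReal ?_
  exact (memLp_two_iff_integrable_sq h3).2 (by simpa [Function.uncurry] using h2)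

/-- Since θ·∇ = e^{-iθ}∂̄ + e^{iθ}∂, its n-th mode couples ∂̄ of mode n+1 with ∂ of mode n-1.
Scattering is a convolution in the angle, hence diagonal in the modes. -/
theorem transport_modes {a : ℂ → ℝ} {k : ℂ → ℝ → ℝ} {s : ℝ} (hk : IsC1HolderKernel s k)
    {f : ℂ → ℝ} {u ux uy uθ : ℂ → ℝ → ℝ} (hu : IsH1Phase u ux uy uθ)
    (hfu : IsTransportSolution a k f u ux uy) :
    ∀ᵐ z ∂discMeasure, ∀ n : ℤ,
      delBar (angularMode ux (n + 1) z) (angularMode uy (n + 1) z) +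
        del (angularMode ux (n - 1) z) (angularMode uy (n - 1) z) + a z * angularMode u n z =
      kernelMode k n z * angularMode u n z + if n = 0 then (f z : ℂ) else 0 := by
  obtain ⟨k', -, hd, -⟩ := hk
  have hz : ∀ᵐ z ∂discMeasure, z ∈ disc := ae_restrict_mem measurableSet_disc
  filter_upwards [hz, ae_memLp_slice hu.memLp, ae_memLp_slice hu.memLp_dx,
    ae_memLp_slice hu.memLp_dy, Measure.ae_ae_of_ae_prod hfu] with z hz h1 h2 h3 h4 n
  have hK : Continuous fun t : ℝ => (k z (Real.cos t) : ℂ) :=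
    continuous_iff_continuousAt.2 fun t => (hd z hz t).ofReal_comp.continuousAt
  have hp : Function.Periodic (fun t : ℝ => (k z (Real.cos t) : ℂ)) (2 * Real.pi) := fun t => by
    simp only [Real.cos_add_two_pi]
  have i1 := h1.integrable (by norm_num : (1 : ℝ≥0∞) ≤ 2)
  have i2 := h2.integrable (by norm_num : (1 : ℝ≥0∞) ≤ 2)
  have i3 := h3.integrable (by norm_num : (1 : ℝ≥0∞) ≤ 2)
  have ib (F : ℝ → ℝ) (hF : Continuous F) (hb : ∀ θ, |F θ| ≤ 1) (w : ℝ → ℂ)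
      (hw : Integrable w angleMeasure) : Integrable (fun θ => (F θ : ℂ) * w θ) angleMeasure :=
    hw.bdd_mul (c := 1) (by fun_prop) (ae_of_all _ fun θ => by simpa using hb θ)
  have ic := ib _ Real.continuous_cos Real.abs_cos_le_one _ i2
  have is := ib _ Real.continuous_sin Real.abs_sin_le_one _ i3
  have e1 : (fun θ : ℝ => (Real.cos θ : ℂ) * (ux z θ : ℂ) + (Real.sin θ : ℂ) * (uy z θ : ℂ) +
      (a z : ℂ) * (u z θ : ℂ)) =ᵐ[angleMeasure] fun θ : ℝ =>
      (1 / (2 * Real.pi) * ∫ t, (fun t : ℝ => (k z (Real.cos t) : ℂ)) (θ - t) * (u z t : ℂ)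
        ∂angleMeasure) + (f z : ℂ) := by
    filter_upwards [h4] with θ h
    have h5 := congrArg (fun x : ℝ => (x : ℂ)) h
    push_cast at h5
    push_cast
    rw [h5]
    congr 2
    rw [← integral_complex_ofReal]
    congr 1; ext t; push_cast; rfl
  have e2 := fourierMode_congr e1 n
  -- The scattering term is integrable because the equation expresses it through the other terms.
  have iconv : Integrable (fun θ : ℝ => 1 / (2 * Real.pi) *
      ∫ t, (fun t : ℝ => (k z (Real.cos t) : ℂ)) (θ - t) * (u z t : ℂ) ∂angleMeasure)
      angleMeasure := by
    refine (((ic.add is).add (i1.const_mul (a z : ℂ))).sub (integrable_const (f z : ℂ))).congr ?_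
    filter_upwards [e1] with θ h
    simp only [Pi.add_apply, Pi.sub_apply] at h ⊢
    rw [h]; ring
  have ics : Integrable (fun θ : ℝ => (Real.cos θ : ℂ) * (ux z θ : ℂ) +
    (Real.sin θ : ℂ) * (uy z θ : ℂ)) angleMeasure := ic.add is
  rw [fourierMode_add ics (i1.const_mul _), fourierMode_add ic is, fourierMode_cos_mul i2,
    fourierMode_sin_mul i3, fourierMode_const_mul, fourierMode_add iconv (integrable_const _),
    fourierMode_conv hK hp i1, fourierMode_const] at e2
  simp only [angularMode, kernelMode, delBar, del]
  linear_combination e2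

theorem transport_mode_neg {a : ℂ → ℝ} {k : ℂ → ℝ → ℝ} {s : ℝ} (hk : IsC1HolderKernel s k)
    {f : ℂ → ℝ} {u ux uy uθ : ℂ → ℝ → ℝ} (hu : IsH1Phase u ux uy uθ)
    (hfu : IsTransportSolution a k f u ux uy) :
    ∀ᵐ z ∂discMeasure, ∀ j : ℕ,
      delBar (angularMode ux (-(j : ℤ)) z) (angularMode uy (-(j : ℤ)) z) +
        del (angularMode ux (-((j + 2 : ℕ) : ℤ)) z) (angularMode uy (-((j + 2 : ℕ) : ℤ)) z) +
        a z * angularMode u (-((j + 1 : ℕ) : ℤ)) z =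
      kernelMode k (-((j + 1 : ℕ) : ℤ)) z * angularMode u (-((j + 1 : ℕ) : ℤ)) z := by
  filter_upwards [transport_modes hk hu hfu] with z h j
  have := h (-((j + 1 : ℕ) : ℤ))
  rw [if_neg (by omega), add_zero, show -((j + 1 : ℕ) : ℤ) + 1 = -(j : ℤ) by push_cast; ring,
    show -((j + 1 : ℕ) : ℤ) - 1 = -((j + 2 : ℕ) : ℤ) by push_cast; ring] at this
  exact this

/-- Since `u` is real, ∂̄u_1 is the conjugate of ∂u_{-1}, and in mode 0 the two add up to 2 Re
∂u_{-1}. -/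
theorem transport_mode_zero {a : ℂ → ℝ} {k : ℂ → ℝ → ℝ} {s : ℝ} (hk : IsC1HolderKernel s k)
    {f : ℂ → ℝ} {u ux uy uθ : ℂ → ℝ → ℝ} (hu : IsH1Phase u ux uy uθ)
    (hfu : IsTransportSolution a k f u ux uy) :
    ∀ᵐ z ∂discMeasure, (f z : ℂ) =
      2 * ((del (angularMode ux (-((1 : ℕ) : ℤ)) z) (angularMode uy (-((1 : ℕ) : ℤ)) z)).re : ℂ) +
        (a z - kernelMode k 0 z) * angularMode u (-((0 : ℕ) : ℤ)) z := by
  filter_upwards [transport_modes hk hu hfu] with z h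
  have h0 := h 0
  have e : delBar (angularMode ux (0 + 1) z) (angularMode uy (0 + 1) z) =
      conj (del (angularMode ux (0 - 1) z) (angularMode uy (0 - 1) z)) := by
    simp only [angularMode, zero_add, zero_sub, fourierMode_neg_of_real, delBar, del, map_div₀,
      map_sub, map_mul, Complex.conj_conj, Complex.conj_I, Complex.conj_ofNat]
    ring
  rw [e, if_pos rfl, add_comm (conj _), Complex.add_conj, zero_sub] at h0
  push_cast at h0
  simp only [Nat.cast_one, Nat.cast_zero, neg_zero]
  linear_combination -h0

/-! ### A compactly supported extension of the attenuation with Lipschitz gradient -/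

/-- On the convex disc `a` and its gradient are Lipschitz, and each is extended to the plane on its
own. So `P` is the gradient of `A` only on the closed disc; at boundary points this follows from the
convergence of the gradients inside. -/
theorem IsC2Holder.exists_lipschitz {s : ℝ} {a : ℂ → ℝ} (ha : IsC2Holder s a) :
    ∃ (A : ℂ → ℝ) (P : ℂ → ℂ →L[ℝ] ℝ), LocallyLipschitz A ∧ LocallyLipschitz P ∧
      (∀ z ∈ disc, A z = a z) ∧
      ∀ z ∈ Metric.closedBall (0 : ℂ) 1, HasFDerivWithinAt A (P z) (Metric.closedBall 0 1) z := by
  obtain ⟨hc, C, hC⟩ := ha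
  have h0 : (0 : ℂ) ∈ disc := by simp [disc]
  have hCn : 0 ≤ C := (abs_nonneg _).trans (hC 0 h0).1
  have hconv : Convex ℝ disc := convex_ball 0 1
  have hda : ∀ z ∈ disc, DifferentiableAt ℝ a z := fun z hz =>
    ((hc z hz).contDiffAt (isOpen_disc.mem_nhds hz)).differentiableAt (by norm_num)
  have hdda : ∀ z ∈ disc, DifferentiableAt ℝ (fderiv ℝ a) z := fun z hz =>
    (((hc z hz).contDiffAt (isOpen_disc.mem_nhds hz)).fderiv_right (m := 1)
      (by norm_num)).differentiableAt (by norm_num)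
  have L1 : LipschitzOnWith ⟨C, hCn⟩ a disc :=
    hconv.lipschitzOnWith_of_nnnorm_fderiv_le hda fun z hz => (hC z hz).2.1
  have L2 : LipschitzOnWith ⟨C, hCn⟩ (fderiv ℝ a) disc :=
    hconv.lipschitzOnWith_of_nnnorm_fderiv_le hdda fun z hz => by
      have h1 := (hC z hz).2.2.1
      rw [← norm_iteratedFDeriv_fderiv (n := 1), norm_iteratedFDeriv_one] at h1
      exact h1
  obtain ⟨A, hA, hAe⟩ := L1.extend_real
  obtain ⟨P, hP, hPe⟩ := L2.extend_finite_dimension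
  refine ⟨A, P, hA.locallyLipschitz, hP.locallyLipschitz, fun z hz => (hAe hz).symm,
    fun z hz => ?_⟩
  have hcl : closure disc = Metric.closedBall (0 : ℂ) 1 := closure_ball 0 one_ne_zero
  have hev : ∀ y ∈ disc, A =ᶠ[𝓝 y] a := fun y hy => by
    filter_upwards [isOpen_disc.mem_nhds hy] with x hx
    exact (hAe hx).symm
  rw [← hcl]
  refine hasFDerivWithinAt_closure_of_tendsto_fderiv (fun y hy =>
    ((hev y hy).differentiableAt_iff.2 (hda y hy)).differentiableWithinAt) hconv isOpen_disc
    (fun y _ => hA.continuous.continuousWithinAt) ?_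
  refine (hP.continuous.continuousWithinAt (s := disc) (x := z)).tendsto.congr' ?_
  filter_upwards [self_mem_nhdsWithin] with y hy
  rw [(hev y hy).fderiv_eq, hPe hy]

/-! ### Gluing across the unit circle by radial reflections -/

theorem _root_.LocallyLipschitz.contDiff_comp₂ {E F G H : Type*} [NormedAddCommGroup E]
    [NormedSpace ℝ E] [NormedAddCommGroup F] [NormedSpace ℝ F] [NormedAddCommGroup G]
    [NormedSpace ℝ G] [NormedAddCommGroup H] [NormedSpace ℝ H] {f : E → F} {g : E → G}
    (hf : LocallyLipschitz f) (hg : LocallyLipschitz g) {Φ : F × G → H} (hΦ : ContDiff ℝ 1 Φ) :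
    LocallyLipschitz fun z => Φ (f z, g z) :=
  hΦ.locallyLipschitz.comp (hf.prodMk hg)

/-- `max (|z|² - 1) 0`. -/
def outerPart (z : ℂ) : ℝ := max (‖z‖ ^ 2 - 1) 0

/-- The radial reflection `z ↦ (1 - c (|z|² - 1)) z` outside the disc, the identity inside. -/
def reflectRadial (c : ℝ) (z : ℂ) : ℂ := (1 - c * outerPart z) • z

/-- The derivative of `reflectRadial c` outside the disc. -/
def reflectDeriv (c m : ℝ) (z : ℂ) : ℂ →L[ℝ] ℂ :=
  (1 - c * m) • ContinuousLinearMap.id ℝ ℂ - (c * 2) • ((innerSL ℝ z).smulRight z)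

theorem locallyLipschitz_outerPart : LocallyLipschitz outerPart := by
  have : ContDiff ℝ 1 fun z : ℂ => ‖z‖ ^ 2 - 1 := (contDiff_norm_sq ℝ).sub contDiff_const
  exact this.locallyLipschitz.max_const 0

theorem locallyLipschitz_reflectRadial (c : ℝ) : LocallyLipschitz (reflectRadial c) := by
  have h1 : ContDiff ℝ 1 fun p : ℝ × ℂ => (1 - c * p.1) • p.2 := by fun_prop
  have h2 : LocallyLipschitz fun z : ℂ => (outerPart z, z) :=
    locallyLipschitz_outerPart.prodMk LocallyLipschitz.id
  have h3 : reflectRadial c = (fun p : ℝ × ℂ => (1 - c * p.1) • p.2) ∘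
      fun z : ℂ => (outerPart z, z) := by
    ext1 z; rw [Function.comp_apply, reflectRadial]
  rw [h3]
  exact h1.locallyLipschitz.comp h2

theorem outerPart_of_mem {z : ℂ} (hz : z ∈ Metric.closedBall (0 : ℂ) 1) : outerPart z = 0 := by
  rw [mem_closedBall_zero_iff] at hz
  exact max_eq_right (by nlinarith [norm_nonneg z])

theorem outerPart_of_one_le {z : ℂ} (hz : 1 ≤ ‖z‖) : outerPart z = ‖z‖ ^ 2 - 1 :=
  max_eq_left (by nlinarith [norm_nonneg z])

theorem reflectRadial_of_mem (c : ℝ) {z : ℂ} (hz : z ∈ Metric.closedBall (0 : ℂ) 1) :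
    reflectRadial c z = z := by simp [reflectRadial, outerPart_of_mem hz]

/-- A shell around the unit circle which radial reflections map into the closed disc. -/
def shell : Set ℂ := {z | 1 ≤ ‖z‖ ∧ ‖z‖ ^ 2 ≤ 5 / 4}

/-- With t = |z|² - 1 in [0, 1/4], the claim is (1 - ct)²(1 + t) ≤ 1. -/
theorem reflectRadial_mapsTo {c : ℝ} (hc : c = 1 ∨ c = 2) :
    MapsTo (reflectRadial c) shell (Metric.closedBall 0 1) := by
  intro z hz
  rw [mem_closedBall_zero_iff, reflectRadial, norm_smul, outerPart_of_one_le hz.1]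
  have h1 : 0 ≤ ‖z‖ ^ 2 - 1 := by nlinarith [hz.1]
  have h2 := hz.2
  set t := ‖z‖ ^ 2 - 1 with ht
  have ht' : t ≤ 1 / 4 := by linarith
  have hz2 : ‖z‖ ^ 2 = 1 + t := by rw [ht]; ring
  refine (le_abs_self _).trans (abs_le_one_iff_mul_self_le_one.2 ?_)
  rw [show ‖1 - c * t‖ * ‖z‖ * (‖1 - c * t‖ * ‖z‖) = ‖1 - c * t‖ ^ 2 * ‖z‖ ^ 2 by ring, hz2,
    Real.norm_eq_abs, sq_abs]
  rcases hc with rfl | rfl <;> nlinarith [mul_nonneg h1 h1, mul_nonneg h1 (sub_nonneg.2 ht'),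
    mul_nonneg (mul_nonneg h1 h1) (sub_nonneg.2 ht')]

theorem hasFDerivWithinAt_reflectRadial (c : ℝ) {z : ℂ} (hz : z ∈ shell) :
    HasFDerivWithinAt (reflectRadial c) (reflectDeriv c (outerPart z) z) shell z := by
  have h1 : HasFDerivAt (fun z : ℂ => ‖z‖ ^ 2) ((2 : ℝ) • innerSL ℝ z) z := by
    have := (hasStrictFDerivAt_norm_sq z).hasFDerivAt
    rwa [two_nsmul, ← two_smul ℝ] at this
  have h2 := (((h1.sub_const 1).const_mul c).const_sub 1).smul (hasFDerivAt_id z)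
  refine HasFDerivWithinAt.congr (f := fun z => (1 - c * (‖z‖ ^ 2 - 1)) • z) ?_
    (fun y hy => by rw [reflectRadial, outerPart_of_one_le hy.1])
    (by rw [reflectRadial, outerPart_of_one_le hz.1])
  refine (h2.congr_fderiv ?_).hasFDerivWithinAt
  rw [outerPart_of_one_le hz.1]
  refine ContinuousLinearMap.ext fun y => ?_
  simp only [reflectDeriv, add_apply, sub_apply,
    smul_apply, ContinuousLinearMap.smulRight_apply,
    neg_apply, ContinuousLinearMap.id_apply, smul_eq_mul, id_eq]
  module

theorem contDiff_reflectDeriv (c : ℝ) :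
    ContDiff ℝ 1 fun p : ℝ × ℂ => reflectDeriv c p.1 p.2 := by
  have h1 : ContDiff ℝ 1 fun p : ℝ × ℂ => 1 - c * p.1 := by fun_prop
  have h2 : ContDiff ℝ 1 fun p : ℝ × ℂ => innerSL ℝ p.2 := (innerSL ℝ).contDiff.comp contDiff_snd
  have h3 : ContDiff ℝ 1 fun p : ℝ × ℂ => (innerSL ℝ p.2).smulRight p.2 :=
    h2.smulRight contDiff_snd
  have h4 : ContDiff ℝ 1 fun p : ℝ × ℂ => (1 - c * p.1) • ContinuousLinearMap.id ℝ ℂ :=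
    h1.smul contDiff_const
  have h5 : ContDiff ℝ 1 fun p : ℝ × ℂ => (c * 2) • (innerSL ℝ p.2).smulRight p.2 :=
    h3.const_smul (c * 2)
  exact h4.sub h5

/-- The gradient of `2 A (reflectRadial 1 ·) - A (reflectRadial 2 ·)`, if `P` is that of `A`. -/
def gluedDeriv (P : ℂ → ℂ →L[ℝ] ℝ) (z : ℂ) : ℂ →L[ℝ] ℝ :=
  (2 : ℝ) • (P (reflectRadial 1 z)).comp (reflectDeriv 1 (outerPart z) z) -
    (P (reflectRadial 2 z)).comp (reflectDeriv 2 (outerPart z) z)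

theorem locallyLipschitz_glued {P : ℂ → ℂ →L[ℝ] ℝ} (hP : LocallyLipschitz P) :
    LocallyLipschitz (gluedDeriv P) := by
  have comp {Q : ℂ → ℂ →L[ℝ] ℝ} (hQ : LocallyLipschitz Q) (c : ℝ) :
      LocallyLipschitz fun z => (Q z).comp (reflectDeriv c (outerPart z) z) := by
    have h1 : ContDiff ℝ 1 fun p : (ℂ →L[ℝ] ℝ) × (ℝ × ℂ) =>
        p.1.comp (reflectDeriv c p.2.1 p.2.2) :=
      contDiff_fst.clm_comp ((contDiff_reflectDeriv c).comp contDiff_snd)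
    exact hQ.contDiff_comp₂ (locallyLipschitz_outerPart.prodMk LocallyLipschitz.id) h1
  have h1 := comp (hP.comp (locallyLipschitz_reflectRadial 1)) 1
  have h2 := comp (hP.comp (locallyLipschitz_reflectRadial 2)) 2
  have h3 : ContDiff ℝ 1 fun p : (ℂ →L[ℝ] ℝ) × (ℂ →L[ℝ] ℝ) => (2 : ℝ) • p.1 - p.2 := by fun_prop
  exact h1.contDiff_comp₂ h2 h3

/-- The combination 2 A∘R_1 - A∘R_2 of two radial reflections agrees with A to first order on the
circle: the weights add up to 1, and the radial derivative of R_c there is 1 - 2c, with 2(1 - 2) -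
(1 - 4) = 1. The glued gradient stays Lipschitz because its ingredients are, and a cutoff makes the
support compact. -/
theorem IsC2Holder.exists_extension {s : ℝ} {a : ℂ → ℝ} (ha : IsC2Holder s a) :
    ∃ (A : ℂ → ℝ) (P : ℂ → ℂ →L[ℝ] ℝ), (∀ z, HasFDerivAt A (P z) z) ∧ LocallyLipschitz P ∧
      (∀ z, 2 ≤ ‖z‖ → A z = 0) ∧ ∀ z ∈ disc, A z = a z := by
  obtain ⟨A, P, hA, hP, hAa, hd⟩ := ha.exists_lipschitz
  obtain ⟨χ, hχ, -, hχ1, hχ0, -⟩ := exists_cutoff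
  let A₀ : ℂ → ℝ := fun z => 2 * A (reflectRadial 1 z) - A (reflectRadial 2 z)
  let P₀ : ℂ → ℂ →L[ℝ] ℝ := gluedDeriv P
  have hA₀K : ∀ z ∈ Metric.closedBall (0 : ℂ) 1, A₀ z = A z := fun z hz => by
    simp only [A₀, reflectRadial_of_mem _ hz]; ring
  -- The rank-one parts of the two reflection derivatives cancel, -2 · 2 + 4 = 0, so the outer
  -- formula for the gradient is also the correct one inside.
  have hP₀K : ∀ z ∈ Metric.closedBall (0 : ℂ) 1, P₀ z = P z := fun z hz => by
    simp only [P₀, gluedDeriv, reflectRadial_of_mem _ hz, outerPart_of_mem hz]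
    ext <;> (simp [reflectDeriv]; ring)
  have hK : ∀ z ∈ Metric.closedBall (0 : ℂ) 1,
      HasFDerivWithinAt A₀ (P₀ z) (Metric.closedBall 0 1) z := fun z hz => by
    rw [hP₀K z hz]
    exact (hd z hz).congr hA₀K (hA₀K z hz)
  have hS : ∀ z ∈ shell, HasFDerivWithinAt A₀ (P₀ z) shell z := fun z hz => by
    have h1 := (hd _ (reflectRadial_mapsTo (Or.inl rfl) hz)).comp z
      (hasFDerivWithinAt_reflectRadial 1 hz) (reflectRadial_mapsTo (Or.inl rfl))
    have h2 := (hd _ (reflectRadial_mapsTo (Or.inr rfl) hz)).comp z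
      (hasFDerivWithinAt_reflectRadial 2 hz) (reflectRadial_mapsTo (Or.inr rfl))
    exact (h1.const_mul 2).sub h2
  have hd₀ : ∀ z : ℂ, ‖z‖ ^ 2 < 5 / 4 → HasFDerivAt A₀ (P₀ z) z := fun z hz => by
    have hO : {y : ℂ | ‖y‖ ^ 2 < 5 / 4} ∈ 𝓝 z :=
      (isOpen_lt (by fun_prop) continuous_const).mem_nhds hz
    rcases lt_trichotomy ‖z‖ 1 with h | h | h
    · refine (hK z (by simpa using h.le)).hasFDerivAt ?_
      exact Filter.mem_of_superset (isOpen_disc.mem_nhds (by simpa [disc] using h))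
        Metric.ball_subset_closedBall
    -- At a point of the circle the derivatives from the two closed sides coincide, and the sides
    -- together cover a neighbourhood.
    · have hu := (hK z (by simpa using h.le)).union (hS z ⟨h.ge, hz.le⟩)
      refine hu.hasFDerivAt ?_
      filter_upwards [hO] with y hy
      rcases le_total ‖y‖ 1 with h' | h'
      · exact Or.inl (by simpa using h')
      · exact Or.inr ⟨h', le_of_lt hy⟩
    · refine (hS z ⟨h.le, hz.le⟩).hasFDerivAt ?_
      filter_upwards [hO, (isOpen_lt continuous_const continuous_norm).mem_nhds h] with y hy hy'
      exact ⟨le_of_lt hy', le_of_lt hy⟩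
  have hA₀L : LocallyLipschitz A₀ := by
    have : ContDiff ℝ 1 fun p : ℝ × ℝ => 2 * p.1 - p.2 := by fun_prop
    have h2 : LocallyLipschitz fun z => (A (reflectRadial 1 z), A (reflectRadial 2 z)) :=
      (hA.comp (locallyLipschitz_reflectRadial 1)).prodMk
        (hA.comp (locallyLipschitz_reflectRadial 2))
    exact this.locallyLipschitz.comp h2
  have hP₀L : LocallyLipschitz P₀ := locallyLipschitz_glued hP
  refine ⟨fun z => χ z * A₀ z, fun z => χ z • P₀ z + A₀ z • fderiv ℝ χ z, fun z => ?_, ?_,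
    fun z hz => ?_, fun z hz => ?_⟩
  · by_cases hz : ‖z‖ ^ 2 < 5 / 4
    · exact ((hχ.differentiable (by simp)).differentiableAt.hasFDerivAt).mul (hd₀ z hz)
    -- As (11/10)² < 5/4, the cutoff vanishes before the shell is left.
    · have hz' : 11 / 10 < ‖z‖ := by
        by_contra hcon
        push Not at hcon
        exact hz (by nlinarith [norm_nonneg z])
      have hev : χ =ᶠ[𝓝 z] fun _ => 0 := by
        filter_upwards [(isOpen_lt continuous_const continuous_norm).mem_nhds hz'] with y hy
        exact hχ0 y (le_of_lt hy)
      beta_reduce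
      rw [hχ0 z hz'.le, hev.fderiv_eq]
      have : (fun z => χ z * A₀ z) =ᶠ[𝓝 z] fun _ => 0 := by
        filter_upwards [hev] with y hy
        rw [hy, zero_mul]
      refine HasFDerivAt.congr_of_eventuallyEq ?_ this
      simpa using hasFDerivAt_const (0 : ℝ) z
  · have h1 : ContDiff ℝ 1 fun p : ℝ × (ℂ →L[ℝ] ℝ) => p.1 • p.2 := contDiff_smul
    have h2 : ContDiff ℝ 1 (fderiv ℝ χ) := hχ.fderiv_right (by norm_cast)
    have h3 : ContDiff ℝ 1 χ := hχ.of_le (by norm_cast)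
    have h4 := h3.locallyLipschitz.contDiff_comp₂ hP₀L h1
    have h5 := hA₀L.contDiff_comp₂ h2.locallyLipschitz h1
    exact h4.contDiff_comp₂ h5 (contDiff_fst.add contDiff_snd)
  · change χ z * A₀ z = 0
    rw [hχ0 z (by linarith), zero_mul]
  · have hz' := Metric.ball_subset_closedBall hz
    change χ z * A₀ z = a z
    rw [hχ1 z hz', one_mul, hA₀K z hz', hAa z hz]

/-! ### Modes of the divergent beam transform of a smooth attenuation -/

/-- The parameters `(θ, r)` of beams of length `4`. -/
def beamMeasure : Measure (ℝ × ℝ) := angleMeasure.prod (volume.restrict (Ioc 0 4))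

instance : IsFiniteMeasure beamMeasure := by unfold beamMeasure; infer_instance

/-- `∫ c(x) B(z + y(x)) dx` over the beam parameters `x = (θ, r)`, with `y(x) = r e^{iθ}` and
`c(x) = e^{-inθ} / 2π`. -/
def beamIntegral {E : Type*} [NormedAddCommGroup E] [NormedSpace ℂ E] (n : ℤ) (B : ℂ → E) (z : ℂ) :
    E :=
  ∫ x, ((1 / (2 * Real.pi) : ℂ) * Complex.exp (-(Complex.I * n * x.1))) • B (z + x.2 * dir x.1)
    ∂beamMeasure

theorem continuous_dir : Continuous dir := by unfold dir; fun_prop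

theorem norm_dir (θ : ℝ) : ‖dir θ‖ = 1 := by
  rw [dir, mul_comm]; exact Complex.norm_exp_ofReal_mul_I θ

theorem ae_beamMeasure : ∀ᵐ x ∂beamMeasure, x.2 ∈ Ioc (0 : ℝ) 4 := by
  rw [beamMeasure, angleMeasure, Measure.prod_restrict]
  filter_upwards [ae_restrict_mem (measurableSet_Ioc.prod measurableSet_Ioc)] with x hx
  exact hx.2

theorem norm_beam_le {z z₀ : ℂ} (hz : z ∈ Metric.ball z₀ 1) {x : ℝ × ℝ} (hx : x.2 ∈ Ioc (0 : ℝ) 4) :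
    z + x.2 * dir x.1 ∈ Metric.closedBall z₀ 5 := by
  rw [mem_closedBall_iff_norm]
  rw [mem_ball_iff_norm] at hz
  have h : ‖(x.2 : ℂ) * dir x.1‖ ≤ 4 := by
    rw [norm_mul, norm_dir, mul_one, Complex.norm_real, Real.norm_eq_abs, abs_of_pos hx.1]
    exact hx.2
  calc ‖z + x.2 * dir x.1 - z₀‖ = ‖(z - z₀) + x.2 * dir x.1‖ := by ring_nf
    _ ≤ ‖z - z₀‖ + ‖(x.2 : ℂ) * dir x.1‖ := norm_add_le _ _
    _ ≤ 5 := by linarith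

section

variable {E : Type*} [NormedAddCommGroup E] [NormedSpace ℂ E]

theorem norm_beamWeight (n : ℤ) (t : ℝ) :
    ‖(1 / (2 * Real.pi) : ℂ) * Complex.exp (-(Complex.I * n * t))‖ ≤ 1 := by
  rw [norm_mul, norm_exp_neg_I_mul, mul_one, norm_div, norm_one, norm_mul, Complex.norm_real,
    Real.norm_eq_abs, abs_of_pos Real.pi_pos, Complex.norm_two, div_le_one (by positivity)]
  linarith [Real.pi_gt_three]

theorem exists_beam_bound {B : ℂ → E} (hB : Continuous B) (z₀ : ℂ) :
    ∃ C, ∀ z ∈ Metric.ball z₀ 1, ∀ n : ℤ, ∀ x : ℝ × ℝ, x.2 ∈ Ioc (0 : ℝ) 4 →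
      ‖((1 / (2 * Real.pi) : ℂ) * Complex.exp (-(Complex.I * n * x.1))) • B (z + x.2 * dir x.1)‖
        ≤ C := by
  obtain ⟨C, hC⟩ := (isCompact_closedBall z₀ 5).exists_bound_of_continuousOn hB.continuousOn
  refine ⟨C, fun z hz n x hx => ?_⟩
  rw [norm_smul]
  calc _ ≤ 1 * ‖B (z + x.2 * dir x.1)‖ := by gcongr; exact norm_beamWeight n x.1
    _ ≤ C := by rw [one_mul]; exact hC _ (norm_beam_le hz hx)

theorem continuous_beamIntegrand {B : ℂ → E} (hB : Continuous B) (n : ℤ) (z : ℂ) :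
    Continuous fun x : ℝ × ℝ =>
      ((1 / (2 * Real.pi) : ℂ) * Complex.exp (-(Complex.I * n * x.1))) • B (z + x.2 * dir x.1) := by
  have := continuous_dir
  fun_prop

theorem integrable_beamIntegrand {B : ℂ → E} (hB : Continuous B) (n : ℤ) (z : ℂ) :
    Integrable (fun x : ℝ × ℝ => ((1 / (2 * Real.pi) : ℂ) * Complex.exp (-(Complex.I * n * x.1))) •
      B (z + x.2 * dir x.1)) beamMeasure := by
  obtain ⟨C, hC⟩ := exists_beam_bound hB z
  refine Integrable.of_bound (C := C)
    (continuous_beamIntegrand hB n z).aestronglyMeasurable ?_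
  filter_upwards [ae_beamMeasure] with x hx
  exact hC z (Metric.mem_ball_self one_pos) n x hx

theorem continuous_beamIntegral {B : ℂ → E} (hB : Continuous B) (n : ℤ) :
    Continuous (beamIntegral n B) := by
  refine continuous_iff_continuousAt.2 fun z₀ => ?_
  obtain ⟨C, hC⟩ := exists_beam_bound hB z₀
  refine continuousAt_of_dominated (bound := fun _ => C)
    (Eventually.of_forall fun z => (continuous_beamIntegrand hB n z).aestronglyMeasurable)
    ?_ (integrable_const C) (Eventually.of_forall fun x => ?_)
  · filter_upwards [Metric.ball_mem_nhds z₀ one_pos] with z hz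
    filter_upwards [ae_beamMeasure] with x hx
    exact hC z hz n x hx
  · fun_prop

/-- Differentiation under the integral gives a beam integral again, now of `P`. This is the reason
for allowing vector values in `beamIntegral`. -/
theorem hasFDerivAt_beamIntegral {B : ℂ → ℂ} {P : ℂ → ℂ →L[ℝ] ℂ} (hB : ∀ z, HasFDerivAt B (P z) z)
    (hP : Continuous P) (n : ℤ) (z₀ : ℂ) :
    HasFDerivAt (beamIntegral n B) (beamIntegral n P z₀) z₀ := by
  obtain ⟨C, hC⟩ := exists_beam_bound hP z₀
  have hBc : Continuous B := continuous_iff_continuousAt.2 fun z => (hB z).continuousAt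
  have hbd : ∀ᵐ x ∂beamMeasure, ∀ z ∈ Metric.ball z₀ 1,
      ‖((1 / (2 * Real.pi) : ℂ) * Complex.exp (-(Complex.I * n * x.1))) • P (z + x.2 * dir x.1)‖
        ≤ C := by
    filter_upwards [ae_beamMeasure] with x hx z hz
    exact hC z hz n x hx
  have hd : ∀ᵐ x ∂beamMeasure, ∀ z ∈ Metric.ball z₀ 1,
      HasFDerivAt (fun z => ((1 / (2 * Real.pi) : ℂ) * Complex.exp (-(Complex.I * n * x.1))) •
        B (z + x.2 * dir x.1)) (((1 / (2 * Real.pi) : ℂ) * Complex.exp (-(Complex.I * n * x.1))) •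
        P (z + x.2 * dir x.1)) z := Eventually.of_forall fun x z _ => by
    have h1 : HasFDerivAt (fun z => B (z + x.2 * dir x.1)) (P (z + x.2 * dir x.1)) z :=
      (hasFDerivAt_comp_add_right _).2 (hB _)
    exact h1.const_smul ((1 / (2 * Real.pi) : ℂ) * Complex.exp (-(Complex.I * n * x.1)))
  have h := hasFDerivAt_integral_of_dominated_of_fderiv_le (𝕜 := ℝ) (μ := beamMeasure)
    (bound := fun _ => C) (Metric.ball_mem_nhds z₀ one_pos)
    (Eventually.of_forall fun z => (continuous_beamIntegrand hBc n z).aestronglyMeasurable)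
    (integrable_beamIntegrand hBc n z₀) (continuous_beamIntegrand hP n z₀).aestronglyMeasurable
    hbd (integrable_const C) hd
  exact h

theorem contDiff_beamIntegral {B : ℂ → ℂ} {P : ℂ → ℂ →L[ℝ] ℂ} (hB : ∀ z, HasFDerivAt B (P z) z)
    (hP : Continuous P) (n : ℤ) : ContDiff ℝ 1 (beamIntegral n B) := by
  refine contDiff_one_iff_fderiv.2 ⟨fun z => (hasFDerivAt_beamIntegral hB hP n z).differentiableAt, ?_⟩
  rw [show fderiv ℝ (beamIntegral n B) = beamIntegral n P from
    funext fun z => (hasFDerivAt_beamIntegral hB hP n z).fderiv]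
  exact continuous_beamIntegral hP n

theorem fderiv_beamIntegral_apply {B : ℂ → ℂ} {P : ℂ → ℂ →L[ℝ] ℂ}
    (hB : ∀ z, HasFDerivAt B (P z) z) (hP : Continuous P) (n : ℤ) (z e : ℂ) :
    fderiv ℝ (beamIntegral n B) z e = beamIntegral n (fun z => P z e) z := by
  rw [(hasFDerivAt_beamIntegral hB hP n z).fderiv, beamIntegral,
    ContinuousLinearMap.integral_apply (integrable_beamIntegrand hP n z)]
  rfl

end

/-- The integral of `B` along the beam of length `4` from `z` in the direction `θ`. -/
def beam (B : ℂ → ℂ) (z : ℂ) (θ : ℝ) : ℂ := ∫ r in (0 : ℝ)..4, B (z + r * dir θ)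

theorem periodic_dir : Function.Periodic dir (2 * Real.pi) := fun θ => by
  rw [dir, dir, Complex.exp_eq_exp_iff_exists_int]
  exact ⟨1, by push_cast; ring⟩

theorem periodic_beam (B : ℂ → ℂ) (z : ℂ) : Function.Periodic (beam B z) (2 * Real.pi) := fun θ => by
  rw [beam, beam, periodic_dir θ]

theorem continuous_beam {B : ℂ → ℂ} (hB : Continuous B) (z : ℂ) : Continuous (beam B z) := by
  have := continuous_dir
  exact intervalIntegral.continuous_parametric_intervalIntegral_of_continuous' (by fun_prop) 0 4

theorem beamIntegral_eq_fourierMode {B : ℂ → ℂ} (hB : Continuous B) (n : ℤ) (z : ℂ) :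
    beamIntegral n B z = fourierMode (beam B z) n := by
  have h := integrable_beamIntegrand hB n z
  rw [beamIntegral, fourierMode]
  rw [beamMeasure] at h ⊢
  rw [integral_prod _ h, ← integral_const_mul]
  refine integral_congr_ae (Eventually.of_forall fun θ => ?_)
  simp only [smul_eq_mul]
  rw [integral_const_mul, beam, intervalIntegral.integral_of_le (by norm_num)]
  ring

theorem hasDerivAt_dir (x : ℝ) : HasDerivAt dir (Complex.I * dir x) x := by
  have h := ((hasDerivAt_id (x : ℂ)).const_mul Complex.I).cexp.comp_ofReal
  refine h.congr_deriv ?_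
  simp [dir, mul_comm]

theorem norm_dir_sub_le (θ t : ℝ) : ‖dir θ - dir t‖ ≤ |θ - t| := by
  have h1 := hasDerivAt_dir
  have := convex_univ.norm_image_sub_le_of_norm_hasDerivWithin_le (f := dir) (C := 1) (x := t)
    (y := θ) (fun x _ => (h1 x).hasDerivWithinAt) (fun x _ => by
      rw [norm_mul, norm_dir, Complex.norm_I, mul_one]) (mem_univ _) (mem_univ _)
  simpa using this

/-- At distance r ≤ 4 the two beams are at most 4|θ - t| apart, and they have length 4; hence 16.
Starting in the unit disc they stay in the ball of radius 5. -/
theorem norm_beam_sub_le {B : ℂ → ℂ} (hB : Continuous B) {K : ℝ} (hK : 0 ≤ K)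
    (hL : ∀ x ∈ Metric.closedBall (0 : ℂ) 5, ∀ y ∈ Metric.closedBall (0 : ℂ) 5,
      ‖B x - B y‖ ≤ K * ‖x - y‖) {z : ℂ} (hz : z ∈ disc) (θ t : ℝ) :
    ‖beam B z θ - beam B z t‖ ≤ 16 * K * |θ - t| := by
  have := continuous_dir
  have hi : ∀ θ : ℝ, IntervalIntegrable (fun r : ℝ => B (z + r * dir θ)) volume 0 4 := fun θ =>
    Continuous.intervalIntegrable (by fun_prop) _ _
  rw [beam, beam, ← intervalIntegral.integral_sub (hi θ) (hi t)]
  have h := intervalIntegral.norm_integral_le_of_norm_le_const (a := 0) (b := 4)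
    (C := K * (4 * |θ - t|)) (f := fun r : ℝ => B (z + r * dir θ) - B (z + r * dir t))
    fun r hr => by
      rw [uIoc_of_le (by norm_num)] at hr
      refine (hL _ (norm_beam_le (x := (θ, r)) hz hr) _ (norm_beam_le (x := (t, r)) hz hr)).trans ?_
      gcongr
      rw [show z + r * dir θ - (z + r * dir t) = r * (dir θ - dir t) by ring, norm_mul,
        Complex.norm_real, Real.norm_eq_abs, abs_of_pos hr.1]
      have := norm_dir_sub_le θ t
      gcongr
      exact hr.2
  refine h.trans (le_of_eq ?_)
  norm_num
  ring

theorem integrable_beamMeasure {F : ℝ × ℝ → ℂ} (hF : Continuous F) : Integrable F beamMeasure := by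
  rw [beamMeasure, angleMeasure, Measure.prod_restrict]
  exact (hF.continuousOn.integrableOn_compact (isCompact_Icc.prod isCompact_Icc)).mono_set
    (Set.prod_mono Ioc_subset_Icc_self Ioc_subset_Icc_self)

/-! ### The transport equation for the modes of the beam transform -/

section

variable {B : ℂ → ℂ} {P : ℂ → ℂ →L[ℝ] ℂ}

/-- The integrand is the derivative of `B` along the beam. A beam of length 4 that starts in the
unit disc ends outside the ball of radius 2, where `B` vanishes. -/
theorem integral_beam_dir (hB : ∀ z, HasFDerivAt B (P z) z) (hP : Continuous P)
    (h0 : ∀ z, 2 ≤ ‖z‖ → B z = 0) {z : ℂ} (hz : z ∈ disc) (θ : ℝ) :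
    ∫ r in (0 : ℝ)..4, P (z + r * dir θ) (dir θ) = -B z := by
  have hd : ∀ r : ℝ, HasDerivAt (fun r : ℝ => B (z + r * dir θ)) (P (z + r * dir θ) (dir θ)) r :=
    fun r => by
      have h1 : HasDerivAt (fun r : ℝ => z + r * dir θ) (dir θ) r := by
        simpa using ((hasDerivAt_id (r : ℂ)).mul_const (dir θ)).comp_ofReal.const_add z
      exact (hB _).comp_hasDerivAt r h1
  rw [intervalIntegral.integral_eq_sub_of_hasDerivAt (fun r _ => hd r)
    (Continuous.intervalIntegrable (by fun_prop) _ _), h0]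
  · simp
  · have h1 : ‖z‖ < 1 := by simpa [disc] using hz
    have h2 : ‖((4 : ℝ) : ℂ) * dir θ‖ = 4 := by rw [norm_mul, norm_dir]; simp
    have h3 := norm_sub_le (z + ((4 : ℝ) : ℂ) * dir θ) z
    rw [add_sub_cancel_left, h2] at h3
    linarith

/-- Up to the factor `r`, the integrand is the angular derivative of a periodic function. -/
theorem integral_circle_perp (hB : ∀ z, HasFDerivAt B (P z) z) (hP : Continuous P) (z : ℂ) {r : ℝ}
    (hr : r ≠ 0) : ∫ θ, P (z + r * dir θ) (Complex.I * dir θ) ∂angleMeasure = 0 := by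
  have hdc := continuous_dir
  have hd : ∀ θ : ℝ, HasDerivAt (fun θ : ℝ => B (z + r * dir θ))
      (r • P (z + r * dir θ) (Complex.I * dir θ)) θ := fun θ => by
    have h1 : HasDerivAt (fun θ : ℝ => z + r * dir θ) (r * (Complex.I * dir θ)) θ :=
      ((hasDerivAt_dir θ).const_mul (r : ℂ)).const_add z
    refine ((hB _).comp_hasDerivAt θ h1).congr_deriv ?_
    rw [← map_smul, Complex.real_smul]
  have h := intervalIntegral.integral_eq_sub_of_hasDerivAt (a := -Real.pi) (b := Real.pi)
    (fun θ _ => hd θ) (Continuous.intervalIntegrable (by fun_prop) _ _)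
  rw [intervalIntegral.integral_smul] at h
  have hper : dir Real.pi = dir (-Real.pi) := by
    rw [← periodic_dir (-Real.pi)]; congr 1; ring
  rw [hper, sub_self, smul_eq_zero] at h
  rw [angleMeasure, ← intervalIntegral.integral_of_le (by linarith [Real.pi_pos])]
  exact h.resolve_left hr

theorem apply_eq_add (L : ℂ →L[ℝ] ℂ) (w : ℂ) : L w = w.re * L 1 + w.im * L Complex.I := by
  conv_lhs => rw [show w = w.re • (1 : ℂ) + w.im • Complex.I by
    rw [Complex.real_smul, Complex.real_smul, mul_one, Complex.re_add_im]]
  rw [map_add, map_smul, map_smul, Complex.real_smul, Complex.real_smul]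

theorem dir_re (θ : ℝ) : (dir θ).re = Real.cos θ := by
  rw [dir, mul_comm, Complex.exp_ofReal_mul_I_re]

theorem dir_im (θ : ℝ) : (dir θ).im = Real.sin θ := by
  rw [dir, mul_comm, Complex.exp_ofReal_mul_I_im]

/-- `∂̄v` for a differentiable function `v`. -/
def delBarFun (v : ℂ → ℂ) (z : ℂ) : ℂ := delBar (fderiv ℝ v z 1) (fderiv ℝ v z Complex.I)

/-- Here e^{-iθ}(∂_x + i∂_y) = θ·∇ + iθ^⊥·∇. The first operator integrates to -B(z) along every
beam, the second to 0 around every circle centred at z. Taking ∂̄ halves the result. -/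
theorem delBarFun_beamIntegral_one (hB : ∀ z, HasFDerivAt B (P z) z) (hP : Continuous P)
    (h0 : ∀ z, 2 ≤ ‖z‖ → B z = 0) {z : ℂ} (hz : z ∈ disc) :
    delBarFun (beamIntegral 1 B) z = -B z / 2 := by
  have hpi : (Real.pi : ℂ) ≠ 0 := Complex.ofReal_ne_zero.2 Real.pi_ne_zero
  have hdc := continuous_dir
  have hP1 : Continuous fun z => P z 1 := by fun_prop
  have hPI : Continuous fun z => P z Complex.I := by fun_prop
  have i1 : Integrable (fun x : ℝ × ℝ => P (z + x.2 * dir x.1) (dir x.1)) beamMeasure :=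
    integrable_beamMeasure (by fun_prop)
  have i2 : Integrable (fun x : ℝ × ℝ => P (z + x.2 * dir x.1) (Complex.I * dir x.1)) beamMeasure :=
    integrable_beamMeasure (by fun_prop)
  have e1 : ∫ x, P (z + x.2 * dir x.1) (dir x.1) ∂beamMeasure = -(2 * Real.pi * B z) := by
    rw [beamMeasure] at i1 ⊢
    rw [integral_prod _ i1]
    simp_rw [← intervalIntegral.integral_of_le (show (0 : ℝ) ≤ 4 by norm_num),
      integral_beam_dir hB hP h0 hz]
    rw [angleMeasure, ← intervalIntegral.integral_of_le (by linarith [Real.pi_pos]),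
      intervalIntegral.integral_const, Complex.real_smul]
    push_cast; ring
  have e2 : ∫ x, P (z + x.2 * dir x.1) (Complex.I * dir x.1) ∂beamMeasure = 0 := by
    rw [beamMeasure] at i2 ⊢
    rw [integral_prod_symm _ i2]
    refine integral_eq_zero_of_ae ?_
    filter_upwards [ae_restrict_mem measurableSet_Ioc] with r hr
    exact integral_circle_perp hB hP z hr.1.ne'
  rw [delBarFun, delBar, fderiv_beamIntegral_apply hB hP, fderiv_beamIntegral_apply hB hP,
    beamIntegral, beamIntegral, ← integral_const_mul,
    ← integral_add (integrable_beamIntegrand hP1 1 z)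
      ((integrable_beamIntegrand hPI 1 z).const_mul _)]
  have key : ∀ x : ℝ × ℝ,
      ((1 / (2 * Real.pi) : ℂ) * Complex.exp (-(Complex.I * (1 : ℤ) * x.1))) • P (z + x.2 * dir x.1) 1 +
      Complex.I * (((1 / (2 * Real.pi) : ℂ) * Complex.exp (-(Complex.I * (1 : ℤ) * x.1))) •
        P (z + x.2 * dir x.1) Complex.I) =
      (1 / (2 * Real.pi) : ℂ) * (P (z + x.2 * dir x.1) (dir x.1) +
        Complex.I * P (z + x.2 * dir x.1) (Complex.I * dir x.1)) := fun x => by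
    have hexp : Complex.exp (-(Complex.I * (1 : ℤ) * x.1)) =
        Real.cos x.1 - Real.sin x.1 * Complex.I := by
      rw [show -(Complex.I * (1 : ℤ) * x.1) = ((-x.1 : ℝ) : ℂ) * Complex.I by push_cast; ring,
        Complex.exp_ofReal_mul_I, Real.cos_neg, Real.sin_neg]
      push_cast; ring
    rw [hexp, apply_eq_add _ (dir x.1), apply_eq_add _ (Complex.I * dir x.1)]
    simp only [Complex.mul_re, Complex.mul_im, Complex.I_re, Complex.I_im, dir_re, dir_im, smul_eq_mul]
    push_cast
    linear_combination (-(1 / (2 * (Real.pi : ℂ))) * Complex.sin x.1 * P (z + x.2 * dir x.1) Complex.I) *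
      Complex.I_sq
  simp_rw [key]
  rw [integral_const_mul, integral_add i1 (i2.const_mul _), integral_const_mul, e1, e2]
  field_simp
  ring

/-- This is mode n+1 of the equation θ·∇D = -B for the beam transform D of B. The right-hand side
does not depend on θ, so it only has mode 0. -/
theorem delBarFun_beamIntegral_add_two (hB : ∀ z, HasFDerivAt B (P z) z) (hP : Continuous P)
    (h0 : ∀ z, 2 ≤ ‖z‖ → B z = 0) {z : ℂ} (hz : z ∈ disc) {n : ℤ} (hn : n + 1 ≠ 0) :
    delBarFun (beamIntegral (n + 2) B) z + delFun (beamIntegral n B) z = 0 := by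
  have hP1 : Continuous fun z => P z 1 := by fun_prop
  have hPI : Continuous fun z => P z Complex.I := by fun_prop
  have c1 := continuous_beam hP1 z
  have cI := continuous_beam hPI z
  have int {w : ℝ → ℂ} (hw : Continuous w) : Integrable w angleMeasure :=
    hw.integrableOn_Ioc
  have tr : (fun θ : ℝ => Real.cos θ * beam (fun z => P z 1) z θ +
      Real.sin θ * beam (fun z => P z Complex.I) z θ) = fun _ => -B z := by
    ext θ
    rw [← integral_beam_dir hB hP h0 hz θ, beam, beam, ← intervalIntegral.integral_const_mul,
      ← intervalIntegral.integral_const_mul, ← intervalIntegral.integral_add]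
    · refine intervalIntegral.integral_congr fun r _ => ?_
      rw [apply_eq_add _ (dir θ), dir_re, dir_im]
    · exact Continuous.intervalIntegrable (by fun_prop) _ _
    · exact Continuous.intervalIntegrable (by fun_prop) _ _
  have h := congrArg (fun w => fourierMode w (n + 1)) tr
  beta_reduce at h
  rw [fourierMode_add (int (by fun_prop)) (int (by fun_prop)), fourierMode_cos_mul (int c1),
    fourierMode_sin_mul (int cI), fourierMode_const, if_neg hn, add_sub_cancel_right,
    show n + 1 + 1 = n + 2 by ring] at h
  rw [delBarFun, delFun, delBar, del]
  simp only [fderiv_beamIntegral_apply hB hP, beamIntegral_eq_fourierMode hP1,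
    beamIntegral_eq_fourierMode hPI]
  linear_combination h

end

/-- The odd positive angular modes, doubled, of the beam transform, as a sequence. -/
def phaseMode (B : ℂ → ℂ) (n : ℕ) (z : ℂ) : ℂ := if Odd n then 2 * beamIntegral n B z else 0

/-- The chain ∂̄D_{n+2} + ∂D_n = 0 breaks between D_{-1} and D_1, and ∂̄D_1 = -a/2 on the disc. So
the odd modes n ≥ 1 can be kept without the negative ones, doubled so that the first produces -a,
and the even modes can be set to zero. The ℓ¹ bounds hold because A and its gradient are Lipschitz,
which makes their beam transforms Lipschitz in the angle. -/
theorem exists_phase {s : ℝ} {a : ℂ → ℝ} (ha : IsC2Holder s a) :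
    ∃ (h : ℕ → ℂ → ℂ) (C : ℝ), (∀ n, ContDiff ℝ 1 (h n)) ∧ (∀ z, h 0 z = 0) ∧
      (∀ z ∈ disc, ∀ N, ∑ n ∈ Finset.range N,
        (‖h n z‖ + ‖fderiv ℝ (h n) z 1‖ + ‖fderiv ℝ (h n) z Complex.I‖) ≤ C) ∧
      (∀ z ∈ disc, delBarFun (h 1) z = -a z) ∧
      ∀ z ∈ disc, ∀ n, delBarFun (h (n + 2)) z + delFun (h n) z = 0 := by
  obtain ⟨A, Q, hA, hQ, h0, hAa⟩ := ha.exists_extension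
  let B : ℂ → ℂ := fun z => A z
  let P : ℂ → ℂ →L[ℝ] ℂ := fun z => Complex.ofRealCLM.comp (Q z)
  have hB : ∀ z, HasFDerivAt B (P z) z := fun z => Complex.ofRealCLM.hasFDerivAt.comp z (hA z)
  have hPc : Continuous P := by have := hQ.continuous; fun_prop
  have hBc : Continuous B := continuous_iff_continuousAt.2 fun z => (hB z).continuousAt
  have hB0 : ∀ z, 2 ≤ ‖z‖ → B z = 0 := fun z hz => by simp [B, h0 z hz]
  have lip : ∀ D : ℂ → ℂ, LocallyLipschitz D → ∃ L : ℝ, ∀ z ∈ disc, ∀ N,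
      ∑ n ∈ Finset.range N, ‖fourierMode (beam D z) (n + 1)‖ ≤ L := fun D hD => by
    obtain ⟨K, hK⟩ := hD.locallyLipschitzOn.exists_lipschitzOnWith_of_compact
      (isCompact_closedBall (0 : ℂ) 5)
    refine ⟨(16 * K) ^ 2 + invSqSum, fun z hz N => sum_norm_fourierMode_le (periodic_beam D z)
      (norm_beam_sub_le hD.continuous K.2 (fun x hx y hy => ?_) hz) N⟩
    simpa [dist_eq_norm] using hK.dist_le_mul x hx y hy
  have hBl : LocallyLipschitz B := by
    refine (contDiff_one_iff_fderiv.2 ⟨fun z => (hB z).differentiableAt, ?_⟩).locallyLipschitz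
    rwa [show fderiv ℝ B = P from funext fun z => (hB z).fderiv]
  have hPl : ∀ e, LocallyLipschitz fun z => P z e := fun e =>
    (Complex.ofRealCLM.comp (ContinuousLinearMap.apply ℝ ℝ e)).lipschitz.locallyLipschitz.comp hQ
  obtain ⟨L₀, hL₀⟩ := lip B hBl
  obtain ⟨L₁, hL₁⟩ := lip _ (hPl 1)
  obtain ⟨L₂, hL₂⟩ := lip _ (hPl Complex.I)
  have fd : ∀ n : ℕ, Odd n → ∀ z e, fderiv ℝ (phaseMode B n) z e =
      2 * beamIntegral n (fun z => P z e) z := fun n hn z e => by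
    have : phaseMode B n = fun z => 2 * beamIntegral n B z := by ext z; simp [phaseMode, hn]
    rw [this, fderiv_const_mul (hasFDerivAt_beamIntegral hB hPc n z).differentiableAt,
      smul_apply, fderiv_beamIntegral_apply hB hPc, smul_eq_mul]
  have fd0 : ∀ n : ℕ, ¬ Odd n → phaseMode B n = fun _ => 0 := fun n hn => by
    ext z; simp [phaseMode, hn]
  refine ⟨phaseMode B, 2 * (L₀ + L₁ + L₂), fun n => ?_, fun z => by simp [phaseMode],
    fun z hz N => ?_, fun z hz => ?_, fun z hz n => ?_⟩
  · by_cases hn : Odd n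
    · have : phaseMode B n = fun z => 2 * beamIntegral n B z := by ext z; simp [phaseMode, hn]
      rw [this]
      exact contDiff_const.mul (contDiff_beamIntegral hB hPc n)
    · rw [fd0 n hn]; exact contDiff_const
  · have hmono : ∑ n ∈ Finset.range N, (‖phaseMode B n z‖ + ‖fderiv ℝ (phaseMode B n) z 1‖ +
        ‖fderiv ℝ (phaseMode B n) z Complex.I‖) ≤ ∑ n ∈ Finset.range (N + 1),
        (‖phaseMode B n z‖ + ‖fderiv ℝ (phaseMode B n) z 1‖ +
        ‖fderiv ℝ (phaseMode B n) z Complex.I‖) :=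
      Finset.sum_le_sum_of_subset_of_nonneg (Finset.range_mono (Nat.le_succ N))
        fun _ _ _ => by positivity
    refine hmono.trans ?_
    rw [Finset.sum_range_succ', fd0 0 (by simp)]
    simp only [fderiv_fun_const, Pi.zero_apply, zero_apply, norm_zero, add_zero]
    calc _ ≤ ∑ n ∈ Finset.range N, 2 * (‖fourierMode (beam B z) (n + 1)‖ +
          ‖fourierMode (beam (fun z => P z 1) z) (n + 1)‖ +
          ‖fourierMode (beam (fun z => P z Complex.I) z) (n + 1)‖) := by
          refine Finset.sum_le_sum fun n _ => ?_
          have hP1 : Continuous fun z => P z 1 := by fun_prop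
          have hPI : Continuous fun z => P z Complex.I := by fun_prop
          by_cases hn : Odd (n + 1)
          · rw [fd _ hn, fd _ hn, phaseMode, if_pos hn, beamIntegral_eq_fourierMode hBc,
              beamIntegral_eq_fourierMode hP1, beamIntegral_eq_fourierMode hPI, norm_mul, norm_mul,
              norm_mul, Complex.norm_two]
            push_cast
            linarith
          · rw [fd0 _ hn]
            simp only [fderiv_fun_const, Pi.zero_apply, zero_apply, norm_zero, add_zero]
            positivity
      _ ≤ 2 * (L₀ + L₁ + L₂) := by
          rw [← Finset.mul_sum, Finset.sum_add_distrib, Finset.sum_add_distrib]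
          have := hL₀ z hz N
          have := hL₁ z hz N
          have := hL₂ z hz N
          linarith
  · have h1 := delBarFun_beamIntegral_one hB hPc hB0 hz
    rw [delBarFun, delBar, fderiv_beamIntegral_apply hB hPc, fderiv_beamIntegral_apply hB hPc] at h1
    rw [delBarFun, delBar, fd 1 odd_one, fd 1 odd_one, ← hAa z hz]
    push_cast
    change _ = -B z
    linear_combination 2 * h1
  · by_cases hn : Odd n
    · have hn2 : Odd (n + 2) := by simpa [parity_simps] using hn
      have h1 := delBarFun_beamIntegral_add_two hB hPc hB0 hz (n := n) (by positivity)
      simp only [delBarFun, delFun, delBar, del, fderiv_beamIntegral_apply hB hPc] at h1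
      simp only [delBarFun, delFun, delBar, del, fd _ hn, fd _ hn2]
      push_cast
      linear_combination 2 * h1
    · have hn2 : ¬ Odd (n + 2) := by simpa [parity_simps] using hn
      rw [fd0 _ hn, fd0 _ hn2]
      simp [delBarFun, delFun, delBar, del]

/-! ### Exponentials of sequences -/

/-- The coefficients of the power series `exp (∑ c_n X^n)`, for `c_0 = 0`. -/
def expCoeff (c : ℕ → ℂ) : ℕ → ℂ
  | 0 => 1
  | n + 1 => (∑ k : Fin (n + 1), ((k : ℕ) + 1 : ℂ) * c (k + 1) * expCoeff c (n - k)) / (n + 1)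
termination_by n => n
decreasing_by omega

theorem expCoeff_zero (c : ℕ → ℂ) : expCoeff c 0 = 1 := by rw [expCoeff]

theorem expCoeff_succ (c : ℕ → ℂ) (n : ℕ) : expCoeff c (n + 1) =
    (∑ k ∈ Finset.range (n + 1), ((k : ℂ) + 1) * c (k + 1) * expCoeff c (n - k)) / (n + 1) := by
  rw [expCoeff, Finset.sum_range]

section

open PowerSeries

theorem derivative_mk_expCoeff (c : ℕ → ℂ) :
    derivative ℂ (mk (expCoeff c)) = derivative ℂ (mk c) * mk (expCoeff c) := by
  ext n
  rw [coeff_derivative, coeff_mk, coeff_mul, Finset.Nat.sum_antidiagonal_eq_sum_range_succ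
    (fun i j => coeff i (derivative ℂ (mk c)) * coeff j (mk (expCoeff c))), expCoeff_succ,
    div_mul_cancel₀ _ (Nat.cast_add_one_ne_zero n)]
  refine Finset.sum_congr rfl fun k _ => ?_
  rw [coeff_derivative, coeff_mk, coeff_mk]
  ring

/-- The product of the two series has zero formal derivative and constant term 1. -/
theorem expCoeff_mul_neg (c : ℕ → ℂ) : mk (expCoeff fun n => -c n) * mk (expCoeff c) = 1 := by
  have hneg : mk (fun n => -c n) = -mk c := by ext n; simp
  refine derivative.ext ?_ ?_
  · rw [Derivation.leibniz, derivative_mk_expCoeff, derivative_mk_expCoeff, hneg, map_neg,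
      derivative_one, smul_eq_mul, smul_eq_mul]
    ring
  · rw [map_mul, ← coeff_zero_eq_constantCoeff_apply, ← coeff_zero_eq_constantCoeff_apply, coeff_mk,
      coeff_mk, expCoeff_zero, expCoeff_zero, map_one, mul_one]

theorem sum_sum_range_mul_le {x y : ℕ → ℝ} (hx : ∀ n, 0 ≤ x n) (hy : ∀ n, 0 ≤ y n) (N : ℕ) :
    ∑ n ∈ Finset.range N, ∑ k ∈ Finset.range (n + 1), x k * y (n - k) ≤
      (∑ k ∈ Finset.range N, x k) * ∑ l ∈ Finset.range N, y l := by
  rw [Finset.sum_range_diag_flip N fun k l => x k * y l, Finset.sum_mul]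
  refine Finset.sum_le_sum fun k _ => ?_
  rw [← Finset.mul_sum]
  exact mul_le_mul_of_nonneg_left (Finset.sum_le_sum_of_subset_of_nonneg
    (Finset.range_mono (Nat.sub_le N k)) fun _ _ _ => hy _) (hx k)

theorem hasDerivAt_sum_range_succ (b : ℕ → ℝ) (N : ℕ) (t : ℝ) :
    HasDerivAt (fun t => ∑ n ∈ Finset.range (N + 1), b n * t ^ n)
      (∑ n ∈ Finset.range N, ((n + 1 : ℝ) * b (n + 1)) * t ^ n) t := by
  have h : HasDerivAt (fun t => ∑ n ∈ Finset.range (N + 1), b n * t ^ n)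
      (∑ n ∈ Finset.range (N + 1), b n * (n * t ^ (n - 1))) t :=
    HasDerivAt.fun_sum fun n _ => (hasDerivAt_pow n t).const_mul (b n)
  refine h.congr_deriv ?_
  rw [Finset.sum_range_succ']
  simp only [Nat.cast_zero, zero_mul, mul_zero, add_zero, Nat.add_sub_cancel, Nat.cast_add,
    Nat.cast_one]
  exact Finset.sum_congr rfl fun n _ => by ring

/-- For the truncated generating polynomials F of A and G of H the recurrence gives F' ≤ G'F on [0,
1], since all coefficients are nonnegative. Thus F e^{-G} decreases there, and F(1) ≤ F(0) e^{G(1)}.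
-/
theorem sum_le_exp_of_recurrence {A H : ℕ → ℝ} (hA : ∀ n, 0 ≤ A n) (hH : ∀ n, 0 ≤ H n)
    (hrec : ∀ n : ℕ, (n + 1 : ℝ) * A (n + 1) ≤
      ∑ k ∈ Finset.range (n + 1), ((k + 1 : ℝ) * H (k + 1)) * A (n - k)) (N : ℕ) :
    ∑ n ∈ Finset.range (N + 1), A n ≤ A 0 * Real.exp (∑ n ∈ Finset.range (N + 1), H n) := by
  let F : ℝ → ℝ := fun t => ∑ n ∈ Finset.range (N + 1), A n * t ^ n
  let G : ℝ → ℝ := fun t => ∑ n ∈ Finset.range (N + 1), H n * t ^ n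
  let F' : ℝ → ℝ := fun t => ∑ n ∈ Finset.range N, ((n + 1 : ℝ) * A (n + 1)) * t ^ n
  let G' : ℝ → ℝ := fun t => ∑ n ∈ Finset.range N, ((n + 1 : ℝ) * H (n + 1)) * t ^ n
  have hF : ∀ t, HasDerivAt F (F' t) t := fun t => hasDerivAt_sum_range_succ A N t
  have hG : ∀ t, HasDerivAt G (G' t) t := fun t => hasDerivAt_sum_range_succ H N t
  have hle : ∀ t, 0 ≤ t → F' t ≤ G' t * F t := fun t ht => by
    calc F' t ≤ ∑ n ∈ Finset.range N, ∑ k ∈ Finset.range (n + 1),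
          ((k + 1 : ℝ) * H (k + 1) * t ^ k) * (A (n - k) * t ^ (n - k)) := by
          refine Finset.sum_le_sum fun n _ => ?_
          refine (mul_le_mul_of_nonneg_right (hrec n) (pow_nonneg ht n)).trans (le_of_eq ?_)
          rw [Finset.sum_mul]
          refine Finset.sum_congr rfl fun k hk => ?_
          have : t ^ n = t ^ k * t ^ (n - k) := by
            rw [← pow_add, Nat.add_sub_cancel' (Nat.lt_succ_iff.1 (Finset.mem_range.1 hk))]
          rw [this]; ring
      _ ≤ G' t * ∑ n ∈ Finset.range N, A n * t ^ n := sum_sum_range_mul_le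
          (x := fun k => (k + 1 : ℝ) * H (k + 1) * t ^ k) (y := fun k => A k * t ^ k)
          (fun k => mul_nonneg (mul_nonneg (Nat.cast_add_one_pos k).le (hH _)) (pow_nonneg ht _))
          (fun k => mul_nonneg (hA _) (pow_nonneg ht _)) N
      _ ≤ G' t * F t := by
          refine mul_le_mul_of_nonneg_left (Finset.sum_le_sum_of_subset_of_nonneg
            (Finset.range_mono (Nat.le_succ N)) fun _ _ _ => mul_nonneg (hA _) (pow_nonneg ht _))
            (Finset.sum_nonneg fun k _ => mul_nonneg (mul_nonneg (Nat.cast_add_one_pos k).le (hH _))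
              (pow_nonneg ht _))
  have hφ : ∀ t, HasDerivAt (fun t => F t * Real.exp (-G t))
      (F' t * Real.exp (-G t) + F t * (Real.exp (-G t) * -G' t)) t :=
    fun t => (hF t).mul (hG t).neg.exp
  have hmono : AntitoneOn (fun t => F t * Real.exp (-G t)) (Icc 0 1) := by
    refine antitoneOn_of_deriv_nonpos (convex_Icc 0 1) (fun t _ => (hφ t).continuousAt.continuousWithinAt)
      (fun t _ => (hφ t).differentiableAt.differentiableWithinAt) fun t ht => ?_
    rw [interior_Icc] at ht
    rw [(hφ t).deriv]
    have := mul_le_mul_of_nonneg_right (hle t ht.1.le) (Real.exp_pos (-G t)).le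
    linarith
  have h := hmono (left_mem_Icc.2 zero_le_one) (right_mem_Icc.2 zero_le_one) zero_le_one
  have hF0 : F 0 = A 0 := by
    simp only [F]
    rw [Finset.sum_range_succ']
    simp
  have hG0 : 0 ≤ G 0 := Finset.sum_nonneg fun n _ => mul_nonneg (hH _) (by positivity)
  have hF1 : F 1 = ∑ n ∈ Finset.range (N + 1), A n := by simp [F]
  have hG1 : G 1 = ∑ n ∈ Finset.range (N + 1), H n := by simp [G]
  simp only [hF0, hF1, hG1] at h
  have h2 := mul_le_mul_of_nonneg_right h (Real.exp_pos (∑ n ∈ Finset.range (N + 1), H n)).le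
  rw [mul_assoc, ← Real.exp_add, neg_add_cancel, Real.exp_zero, mul_one] at h2
  refine h2.trans (mul_le_mul_of_nonneg_right ?_ (Real.exp_pos _).le)
  exact mul_le_of_le_one_right (hA 0) (Real.exp_le_one_iff.2 (by linarith))

theorem sum_norm_expCoeff_le (c : ℕ → ℂ) (N : ℕ) : ∑ n ∈ Finset.range (N + 1), ‖expCoeff c n‖ ≤
    Real.exp (∑ n ∈ Finset.range (N + 1), ‖c n‖) := by
  refine (sum_le_exp_of_recurrence (A := fun n => ‖expCoeff c n‖) (H := fun n => ‖c n‖)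
    (fun _ => norm_nonneg _) (fun _ => norm_nonneg _) (fun n => ?_) N).trans (by simp [expCoeff_zero])
  have hn : (0 : ℝ) < n + 1 := by positivity
  have hnorm : ∀ k : ℕ, ‖(k : ℂ) + 1‖ = k + 1 := fun k => by
    rw [← Nat.cast_add_one, Complex.norm_natCast]; push_cast; rfl
  rw [expCoeff_succ, norm_div, hnorm, mul_div_cancel₀ _ hn.ne']
  refine (norm_sum_le _ _).trans (Finset.sum_le_sum fun k _ => ?_)
  rw [norm_mul, norm_mul, hnorm]

theorem contDiff_expCoeff {c : ℕ → ℂ → ℂ} (hc : ∀ n, ContDiff ℝ 1 (c n)) (n : ℕ) :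
    ContDiff ℝ 1 fun z => expCoeff (fun n => c n z) n := by
  induction n using Nat.strong_induction_on with
  | _ n ih =>
    cases n with
    | zero => simpa only [expCoeff_zero] using contDiff_const
    | succ n =>
      simp only [expCoeff_succ]
      refine ContDiff.div_const (ContDiff.sum fun k hk => ?_) _
      exact (contDiff_const.mul (hc _)).mul (ih _ (by have := Finset.mem_range.1 hk; omega))

/-- This is the chain rule (exp H)' = H' exp H for formal series in X. Differentiating the
recurrence in `z` shows that both sides solve the same linear formal equation in X; hence exp(-H)
times their difference has zero formal derivative and, as H has no constant term, zero constant
coefficient. -/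
theorem fderiv_expCoeff {c : ℕ → ℂ → ℂ} (hc : ∀ n, ContDiff ℝ 1 (c n)) (h0 : ∀ z, c 0 z = 0)
    (z e : ℂ) : mk (fun n => fderiv ℝ (fun z => expCoeff (fun n => c n z) n) z e) =
      mk (fun n => fderiv ℝ (c n) z e) * mk (expCoeff fun n => c n z) := by
  set A := mk (expCoeff fun n => c n z) with hA
  set A' := mk (fun n => fderiv ℝ (fun z => expCoeff (fun n => c n z) n) z e) with hA'
  set H := mk (fun n => c n z) with hH
  set H' := mk (fun n => fderiv ℝ (c n) z e) with hH'
  have hdA : ∀ n, DifferentiableAt ℝ (fun z => expCoeff (fun n => c n z) n) z := fun n =>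
    ((contDiff_expCoeff hc n).differentiable one_ne_zero) z
  have hdc : ∀ n, DifferentiableAt ℝ (c n) z := fun n => ((hc n).differentiable one_ne_zero) z
  have d1 : derivative ℂ A = derivative ℂ H * A := derivative_mk_expCoeff _
  have d2 : derivative ℂ A' = derivative ℂ H' * A + derivative ℂ H * A' := by
    ext n
    rw [map_add, coeff_derivative, hA', coeff_mk, coeff_mul, coeff_mul,
      Finset.Nat.sum_antidiagonal_eq_sum_range_succ
        (fun i j => coeff i (derivative ℂ H') * coeff j A),
      Finset.Nat.sum_antidiagonal_eq_sum_range_succ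
        (fun i j => coeff i (derivative ℂ H) * coeff j _), ← Finset.sum_add_distrib]
    have : (fun z => expCoeff (fun n => c n z) (n + 1)) = fun z => (n + 1 : ℂ)⁻¹ *
        ∑ k ∈ Finset.range (n + 1), ((k : ℂ) + 1) * c (k + 1) z * expCoeff (fun n => c n z) (n - k) := by
      ext z; rw [expCoeff_succ, div_eq_inv_mul]
    have hd : ∀ k ∈ Finset.range (n + 1), DifferentiableAt ℝ (fun z =>
        ((k : ℂ) + 1) * c (k + 1) z * expCoeff (fun n => c n z) (n - k)) z := fun k _ =>
      ((hdc _).const_mul _).mul (hdA _)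
    rw [this, fderiv_const_mul (DifferentiableAt.fun_sum hd), fderiv_fun_sum hd, smul_apply,
      sum_apply, smul_eq_mul, mul_comm, mul_inv_cancel_left₀ (Nat.cast_add_one_ne_zero n)]
    refine Finset.sum_congr rfl fun k _ => ?_
    rw [fderiv_fun_mul ((hdc _).const_mul _) (hdA _), fderiv_const_mul (hdc _)]
    simp only [coeff_derivative, hH, hH', hA, coeff_mk, add_apply, smul_apply, smul_eq_mul]
    ring
  have hinv : mk (expCoeff fun n => -c n z) * A = 1 := expCoeff_mul_neg _
  have d3 : derivative ℂ (mk (expCoeff fun n => -c n z)) =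
      -derivative ℂ H * mk (expCoeff fun n => -c n z) := by
    rw [derivative_mk_expCoeff, ← map_neg]
    congr 2
  have hY : mk (expCoeff fun n => -c n z) * (A' - H' * A) = 0 := by
    refine derivative.ext ?_ ?_
    · rw [Derivation.leibniz, map_sub, Derivation.leibniz, d1, d2, d3, map_zero]
      simp only [smul_eq_mul]
      ring
    · rw [map_mul, map_sub, map_mul]
      simp only [← coeff_zero_eq_constantCoeff_apply, hA', hH', coeff_mk, expCoeff_zero]
      simp [show c 0 = fun _ => 0 from funext h0]
  have : A' - H' * A = 0 := by
    rw [← one_mul (A' - H' * A), ← hinv, mul_assoc, mul_comm A, ← mul_assoc, hY, zero_mul]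
  exact sub_eq_zero.1 this

end

/-- The properties of the Fourier modes `α`, `β` of a pair of integrating factors `e^{-h}`, `e^h` of
the transport operator with attenuation `a`: the bounds hold in `ℓ¹` uniformly on the disc. -/
structure IsIntegratingPair (a : ℂ → ℝ) (α β : ℕ → ℂ → ℂ) (C : ℝ) : Prop where
  contDiff_left : ∀ n, ContDiff ℝ 1 (α n)
  contDiff_right : ∀ n, ContDiff ℝ 1 (β n)
  bound_left : ∀ z ∈ disc, ∀ N, ∑ n ∈ Finset.range N,
    (‖α n z‖ + ‖fderiv ℝ (α n) z 1‖ + ‖fderiv ℝ (α n) z Complex.I‖) ≤ C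
  bound_right : ∀ z ∈ disc, ∀ N, ∑ n ∈ Finset.range N,
    (‖β n z‖ + ‖fderiv ℝ (β n) z 1‖ + ‖fderiv ℝ (β n) z Complex.I‖) ≤ C
  mul_zero : ∀ z, β 0 z * α 0 z = 1
  mul_succ : ∀ z n, ∑ k ∈ Finset.range (n + 2), β k z * α (n + 1 - k) z = 0
  delBar_zero : ∀ z ∈ disc, delBarFun (α 0) z = 0
  delBar_one : ∀ z ∈ disc, delBarFun (α 1) z = a z * α 0 z
  delBar_add_two : ∀ z ∈ disc, ∀ n,
    delBarFun (α (n + 2)) z + delFun (α n) z = a z * α (n + 1) z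

/-- The series itself is bounded by e^C, and each of the two partial derivatives, being the product
of the derivative of the phase with the exponential, by C e^C. -/
theorem sum_norm_expCoeff_fderiv_le {c : ℕ → ℂ → ℂ} (hc : ∀ n, ContDiff ℝ 1 (c n))
    (h0 : ∀ z, c 0 z = 0) {z : ℂ} {C : ℝ} (hC : ∀ N, ∑ n ∈ Finset.range N,
      (‖c n z‖ + ‖fderiv ℝ (c n) z 1‖ + ‖fderiv ℝ (c n) z Complex.I‖) ≤ C) (N : ℕ) :
    ∑ n ∈ Finset.range N, (‖expCoeff (fun n => c n z) n‖ +
      ‖fderiv ℝ (fun z => expCoeff (fun n => c n z) n) z 1‖ +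
      ‖fderiv ℝ (fun z => expCoeff (fun n => c n z) n) z Complex.I‖) ≤ (1 + 2 * C) * Real.exp C := by
  have hC0 : 0 ≤ C := by simpa using hC 0
  have hE : ∑ n ∈ Finset.range N, ‖expCoeff (fun n => c n z) n‖ ≤ Real.exp C := by
    refine (Finset.sum_le_sum_of_subset_of_nonneg (Finset.range_mono (Nat.le_succ N))
      fun _ _ _ => norm_nonneg _).trans ((sum_norm_expCoeff_le _ N).trans (Real.exp_le_exp.2 ?_))
    exact (Finset.sum_le_sum fun n _ => by
      linarith [norm_nonneg (fderiv ℝ (c n) z 1), norm_nonneg (fderiv ℝ (c n) z Complex.I)]).trans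
      (hC _)
  have hD : ∀ e : ℂ, ∑ n ∈ Finset.range N, ‖fderiv ℝ (c n) z e‖ ≤ C →
      ∑ n ∈ Finset.range N, ‖fderiv ℝ (fun z => expCoeff (fun n => c n z) n) z e‖ ≤
        C * Real.exp C := fun e he => by
    refine (Finset.sum_le_sum fun n _ => ?_).trans ((sum_sum_range_mul_le (x := fun n =>
      ‖fderiv ℝ (c n) z e‖) (y := fun n => ‖expCoeff (fun n => c n z) n‖) (fun _ => norm_nonneg _)
      (fun _ => norm_nonneg _) N).trans (mul_le_mul he hE (Finset.sum_nonneg fun _ _ => norm_nonneg _)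
      hC0))
    have h := congrArg (PowerSeries.coeff n) (fderiv_expCoeff hc h0 z e)
    rw [PowerSeries.coeff_mk, PowerSeries.coeff_mul, Finset.Nat.sum_antidiagonal_eq_sum_range_succ
        (fun i j => PowerSeries.coeff i _ * PowerSeries.coeff j _)] at h
    rw [h]
    refine (norm_sum_le _ _).trans (le_of_eq (Finset.sum_congr rfl fun k _ => ?_))
    rw [norm_mul, PowerSeries.coeff_mk, PowerSeries.coeff_mk]
  have h1 := hD 1 ((Finset.sum_le_sum fun n _ => by
      linarith [norm_nonneg (c n z), norm_nonneg (fderiv ℝ (c n) z Complex.I)]).trans (hC N))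
  have h2 := hD Complex.I ((Finset.sum_le_sum fun n _ => by
      linarith [norm_nonneg (c n z), norm_nonneg (fderiv ℝ (c n) z 1)]).trans (hC N))
  rw [Finset.sum_add_distrib, Finset.sum_add_distrib]
  linarith

open PowerSeries in
-- Let H be the generating series of the phase. The equations of `exists_phase` say (∂̄ + X²∂)H =
-- -aX. By the chain rule A = exp(-H) satisfies (∂̄ + X²∂)A = aXA, whose coefficients are the three
-- differential identities required; `β` comes from exp(H).
theorem exists_isIntegratingPair {s : ℝ} {a : ℂ → ℝ} (ha : IsC2Holder s a) :
    ∃ α β C, IsIntegratingPair a α β C := by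
  obtain ⟨h, K, hc, h0, hK, h1, h2⟩ := exists_phase ha
  have hc' : ∀ n, ContDiff ℝ 1 fun z => -h n z := fun n => (hc n).neg
  have h0' : ∀ z, -h 0 z = 0 := fun z => by rw [h0, neg_zero]
  have hfd : ∀ n z e, fderiv ℝ (fun z => -h n z) z e = -fderiv ℝ (h n) z e := fun n z e => by
    rw [fderiv_fun_neg, neg_apply]
  let α : ℕ → ℂ → ℂ := fun n z => expCoeff (fun n => -h n z) n
  let β : ℕ → ℂ → ℂ := fun n z => expCoeff (fun n => h n z) n
  have hmul : ∀ z, mk (fun n => β n z) * mk (fun n => α n z) = 1 := fun z => by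
    rw [mul_comm]; exact expCoeff_mul_neg _
  have hz0 : h 0 = fun _ => 0 := funext h0
  have key : ∀ z ∈ disc, mk (fun n => delBarFun (α n) z) + X ^ 2 * mk (fun n => delFun (α n) z) =
      C (a z : ℂ) * X * mk (fun n => α n z) := fun z hz => by
    have hx := fderiv_expCoeff hc' h0' z 1
    have hy := fderiv_expCoeff hc' h0' z Complex.I
    simp only [hfd] at hx hy
    have e1 : mk (fun n => delBarFun (α n) z) =
        C (1 / 2 : ℂ) * (mk (fun n => fderiv ℝ (α n) z 1) +
          C Complex.I * mk fun n => fderiv ℝ (α n) z Complex.I) := by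
      ext n
      simp only [coeff_mk, coeff_C_mul, map_add, delBarFun, delBar]; ring
    have e2 : mk (fun n => delFun (α n) z) =
        C (1 / 2 : ℂ) * (mk (fun n => fderiv ℝ (α n) z 1) -
          C Complex.I * mk fun n => fderiv ℝ (α n) z Complex.I) := by
      ext n
      simp only [coeff_mk, coeff_C_mul, map_sub, delFun, del]; ring
    have e3 : C (1 / 2 : ℂ) * (mk (fun n => -fderiv ℝ (h n) z 1) +
          C Complex.I * mk fun n => -fderiv ℝ (h n) z Complex.I) +
        X ^ 2 * (C (1 / 2 : ℂ) * (mk (fun n => -fderiv ℝ (h n) z 1) -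
          C Complex.I * mk fun n => -fderiv ℝ (h n) z Complex.I)) = C (a z : ℂ) * X := by
      ext n
      have g1 := h1 z hz
      have g2 := h2 z hz
      simp only [delBarFun, delBar, delFun, del] at g1 g2
      rw [map_add, coeff_C_mul, map_add, coeff_C_mul, coeff_mk, coeff_mk, coeff_C_mul, coeff_X]
      match n with
      | 0 => simp [hz0, coeff_X_pow_mul']
      | 1 =>
        rw [coeff_X_pow_mul', if_neg (by norm_num), if_pos rfl]
        linear_combination -g1
      | n + 2 =>
        rw [coeff_X_pow_mul, if_neg (by omega), coeff_C_mul, map_sub, coeff_C_mul, coeff_mk, coeff_mk]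
        linear_combination -(g2 n)
    rw [e1, e2, hx, hy]
    linear_combination e3 * mk (fun n => α n z)
  refine ⟨α, β, (1 + 2 * K) * Real.exp K, fun n => contDiff_expCoeff hc' n,
    fun n => contDiff_expCoeff hc n, fun z hz N => ?_, fun z hz N => ?_, fun z => ?_, fun z n => ?_,
    fun z hz => ?_, fun z hz => ?_, fun z hz n => ?_⟩
  · refine sum_norm_expCoeff_fderiv_le hc' h0' (fun N => ?_) N
    simpa only [hfd, norm_neg] using hK z hz N
  · exact sum_norm_expCoeff_fderiv_le hc h0 (hK z hz) N
  · simp [α, β, expCoeff_zero]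
  · have := congrArg (coeff (n + 1)) (hmul z)
    rw [coeff_mul, Finset.Nat.sum_antidiagonal_eq_sum_range_succ
        (fun i j => coeff i _ * coeff j _), coeff_one, if_neg (by omega)] at this
    simpa only [coeff_mk] using this
  · have := congrArg (coeff 0) (key z hz)
    rw [map_add, coeff_mk, coeff_X_pow_mul', if_neg (by norm_num), mul_assoc, coeff_C_mul,
      coeff_zero_X_mul] at this
    simpa using this
  · have := congrArg (coeff 1) (key z hz)
    rw [map_add, coeff_mk, coeff_X_pow_mul', if_neg (by norm_num), mul_assoc, coeff_C_mul,
      show 1 = 0 + 1 from rfl, coeff_succ_X_mul, coeff_mk] at this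
    simpa using this
  · have := congrArg (coeff (n + 2)) (key z hz)
    rwa [map_add, coeff_mk, coeff_X_pow_mul, mul_assoc, coeff_C_mul, coeff_mk,
      show n + 2 = (n + 1) + 1 from rfl, coeff_succ_X_mul, coeff_mk] at this

open scoped ComplexConjugate

/-! ### Polar coordinates and the divergence theorem on the disc -/

theorem integral_disc_polar (F : ℂ → ℂ) : ∫ z, F z ∂discMeasure =
    ∫ p : ℝ × ℝ, p.1 * F (p.1 * dir p.2) ∂((volume.restrict (Ioc (0 : ℝ) 1)).prod angleMeasure) := by
  have hm : MeasurableSet (Iio (1 : ℝ) ×ˢ (univ : Set ℝ)) := measurableSet_Iio.prod MeasurableSet.univ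
  have h1 : ∫ p in polarCoord.target, p.1 • disc.indicator F (Complex.polarCoord.symm p) =
      ∫ p in polarCoord.target, (Iio (1 : ℝ) ×ˢ (univ : Set ℝ)).indicator
        (fun p : ℝ × ℝ => p.1 * F (p.1 * dir p.2)) p := by
    refine setIntegral_congr_fun polarCoord.open_target.measurableSet fun p hp => ?_
    have hp0 : 0 < p.1 := hp.1
    have e : Complex.polarCoord.symm p = p.1 * dir p.2 := by
      rw [Complex.polarCoord_symm_apply, dir, mul_comm Complex.I, Complex.exp_mul_I,
        ← Complex.ofReal_cos, ← Complex.ofReal_sin]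
    have hmem : (p.1 : ℂ) * dir p.2 ∈ disc ↔ p.1 < 1 := by
      rw [disc, mem_ball_zero_iff, norm_mul, norm_dir, mul_one, Complex.norm_real, Real.norm_eq_abs,
        abs_of_pos hp0]
    rw [e]
    by_cases h : p.1 < 1
    · rw [indicator_of_mem (hmem.2 h), indicator_of_mem (by simpa using h), Complex.real_smul]
    · rw [indicator_of_notMem (fun h' => h (hmem.1 h')), indicator_of_notMem (by simpa using h),
        smul_zero]
  have hset : polarCoord.target ∩ Iio (1 : ℝ) ×ˢ (univ : Set ℝ) =
      Ioo (0 : ℝ) 1 ×ˢ Ioo (-Real.pi) Real.pi := by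
    ext p
    simp only [polarCoord_target, mem_inter_iff, mem_prod, mem_Ioi, mem_Ioo, mem_Iio, mem_univ]
    tauto
  rw [discMeasure, ← integral_indicator measurableSet_disc, ← Complex.integral_comp_polarCoord_symm,
    h1, setIntegral_indicator hm, hset, Measure.volume_eq_prod, ← Measure.prod_restrict,
    angleMeasure, Measure.restrict_congr_set Ioo_ae_eq_Ioc, Measure.restrict_congr_set Ioo_ae_eq_Ioc]

theorem integrable_polar {F : ℝ × ℝ → ℂ} (hF : Continuous F) :
    Integrable F ((volume.restrict (Ioc (0 : ℝ) 1)).prod angleMeasure) := by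
  rw [angleMeasure, Measure.prod_restrict]
  exact (hF.continuousOn.integrableOn_compact (isCompact_Icc.prod isCompact_Icc)).mono_set
    (Set.prod_mono Ioc_subset_Icc_self Ioc_subset_Icc_self)

/-- Write e = ν e_r + ν' e_β with ν'' = -ν. The polar density r ∂_eψ is then the sum of ∂_r(rνψ),
called `R`, and ∂_β(ν'ψ), called `Q`. The first integrates to the boundary value at r = 1, the
second to zero over a period. -/
theorem integral_fderiv_disc {ψ : ℂ → ℂ} (hψ : ContDiff ℝ 1 ψ) {e : ℂ} {ν ν' : ℝ → ℝ}
    (hν : ∀ β, HasDerivAt ν (ν' β) β) (hν' : ∀ β, HasDerivAt ν' (-ν β) β)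
    (hper : ν' Real.pi = ν' (-Real.pi))
    (he : ∀ β, e = ν β * dir β + ν' β * (Complex.I * dir β)) :
    ∫ z, fderiv ℝ ψ z e ∂discMeasure = ∫ β, ψ (dir β) * ν β ∂angleMeasure := by
  have hdc := continuous_dir
  have hνc : Continuous ν := continuous_iff_continuousAt.2 fun β => (hν β).continuousAt
  have hνc' : Continuous ν' := continuous_iff_continuousAt.2 fun β => (hν' β).continuousAt
  have hψc := hψ.continuous
  have hdψ : Continuous (fderiv ℝ ψ) := hψ.continuous_fderiv one_ne_zero
  have hd : ∀ z, HasFDerivAt ψ (fderiv ℝ ψ z) z := fun z =>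
    ((hψ.differentiable one_ne_zero) z).hasFDerivAt
  let R : ℝ × ℝ → ℂ := fun p => ν p.2 * ψ (p.1 * dir p.2) +
    p.1 * ν p.2 * fderiv ℝ ψ (p.1 * dir p.2) (dir p.2)
  let Q : ℝ × ℝ → ℂ := fun p => -ν p.2 * ψ (p.1 * dir p.2) +
    ν' p.2 * fderiv ℝ ψ (p.1 * dir p.2) (p.1 * (Complex.I * dir p.2))
  have hRc : Continuous R := by simp only [R]; fun_prop
  have hQc : Continuous Q := by simp only [Q]; fun_prop
  have hR : ∀ r β : ℝ, HasDerivAt (fun r : ℝ => r * ν β * ψ (r * dir β)) (R (r, β)) r := fun r β => by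
    have h1 : HasDerivAt (fun r : ℝ => (r : ℂ) * dir β) (dir β) r := by
      simpa using ((hasDerivAt_id (r : ℂ)).mul_const (dir β)).comp_ofReal
    have h2 : HasDerivAt (fun r : ℝ => (r : ℂ) * ν β) (ν β) r := by
      simpa using ((hasDerivAt_id (r : ℂ)).mul_const (ν β : ℂ)).comp_ofReal
    exact h2.mul ((hd _).comp_hasDerivAt r h1)
  have hQ : ∀ r β : ℝ, HasDerivAt (fun β : ℝ => ν' β * ψ (r * dir β)) (Q (r, β)) β := fun r β => by
    have h1 : HasDerivAt (fun β : ℝ => (r : ℂ) * dir β) (r * (Complex.I * dir β)) β :=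
      (hasDerivAt_dir β).const_mul (r : ℂ)
    have h2 : HasDerivAt (fun β : ℝ => (ν' β : ℂ)) (-ν β : ℝ) β := (hν' β).ofReal_comp
    refine (h2.mul ((hd _).comp_hasDerivAt β h1)).congr_deriv ?_
    simp only [Q, Function.comp_apply]
    push_cast
    ring
  have hRQ : ∀ p : ℝ × ℝ, (p.1 : ℂ) * fderiv ℝ ψ (p.1 * dir p.2) e = R p + Q p := fun p => by
    simp only [R, Q]
    conv_lhs => rw [he p.2]
    have hs : ∀ (L : ℂ →L[ℝ] ℂ) (t : ℝ) (w : ℂ), L (t * w) = t * L w := fun L t w => by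
      rw [← Complex.real_smul, map_smul, Complex.real_smul]
    rw [map_add, hs, hs, hs]
    ring
  rw [integral_disc_polar]
  simp_rw [hRQ]
  rw [integral_add (integrable_polar hRc) (integrable_polar hQc),
    integral_prod_symm _ (integrable_polar hRc), integral_prod _ (integrable_polar hQc)]
  have e1 : ∀ β : ℝ, ∫ r in Ioc (0 : ℝ) 1, R (r, β) = ψ (dir β) * ν β := fun β => by
    rw [← intervalIntegral.integral_of_le zero_le_one,
      intervalIntegral.integral_eq_sub_of_hasDerivAt (fun r _ => hR r β)
      (Continuous.intervalIntegrable (by fun_prop) _ _)]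
    simp [mul_comm]
  have e2 : ∀ r : ℝ, ∫ β, Q (r, β) ∂angleMeasure = 0 := fun r => by
    have hper2 : dir Real.pi = dir (-Real.pi) := by
      rw [← periodic_dir (-Real.pi)]; congr 1; ring
    rw [angleMeasure, ← intervalIntegral.integral_of_le (by linarith [Real.pi_pos]),
      intervalIntegral.integral_eq_sub_of_hasDerivAt (fun β _ => hQ r β)
      (Continuous.intervalIntegrable (by fun_prop) _ _), hper, hper2, sub_self]
  simp_rw [e1, e2]
  simp

theorem integral_fderiv_one_disc {ψ : ℂ → ℂ} (hψ : ContDiff ℝ 1 ψ) :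
    ∫ z, fderiv ℝ ψ z 1 ∂discMeasure = ∫ β, ψ (dir β) * Real.cos β ∂angleMeasure := by
  refine integral_fderiv_disc hψ (ν' := fun β => -Real.sin β) Real.hasDerivAt_cos
    (fun β => (Real.hasDerivAt_sin β).neg) (by simp) fun β => ?_
  rw [dir, mul_comm Complex.I, Complex.exp_mul_I]
  push_cast
  linear_combination -Complex.sin_sq_add_cos_sq (β : ℂ) + Complex.sin β ^ 2 * Complex.I_sq

theorem integral_fderiv_I_disc {ψ : ℂ → ℂ} (hψ : ContDiff ℝ 1 ψ) :
    ∫ z, fderiv ℝ ψ z Complex.I ∂discMeasure = ∫ β, ψ (dir β) * Real.sin β ∂angleMeasure := by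
  refine integral_fderiv_disc hψ (ν' := fun β => Real.cos β) Real.hasDerivAt_sin
    (fun β => Real.hasDerivAt_cos β) (by simp) fun β => ?_
  rw [dir, mul_comm Complex.I, Complex.exp_mul_I]
  push_cast
  linear_combination -Complex.I * Complex.sin_sq_add_cos_sq (β : ℂ) -
    Complex.cos β * Complex.sin β * Complex.I_sq

theorem integral_conj_pow_mul_pow (m n : ℕ) : ∫ z : ℂ, conj (z ^ m) * z ^ n ∂discMeasure =
    if m = n then ((Real.pi / (n + 1) : ℝ) : ℂ) else 0 := by
  have e : ∀ p : ℝ × ℝ, (p.1 : ℂ) * (conj ((p.1 * dir p.2) ^ m) * (p.1 * dir p.2) ^ n) =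
      ((p.1 ^ (m + n + 1) : ℝ) : ℂ) * Complex.exp (Complex.I * ((n : ℤ) - (m : ℤ) : ℤ) * p.2) :=
    fun p => by
      have h1 : conj (dir p.2) ^ m * dir p.2 ^ n =
          Complex.exp (Complex.I * ((n : ℤ) - (m : ℤ) : ℤ) * p.2) := by
        rw [dir, ← Complex.exp_conj, ← Complex.exp_nat_mul, ← Complex.exp_nat_mul, ← Complex.exp_add]
        congr 1
        simp only [map_mul, Complex.conj_I, Complex.conj_ofReal]
        push_cast; ring
      rw [← h1, map_pow, map_mul, Complex.conj_ofReal, mul_pow, mul_pow]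
      push_cast
      ring
  rw [integral_disc_polar]
  simp_rw [e]
  rw [integral_prod_mul (fun r : ℝ => ((r ^ (m + n + 1) : ℝ) : ℂ))
    (fun β : ℝ => Complex.exp (Complex.I * ((n : ℤ) - (m : ℤ) : ℤ) * β)), integral_exp_angle,
    integral_complex_ofReal, ← intervalIntegral.integral_of_le zero_le_one, integral_pow]
  by_cases h : m = n
  · subst h
    have hn : (m : ℂ) + 1 ≠ 0 := Nat.cast_add_one_ne_zero m
    have hn2 : ((m + m + 1 : ℕ) : ℝ) + 1 = 2 * (m + 1) := by push_cast; ring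
    simp only [sub_self, if_true]
    rw [hn2, one_pow, zero_pow (by omega)]
    push_cast
    field_simp
    ring
  · rw [if_neg h, if_neg (by omega)]; simp

/-! ### Limits of orthogonal series in `L²` -/

/-- Riesz–Fischer for the normalized family `e n / √(w n)`, stated with functions instead of
classes. -/
theorem exists_orthogonal_limit {X : Type*} [MeasurableSpace X] {μ : Measure X} {e : ℕ → X → ℂ}
    (he : ∀ n, MemLp (e n) 2 μ) {w : ℕ → ℝ} (hw : ∀ n, 0 < w n)
    (horth : ∀ m n, ∫ x, conj (e m x) * e n x ∂μ = if m = n then (w n : ℂ) else 0) {c : ℕ → ℂ}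
    (hc : Summable fun n => w n * ‖c n‖ ^ 2) :
    ∃ v : X → ℂ, MemLp v 2 μ ∧ eLpNorm v 2 μ ^ 2 ≤ ENNReal.ofReal (∑' n, w n * ‖c n‖ ^ 2) ∧
      Tendsto (fun N => eLpNorm (fun x => ∑ n ∈ Finset.range N, c n * e n x - v x) 2 μ) atTop
        (𝓝 0) := by
  let b : ℕ → Lp ℂ 2 μ := fun n => ((√(w n))⁻¹ : ℂ) • (he n).toLp
  have hs0 : ∀ n, ((√(w n) : ℝ) : ℂ) ≠ 0 := fun n => by
    rw [Complex.ofReal_ne_zero, Real.sqrt_ne_zero']; exact hw n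
  have hss : ∀ n, ((√(w n) : ℝ) : ℂ) * (√(w n) : ℝ) = w n := fun n => by
    rw [← Complex.ofReal_mul, Real.mul_self_sqrt (hw n).le]
  have hb : Orthonormal ℂ b := by
    rw [orthonormal_iff_ite]
    intro m n
    rw [inner_smul_left, inner_smul_right, L2.inner_def,
      integral_congr_ae (g := fun x => conj (e m x) * e n x), horth]
    · by_cases h : m = n
      · subst h
        simp only [if_true, map_inv₀, Complex.conj_ofReal, ← hss m]
        have := hs0 m
        field_simp
      · rw [if_neg h, if_neg h]; simp
    · filter_upwards [(he m).coeFn_toLp, (he n).coeFn_toLp] with x h1 h2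
      rw [h1, h2, RCLike.inner_apply, mul_comm]
  have hterm : ∀ n, ‖(√(w n) : ℂ) * c n‖ ^ 2 = w n * ‖c n‖ ^ 2 := fun n => by
    rw [norm_mul, mul_pow, Complex.norm_real, Real.norm_eq_abs, sq_abs, Real.sq_sqrt (hw n).le]
  have hV : ∀ n, c n • (he n).toLp = ((√(w n) : ℂ) * c n) • b n := fun n => by
    rw [smul_smul, mul_comm (√(w n) : ℂ), mul_assoc, mul_inv_cancel₀ (hs0 n), mul_one]
  have hsum : Summable fun n => ((√(w n) : ℂ) * c n) • b n := by
    have := (hb.orthogonalFamily.summable_iff_norm_sq_summable fun n => (√(w n) : ℂ) * c n).2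
      (by simpa only [hterm] using hc)
    simpa using this
  obtain ⟨v, hv⟩ := hsum
  have hpart : ∀ N, ∑ n ∈ Finset.range N, ((√(w n) : ℂ) * c n) • b n =
      (memLp_finsetSum (Finset.range N) fun n _ => (he n).const_mul (c n)).toLp := fun N => by
    refine Lp.ext ?_
    refine (Lp.coeFn_finsetSum _ _).trans ?_
    refine EventuallyEq.trans ?_ (MemLp.coeFn_toLp _).symm
    have h1 : ∀ᵐ x ∂μ, ∀ n, (((√(w n) : ℂ) * c n) • b n) x = c n * e n x := ae_all_iff.2 fun n => by
      rw [← hV n]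
      filter_upwards [Lp.coeFn_smul (c n) (he n).toLp, (he n).coeFn_toLp] with x h1 h2
      rw [h1, Pi.smul_apply, h2, smul_eq_mul]
    filter_upwards [h1] with x hx
    rw [Finset.sum_apply]
    exact Finset.sum_congr rfl fun n _ => hx n
  have hT : Tendsto (fun N => ∑ n ∈ Finset.range N, ((√(w n) : ℂ) * c n) • b n) atTop (𝓝 v) :=
    hv.tendsto_sum_nat
  refine ⟨v, Lp.memLp v, ?_, ?_⟩
  · have h1 : ‖v‖ ^ 2 ≤ ∑' n, w n * ‖c n‖ ^ 2 := by
      refine le_of_tendsto (hT.norm.pow 2) (Eventually.of_forall fun N => ?_)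
      have := hb.orthogonalFamily.norm_sum (fun n => (√(w n) : ℂ) * c n) (Finset.range N)
      simp only [LinearIsometry.toSpanSingleton_apply] at this
      rw [this]
      simp only [hterm]
      exact hc.sum_le_tsum _ fun n _ => by have := (hw n).le; positivity
    rw [← Lp.enorm_def, ← ofReal_norm, ← ENNReal.ofReal_pow (norm_nonneg _)]
    exact ENNReal.ofReal_le_ofReal h1
  · have := (tendsto_iff_edist_tendsto_0.1 hT)
    refine this.congr fun N => ?_
    rw [hpart, Lp.edist_def]
    refine eLpNorm_congr_ae ?_
    filter_upwards [(memLp_finsetSum (Finset.range N) fun n _ => (he n).const_mul (c n)).coeFn_toLp]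
      with x hx
    simp [hx]

/-- Partial sums of the power series with coefficients `c`, -/
def powerSum (c : ℕ → ℂ) (N : ℕ) (z : ℂ) : ℂ := ∑ n ∈ Finset.range N, c n * z ^ n

/-- and of its derivative. -/
def powerSumDeriv (c : ℕ → ℂ) (N : ℕ) (z : ℂ) : ℂ :=
  ∑ n ∈ Finset.range N, c (n + 1) * ((n + 1) * z ^ n)

theorem hasDerivAt_powerSum (c : ℕ → ℂ) (N : ℕ) (z : ℂ) :
    HasDerivAt (powerSum c (N + 1)) (powerSumDeriv c N z) z := by
  have h : HasDerivAt (powerSum c (N + 1))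
      (∑ n ∈ Finset.range (N + 1), c n * (n * z ^ (n - 1))) z :=
    HasDerivAt.fun_sum fun n _ => (hasDerivAt_pow n z).const_mul (c n)
  refine h.congr_deriv ?_
  rw [Finset.sum_range_succ', powerSumDeriv]
  simp

theorem memLp_disc_of_continuous {F : ℂ → ℂ} (hF : Continuous F) : MemLp F 2 discMeasure := by
  simpa using memLp_continuous_mul (memLp_const (1 : ℂ)) hF

/-- On the disc the powers z^n are orthogonal with squared norm π/(n+1), and the derivatives
(n+1)z^n have squared norm π(n+1); on the circle the squared norm is 2π. The one condition on Σ
(n+1)|c_n|² controls all three series. -/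
theorem exists_powerSum_limit {c : ℕ → ℂ} (hc : Summable fun n : ℕ => ((n : ℝ) + 1) * ‖c n‖ ^ 2) :
    ∃ (v w : ℂ → ℂ) (t : ℝ → ℂ), MemLp v 2 discMeasure ∧ MemLp w 2 discMeasure ∧
      MemLp t 2 angleMeasure ∧
      eLpNorm v 2 discMeasure ^ 2 ≤ ENNReal.ofReal (Real.pi * ∑' n : ℕ, ((n : ℝ) + 1) * ‖c n‖ ^ 2) ∧
      eLpNorm w 2 discMeasure ^ 2 ≤ ENNReal.ofReal (Real.pi * ∑' n : ℕ, ((n : ℝ) + 1) * ‖c n‖ ^ 2) ∧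
      Tendsto (fun N => eLpNorm (fun z => powerSum c N z - v z) 2 discMeasure) atTop (𝓝 0) ∧
      Tendsto (fun N => eLpNorm (fun z => powerSumDeriv c N z - w z) 2 discMeasure) atTop (𝓝 0) ∧
      Tendsto (fun N => eLpNorm (fun β => powerSum c N (dir β) - t β) 2 angleMeasure) atTop
        (𝓝 0) := by
  have hpi := Real.pi_pos
  have hN : ∀ n : ℕ, (0 : ℝ) < n + 1 := fun n => by positivity
  have b1 : ∀ n : ℕ, Real.pi / ((n : ℝ) + 1) * ‖c n‖ ^ 2 ≤
      Real.pi * (((n : ℝ) + 1) * ‖c n‖ ^ 2) := fun n => by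
    rw [← mul_assoc]
    refine mul_le_mul_of_nonneg_right ?_ (by positivity)
    rw [div_le_iff₀ (hN n), mul_assoc]
    exact le_mul_of_one_le_right hpi.le (by nlinarith [(n.cast_nonneg : (0 : ℝ) ≤ n)])
  have b2 : ∀ n : ℕ, Real.pi * ((n : ℝ) + 1) * ‖c (n + 1)‖ ^ 2 ≤
      Real.pi * (((n + 1 : ℕ) + 1 : ℝ) * ‖c (n + 1)‖ ^ 2) := fun n => by
    rw [← mul_assoc]
    gcongr
    exact Nat.le_succ n
  have hc1 := (summable_nat_add_iff 1).2 (hc.mul_left Real.pi)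
  have s1 := (hc.mul_left Real.pi).of_nonneg_of_le (fun n => by positivity) b1
  have s2 := hc1.of_nonneg_of_le (fun n => by positivity) b2
  have s3 : Summable fun n : ℕ => 2 * Real.pi * ‖c n‖ ^ 2 :=
    (hc.mul_left (2 * Real.pi)).of_nonneg_of_le (fun n => by positivity) fun n => by
      gcongr
      nlinarith [(n.cast_nonneg : (0 : ℝ) ≤ n), sq_nonneg ‖c n‖]
  have t1 : ∑' n : ℕ, Real.pi / ((n : ℝ) + 1) * ‖c n‖ ^ 2 ≤
      Real.pi * ∑' n : ℕ, ((n : ℝ) + 1) * ‖c n‖ ^ 2 := by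
    rw [← tsum_mul_left]
    exact s1.tsum_le_tsum b1 (hc.mul_left _)
  have t2 : ∑' n : ℕ, Real.pi * ((n : ℝ) + 1) * ‖c (n + 1)‖ ^ 2 ≤
      Real.pi * ∑' n : ℕ, ((n : ℝ) + 1) * ‖c n‖ ^ 2 := by
    rw [← tsum_mul_left, (hc.mul_left Real.pi).tsum_eq_zero_add]
    refine (s2.tsum_le_tsum b2 hc1).trans (le_add_of_nonneg_left (by positivity))
  obtain ⟨v, hv, hvn, hvt⟩ := exists_orthogonal_limit (μ := discMeasure) (e := fun n z => z ^ n)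
    (fun n => memLp_disc_of_continuous (by fun_prop)) (w := fun n => Real.pi / (n + 1))
    (fun n => by positivity) integral_conj_pow_mul_pow s1
  obtain ⟨w, hw, hwn, hwt⟩ := exists_orthogonal_limit (μ := discMeasure)
    (e := fun n z => ((n : ℂ) + 1) * z ^ n)
    (fun n => memLp_disc_of_continuous (by fun_prop)) (w := fun n => Real.pi * (n + 1))
    (fun n => by positivity) (fun m n => by
      have : ∀ z : ℂ, conj (((m : ℂ) + 1) * z ^ m) * (((n : ℂ) + 1) * z ^ n) =
          (((m : ℂ) + 1) * (n + 1)) * (conj (z ^ m) * z ^ n) := fun z => by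
        rw [map_mul, map_add, map_one, Complex.conj_natCast]; ring
      simp_rw [this]
      rw [integral_const_mul, integral_conj_pow_mul_pow]
      split_ifs with h
      · subst h
        have := Nat.cast_add_one_ne_zero (R := ℂ) m
        push_cast
        field_simp
      · rw [mul_zero]) s2
  obtain ⟨t, ht, -, htt⟩ := exists_orthogonal_limit (μ := angleMeasure)
    (e := fun (n : ℕ) (β : ℝ) => dir β ^ n)
    (fun n => MemLp.of_bound (by have := continuous_dir; fun_prop) 1
      (ae_of_all _ fun β => by rw [norm_pow, norm_dir, one_pow])) (w := fun n => 2 * Real.pi)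
    (fun n => by positivity) (fun m n => by
      have : ∀ β : ℝ, conj (dir β ^ m) * dir β ^ n =
          Complex.exp (Complex.I * ((n : ℤ) - (m : ℤ) : ℤ) * β) := fun β => by
        rw [dir, map_pow, ← Complex.exp_conj, ← Complex.exp_nat_mul, ← Complex.exp_nat_mul,
          ← Complex.exp_add]
        congr 1
        simp only [map_mul, Complex.conj_I, Complex.conj_ofReal]
        push_cast; ring
      simp_rw [this]
      rw [integral_exp_angle]
      by_cases h : m = n
      · subst h; simp
      · rw [if_neg h, if_neg (by omega)]; simp) s3
  exact ⟨v, w, t, hv, hw, ht, hvn.trans (ENNReal.ofReal_le_ofReal t1),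
    hwn.trans (ENNReal.ofReal_le_ofReal t2), hvt, hwt, htt⟩

/-! ### Uniqueness of Fourier coefficients -/

theorem ae_eq_zero_of_fourierMode {w : ℝ → ℂ} (hw : MemLp w 2 angleMeasure)
    (h : ∀ n, fourierMode w n = 0) : w =ᵐ[angleMeasure] 0 := by
  have hab : -Real.pi < Real.pi := by linarith [Real.pi_pos]
  have hco : ∀ n, fourierCoeffOn hab w n = 0 := fun n => by
    have h1 := h n
    rw [fourierMode_eq_intervalIntegral] at h1
    have h2 := (mul_eq_zero.1 h1).resolve_left (by
      have : (Real.pi : ℂ) ≠ 0 := Complex.ofReal_ne_zero.2 Real.pi_ne_zero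
      simp [this])
    rw [fourierCoeffOn_eq_integral, smul_eq_zero]
    right
    rw [← h2]
    refine intervalIntegral.integral_congr fun θ _ => ?_
    simp only [fourier_coe_apply, smul_eq_mul]
    rw [mul_comm]
    congr 2
    have : (Real.pi : ℂ) ≠ 0 := Complex.ofReal_ne_zero.2 Real.pi_ne_zero
    push_cast
    field_simp
    ring
  have hp := hasSum_sq_fourierCoeffOn hab hw
  simp only [hco, norm_zero, ne_eq, OfNat.ofNat_ne_zero, not_false_eq_true, zero_pow] at hp
  have h0 := hp.unique hasSum_zero
  have h1 : ∫ θ, ‖w θ‖ ^ 2 ∂angleMeasure = 0 := by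
    rw [angleMeasure, ← intervalIntegral.integral_of_le hab.le]
    exact (smul_eq_zero.1 h0).resolve_left (inv_ne_zero (by linarith [Real.pi_pos]))
  rw [integral_eq_zero_iff_of_nonneg (fun _ => by positivity) hw.integrable_norm_pow'] at h1
  filter_upwards [h1] with θ hθ
  simpa using hθ

open scoped ComplexConjugate

/-! ### A lift of boundary data -/

/-- The divergence theorem holds for the products of the `C¹` approximations with test functions,
and every integral passes to the limit. -/
theorem IsTrace.of_tendsto {S : ℕ → ℂ → ℂ} (hS : ∀ N, ContDiff ℝ 1 (S N)) {v vx vy : ℂ → ℂ}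
    {d : ℝ → ℂ} (hv : MemLp v 2 discMeasure) (hvx : MemLp vx 2 discMeasure)
    (hvy : MemLp vy 2 discMeasure) (hd : MemLp d 2 angleMeasure)
    (t : Tendsto (fun N => eLpNorm (fun z => S N z - v z) 2 discMeasure) atTop (𝓝 0))
    (tx : Tendsto (fun N => eLpNorm (fun z => fderiv ℝ (S N) z 1 - vx z) 2 discMeasure) atTop (𝓝 0))
    (ty : Tendsto (fun N => eLpNorm (fun z => fderiv ℝ (S N) z Complex.I - vy z) 2 discMeasure) atTop
      (𝓝 0))
    (td : Tendsto (fun N => eLpNorm (fun β => S N (dir β) - d β) 2 angleMeasure) atTop (𝓝 0)) :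
    IsTrace v vx vy d := by
  have hdc := continuous_dir
  have hSc : ∀ N, Continuous (S N) := fun N => (hS N).continuous
  have hSd : ∀ (N : ℕ) (e : ℂ), Continuous fun z => fderiv ℝ (S N) z e := fun N e =>
    ((hS N).continuous_fderiv one_ne_zero).clm_apply continuous_const
  have main : ∀ (e : ℂ) (ve : ℂ → ℂ) (ν : ℝ → ℝ), MemLp ve 2 discMeasure → Continuous ν →
      (∀ ψ : ℂ → ℂ, ContDiff ℝ 1 ψ →
        ∫ z, fderiv ℝ ψ z e ∂discMeasure = ∫ β, ψ (dir β) * ν β ∂angleMeasure) →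
      Tendsto (fun N => eLpNorm (fun z => fderiv ℝ (S N) z e - ve z) 2 discMeasure) atTop (𝓝 0) →
      ∀ φ : ℂ → ℝ, ContDiff ℝ ∞ φ →
        ∫ z, (ve z * (φ z : ℂ) + v z * (fderiv ℝ φ z e : ℂ)) ∂discMeasure =
          ∫ β, d β * ((φ (Complex.exp (Complex.I * β)) * ν β : ℝ) : ℂ) ∂angleMeasure := by
    intro e ve ν hve hν hdiv te φ hφ
    have hφc := hφ.continuous
    have hdφ : Continuous fun z => fderiv ℝ φ z e :=
      (hφ.continuous_fderiv (by simp)).clm_apply continuous_const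
    have m1 : MemLp (fun z => (φ z : ℂ)) 2 discMeasure := memLp_disc_of_continuous (by fun_prop)
    have m2 : MemLp (fun z => (fderiv ℝ φ z e : ℂ)) 2 discMeasure :=
      memLp_disc_of_continuous (by fun_prop)
    have angleL {F : ℝ → ℂ} (hF : Continuous F) : MemLp F 2 angleMeasure := by
      obtain ⟨C, hC⟩ := (isCompact_Icc (a := -Real.pi) (b := Real.pi)).exists_bound_of_continuousOn
        hF.continuousOn
      refine MemLp.of_bound hF.aestronglyMeasurable C ?_
      rw [angleMeasure]
      filter_upwards [ae_restrict_mem measurableSet_Ioc] with β hβ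
      exact hC β (Ioc_subset_Icc_self hβ)
    have hψc : Continuous fun β : ℝ => ((φ (dir β) * ν β : ℝ) : ℂ) := by fun_prop
    have l1 := tendsto_integral_mul_of_tendsto_eLpNorm
      (fun N => memLp_disc_of_continuous (hSd N e)) hve m1 te
    have l2 := tendsto_integral_mul_of_tendsto_eLpNorm
      (fun N => memLp_disc_of_continuous (hSc N)) hv m2 t
    have l3 := tendsto_integral_mul_of_tendsto_eLpNorm
      (fun N => angleL ((hSc N).comp hdc)) hd (angleL hψc) td
    have i3 : Integrable (fun z => ve z * (φ z : ℂ)) discMeasure := hve.integrable_mul m1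
    have i4 : Integrable (fun z => v z * (fderiv ℝ φ z e : ℂ)) discMeasure := hv.integrable_mul m2
    rw [integral_add i3 i4]
    refine tendsto_nhds_unique ((l1.add l2).congr fun N => ?_) l3
    have i1 : Integrable (fun z => fderiv ℝ (S N) z e * (φ z : ℂ)) discMeasure :=
      (memLp_disc_of_continuous (hSd N e)).integrable_mul m1
    have i2 : Integrable (fun z => S N z * (fderiv ℝ φ z e : ℂ)) discMeasure :=
      (memLp_disc_of_continuous (hSc N)).integrable_mul m2
    have hφ1 : ContDiff ℝ 1 fun z => (φ z : ℂ) :=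
      Complex.ofRealCLM.contDiff.comp (hφ.of_le (by norm_cast))
    have h := hdiv (fun z => S N z * (φ z : ℂ)) ((hS N).mul hφ1)
    rw [← integral_add i1 i2]
    refine Eq.trans ?_ (h.trans ?_)
    · refine integral_congr_ae (ae_of_all _ fun z => ?_)
      have hfd : fderiv ℝ (fun z => (φ z : ℂ)) z e = (fderiv ℝ φ z e : ℂ) := by
        have := (Complex.ofRealCLM.hasFDerivAt.comp z
          ((hφ.differentiable (by simp)) z).hasFDerivAt).fderiv
        exact congrArg (fun L => L e) this
      beta_reduce
      rw [fderiv_fun_mul (((hS N).differentiable one_ne_zero) z)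
        ((hφ1.differentiable one_ne_zero) z), add_apply, smul_apply, smul_apply, hfd]
      simp only [smul_eq_mul]
      ring
    · refine integral_congr_ae (ae_of_all _ fun β => ?_)
      simp only [Function.comp_apply]
      push_cast
      ring
  exact ⟨hd, main 1 vx _ hvx Real.continuous_cos (fun ψ => integral_fderiv_one_disc) tx,
    main Complex.I vy _ hvy Real.continuous_sin (fun ψ => integral_fderiv_I_disc) ty⟩

theorem fourierMode_powerSum_dir (c : ℕ → ℂ) (N : ℕ) (m : ℤ) :
    fourierMode (fun β => powerSum c N (dir β)) m =
      ∑ n ∈ Finset.range N, if (n : ℤ) = m then c n else 0 := by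
  have hpi : (Real.pi : ℂ) ≠ 0 := Complex.ofReal_ne_zero.2 Real.pi_ne_zero
  have hint : ∀ n ∈ Finset.range N, Integrable (fun β : ℝ => c n *
      Complex.exp (Complex.I * ((n : ℤ) - m : ℤ) * β)) angleMeasure := fun n _ =>
    (Continuous.integrableOn_Ioc (by fun_prop))
  have e : ∀ β : ℝ, powerSum c N (dir β) * Complex.exp (-(Complex.I * m * β)) =
      ∑ n ∈ Finset.range N, c n * Complex.exp (Complex.I * ((n : ℤ) - m : ℤ) * β) := fun β => by
    rw [powerSum, Finset.sum_mul]
    refine Finset.sum_congr rfl fun n _ => ?_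
    rw [dir, ← Complex.exp_nat_mul, mul_assoc, ← Complex.exp_add]
    congr 2
    push_cast; ring
  rw [fourierMode]
  simp_rw [e]
  rw [integral_finsetSum _ hint, Finset.mul_sum]
  refine Finset.sum_congr rfl fun n _ => ?_
  rw [integral_const_mul, integral_exp_angle]
  by_cases h : (n : ℤ) = m
  · simp only [h, sub_self, if_true]; push_cast; field_simp
  · rw [if_neg h, if_neg (by omega)]; simp

theorem tendsto_fourierMode {F : ℕ → ℝ → ℂ} {w : ℝ → ℂ} (hF : ∀ N, MemLp (F N) 2 angleMeasure)
    (hw : MemLp w 2 angleMeasure)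
    (h : Tendsto (fun N => eLpNorm (fun β => F N β - w β) 2 angleMeasure) atTop (𝓝 0)) (m : ℤ) :
    Tendsto (fun N => fourierMode (F N) m) atTop (𝓝 (fourierMode w m)) := by
  have h2 := memLp_exp_angle (-m)
  refine (tendsto_integral_mul_of_tendsto_eLpNorm hF hw (h2.ae_eq (ae_of_all _ fun β => ?_)) h).const_mul
    _
  congr 1
  push_cast; ring

theorem contDiff_powerSum (c : ℕ → ℂ) (N : ℕ) : ContDiff ℝ 1 (powerSum c N) := by
  unfold powerSum
  exact ContDiff.sum fun n _ => contDiff_const.mul (contDiff_id.pow n)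

theorem continuous_powerSumDeriv (c : ℕ → ℂ) (N : ℕ) : Continuous (powerSumDeriv c N) := by
  unfold powerSumDeriv; fun_prop

theorem memLp_powerSum_dir (c : ℕ → ℂ) (N : ℕ) :
    MemLp (fun β => powerSum c N (dir β)) 2 angleMeasure := by
  have hdc := continuous_dir
  refine MemLp.of_bound ((contDiff_powerSum c N).continuous.comp hdc).aestronglyMeasurable
    (∑ n ∈ Finset.range N, ‖c n‖) (ae_of_all _ fun β => ?_)
  refine (norm_sum_le _ _).trans (Finset.sum_le_sum fun n _ => ?_)
  rw [norm_mul, norm_pow, norm_dir, one_pow, mul_one]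

theorem fourierMode_limit {c : ℕ → ℂ} {t : ℝ → ℂ} (ht : MemLp t 2 angleMeasure)
    (h : Tendsto (fun N => eLpNorm (fun β => powerSum c N (dir β) - t β) 2 angleMeasure) atTop (𝓝 0))
    (m : ℤ) : fourierMode t m = if 0 ≤ m then c m.toNat else 0 := by
  refine tendsto_nhds_unique (tendsto_fourierMode (memLp_powerSum_dir c) ht h m) ?_
  simp only [fourierMode_powerSum_dir]
  refine tendsto_const_nhds.congr' ?_
  filter_upwards [eventually_gt_atTop m.toNat] with N hN
  split_ifs with hm
  · rw [Finset.sum_eq_single m.toNat]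
    · rw [if_pos (Int.toNat_of_nonneg hm)]
    · intro n _ hn
      rw [if_neg (by omega)]
    · intro hn
      exact absurd (Finset.mem_range.2 hN) hn
  · refine (Finset.sum_eq_zero fun n _ => ?_).symm
    rw [if_neg (by omega)]

theorem fourierMode_conj (w : ℝ → ℂ) (n : ℤ) :
    fourierMode (fun θ => conj (w θ)) n = conj (fourierMode w (-n)) := by
  rw [fourierMode, fourierMode, map_mul, ← integral_conj]
  congr 1
  · simp [Complex.conj_ofNat]
  · refine integral_congr_ae (ae_of_all _ fun θ => ?_)
    simp [← Complex.exp_conj]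

theorem fderiv_add_conj {p q : ℂ → ℂ} {p' q' z : ℂ} (hp : HasDerivAt p p' z) (hq : HasDerivAt q q' z)
    (e : ℂ) : fderiv ℝ (fun z => p z + conj (q z)) z e = p' * e + conj (q' * e) := by
  have h1 : HasFDerivAt p (((ContinuousLinearMap.toSpanSingleton ℂ p' : ℂ →L[ℂ] ℂ)).restrictScalars ℝ) z :=
    hp.hasFDerivAt.restrictScalars ℝ
  have h2 : HasFDerivAt q (((ContinuousLinearMap.toSpanSingleton ℂ q' : ℂ →L[ℂ] ℂ)).restrictScalars ℝ) z :=
    hq.hasFDerivAt.restrictScalars ℝ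
  have h3 := h1.add ((Complex.conjCLE : ℂ →L[ℝ] ℂ).hasFDerivAt.comp z h2)
  have h4 : fderiv ℝ (fun z => p z + conj (q z)) z = _ := h3.fderiv
  rw [h4]
  simp [mul_comm]

theorem add_sq_le_of_sq_le {A B X : ℝ≥0∞} (hA : A ^ 2 ≤ X) (hB : B ^ 2 ≤ X) :
    (A + B) ^ 2 ≤ 4 * X := by
  wlog h : A ≤ B generalizing A B
  · rw [add_comm]; exact this hB hA (le_of_not_ge h)
  calc (A + B) ^ 2 ≤ (2 * B) ^ 2 := by rw [two_mul]; gcongr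
    _ = 4 * B ^ 2 := by rw [mul_pow]; norm_num
    _ ≤ 4 * X := by gcongr

/-- The map `σ` selects the modes of one sign. The constant is 8 = 4 · 2, from π ≤ 4 and n + 1 ≤
2√(1 + n²). -/
theorem summable_of_halfNormSq {d : ℝ → ℂ} (h : halfNormSq d < ⊤) {c : ℕ → ℂ} {σ : ℕ → ℤ}
    (hσ : Function.Injective σ) (hσ2 : ∀ n : ℕ, ((σ n : ℤ) : ℝ) ^ 2 = (n : ℝ) ^ 2)
    (hc : ∀ n, ‖c n‖ ≤ ‖fourierMode d (σ n)‖) :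
    (Summable fun n : ℕ => ((n : ℝ) + 1) * ‖c n‖ ^ 2) ∧
      ENNReal.ofReal (Real.pi * ∑' n : ℕ, ((n : ℝ) + 1) * ‖c n‖ ^ 2) ≤ 8 * halfNormSq d := by
  have hle : ∑' n : ℕ, ENNReal.ofReal (((n : ℝ) + 1) * ‖c n‖ ^ 2) ≤ 2 * halfNormSq d := by
    rw [halfNormSq, ← ENNReal.tsum_mul_left]
    refine le_trans (ENNReal.tsum_le_tsum fun n => ?_) (ENNReal.tsum_comp_le_tsum_of_injective hσ _)
    rw [hσ2, ← ofReal_norm, ← ENNReal.ofReal_pow (norm_nonneg _),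
      ← ENNReal.ofReal_mul (Real.sqrt_nonneg _), show (2 : ℝ≥0∞) = ENNReal.ofReal 2 by simp,
      ← ENNReal.ofReal_mul zero_le_two, ← mul_assoc]
    refine ENNReal.ofReal_le_ofReal ?_
    have h1 : (n : ℝ) + 1 ≤ 2 * √(1 + (n : ℝ) ^ 2) := by
      have hn := (n.cast_nonneg : (0 : ℝ) ≤ n)
      rw [← div_le_iff₀' two_pos]
      exact Real.le_sqrt_of_sq_le (by nlinarith [sq_nonneg ((n : ℝ) - 1)])
    have := hc n
    gcongr
  have hs : Summable fun n : ℕ => ((n : ℝ) + 1) * ‖c n‖ ^ 2 := by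
    have := ENNReal.summable_toReal (hle.trans_lt (ENNReal.mul_lt_top (by simp) h)).ne
    refine this.congr fun n => ENNReal.toReal_ofReal (by positivity)
  refine ⟨hs, ?_⟩
  rw [ENNReal.ofReal_mul Real.pi_pos.le, ENNReal.ofReal_tsum_of_nonneg (fun n => by positivity) hs]
  calc _ ≤ (4 : ℝ≥0∞) * (2 * halfNormSq d) := by
        gcongr
        rw [show (4 : ℝ≥0∞) = ENNReal.ofReal 4 by simp]
        exact ENNReal.ofReal_le_ofReal Real.pi_le_four
    _ = 8 * halfNormSq d := by rw [← mul_assoc]; norm_num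

theorem tendsto_eLpNorm_add_conj {X : Type*} [MeasurableSpace X] {μ : Measure X} {F G : ℕ → X → ℂ}
    {f g : X → ℂ} (hF : ∀ N, MemLp (F N) 2 μ) (hG : ∀ N, MemLp (G N) 2 μ) (hf : MemLp f 2 μ)
    (hg : MemLp g 2 μ) (tF : Tendsto (fun N => eLpNorm (fun x => F N x - f x) 2 μ) atTop (𝓝 0))
    (tG : Tendsto (fun N => eLpNorm (fun x => G N x - g x) 2 μ) atTop (𝓝 0)) {a b : ℂ}
    (ha : ‖a‖ = 1) (hb : ‖b‖ = 1) :
    Tendsto (fun N => eLpNorm (fun x => (F N x * a + conj (G N x * b)) - (f x * a + conj (g x * b)))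
      2 μ) atTop (𝓝 0) := by
  have hle : ∀ N, eLpNorm (fun x => (F N x * a + conj (G N x * b)) - (f x * a + conj (g x * b))) 2 μ ≤
      eLpNorm (fun x => F N x - f x) 2 μ + eLpNorm (fun x => G N x - g x) 2 μ := fun N => by
    have h1 : MemLp (fun x => (F N x - f x) * a) 2 μ := ((hF N).sub hf).mul_const a
    have h2 : MemLp (fun x => conj ((G N x - g x) * b)) 2 μ := (((hG N).sub hg).mul_const b).star
    have h3 := eLpNorm_add_le h1.1 h2.1 one_le_two
    refine le_trans (le_of_eq ?_) (h3.trans (le_of_eq ?_))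
    · congr 1; ext x; simp only [Pi.add_apply, map_mul, map_sub]; ring
    · congr 1
      · exact eLpNorm_congr_norm_ae (ae_of_all _ fun x => by rw [norm_mul, ha, mul_one])
      · exact eLpNorm_congr_norm_ae (ae_of_all _ fun x => by
          rw [RCLike.norm_conj, norm_mul, hb, mul_one])
  refine tendsto_of_tendsto_of_tendsto_of_le_of_le tendsto_const_nhds ?_ (fun _ => zero_le) hle
  simpa using tF.add tG

/-- The lift is the harmonic extension: a power series with the modes n ≥ 0, plus the conjugate of
one with the modes n < 0. Its partial sums provide smooth approximations, and the boundary limit is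
identified with `d` by its Fourier coefficients. Each half costs 8, adding two halves costs 4, and
there are three components: 3 · 4 · 8 = 96. -/
theorem exists_lift {d : ℝ → ℂ} (hd : MemLp d 2 angleMeasure) (h : halfNormSq d < ⊤) :
    ∃ (v vx vy : ℂ → ℂ) (S : ℕ → ℂ → ℂ), MemLp v 2 discMeasure ∧ MemLp vx 2 discMeasure ∧
      MemLp vy 2 discMeasure ∧ IsTrace v vx vy d ∧ h1NormSq v vx vy ≤ 96 * halfNormSq d ∧
      (∀ N, ContDiff ℝ 1 (S N)) ∧
      Tendsto (fun N => eLpNorm (fun z => S N z - v z) 2 discMeasure) atTop (𝓝 0) ∧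
      Tendsto (fun N => eLpNorm (fun z => fderiv ℝ (S N) z 1 - vx z) 2 discMeasure) atTop (𝓝 0) ∧
      Tendsto (fun N => eLpNorm (fun z => fderiv ℝ (S N) z Complex.I - vy z) 2 discMeasure) atTop
        (𝓝 0) := by
  let cp : ℕ → ℂ := fun n => fourierMode d n
  -- Mode 0 already belongs to the first half, so it is removed here.
  let cm : ℕ → ℂ := fun n => if n = 0 then 0 else conj (fourierMode d (-n))
  obtain ⟨sp, np⟩ := summable_of_halfNormSq h (c := cp) (σ := fun n => (n : ℤ)) Nat.cast_injective
    (fun n => by simp) fun n => le_rfl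
  obtain ⟨sm, nm⟩ := summable_of_halfNormSq h (c := cm) (σ := fun n => -(n : ℤ))
    (fun m n hmn => by simpa using hmn) (fun n => by simp) fun n => by
      simp only [cm]; split_ifs
      · simp
      · rw [RCLike.norm_conj]
  obtain ⟨vp, wp, tp, hvp, hwp, htp, nvp, nwp, cvp, cwp, ctp⟩ := exists_powerSum_limit sp
  obtain ⟨vm, wm, tm, hvm, hwm, htm, nvm, nwm, cvm, cwm, ctm⟩ := exists_powerSum_limit sm
  have hPc : ∀ (c : ℕ → ℂ) N, MemLp (powerSum c N) 2 discMeasure := fun c N =>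
    memLp_disc_of_continuous (contDiff_powerSum c N).continuous
  have hDc : ∀ (c : ℕ → ℂ) N, MemLp (powerSumDeriv c N) 2 discMeasure := fun c N =>
    memLp_disc_of_continuous (continuous_powerSumDeriv c N)
  have memL {p q : ℂ → ℂ} (hp : MemLp p 2 discMeasure) (hq : MemLp q 2 discMeasure) (e : ℂ) :
      MemLp (fun z => p z * e + conj (q z * e)) 2 discMeasure :=
    (hp.mul_const e).add (hq.mul_const e).star
  have nrm {p q : ℂ → ℂ} (hp : MemLp p 2 discMeasure) (hq : MemLp q 2 discMeasure)
      (np : eLpNorm p 2 discMeasure ^ 2 ≤ 8 * halfNormSq d)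
      (nq : eLpNorm q 2 discMeasure ^ 2 ≤ 8 * halfNormSq d) {e : ℂ} (he : ‖e‖ = 1) :
      eLpNorm (fun z => p z * e + conj (q z * e)) 2 discMeasure ^ 2 ≤ 32 * halfNormSq d := by
    have h1 := eLpNorm_add_le (hp.mul_const e).1 (hq.mul_const e).star.1 one_le_two
    have e1 : eLpNorm (fun z => p z * e) 2 discMeasure = eLpNorm p 2 discMeasure :=
      eLpNorm_congr_norm_ae (ae_of_all _ fun x => by rw [norm_mul, he, mul_one])
    have e2 : eLpNorm (star fun z => q z * e) 2 discMeasure = eLpNorm q 2 discMeasure :=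
      eLpNorm_congr_norm_ae (ae_of_all _ fun x => by
        rw [Pi.star_apply, norm_star, norm_mul, he, mul_one])
    rw [e1, e2] at h1
    calc _ ≤ (eLpNorm p 2 discMeasure + eLpNorm q 2 discMeasure) ^ 2 := by gcongr; exact h1
      _ ≤ 4 * (8 * halfNormSq d) := add_sq_le_of_sq_le np nq
      _ = 32 * halfNormSq d := by rw [← mul_assoc]; norm_num
  let S : ℕ → ℂ → ℂ := fun N z => powerSum cp (N + 1) z + conj (powerSum cm (N + 1) z)
  have hS : ∀ N, ContDiff ℝ 1 (S N) := fun N => (contDiff_powerSum cp _).add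
    ((Complex.conjCLE : ℂ →L[ℝ] ℂ).contDiff.comp (contDiff_powerSum cm _))
  have hSd : ∀ N z e, fderiv ℝ (S N) z e = powerSumDeriv cp N z * e + conj (powerSumDeriv cm N z * e) :=
    fun N z e => fderiv_add_conj (hasDerivAt_powerSum cp N z) (hasDerivAt_powerSum cm N z) e
  have n1 : ‖(1 : ℂ)‖ = 1 := norm_one
  have nI : ‖Complex.I‖ = 1 := Complex.norm_I
  have m0 := memL hvp hvm 1
  have mx := memL hwp hwm 1
  have my := memL hwp hwm Complex.I
  have T0 := tendsto_eLpNorm_add_conj (fun N => hPc cp (N + 1)) (fun N => hPc cm (N + 1)) hvp hvm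
    (cvp.comp (tendsto_add_atTop_nat 1)) (cvm.comp (tendsto_add_atTop_nat 1)) n1 n1
  have Tx := tendsto_eLpNorm_add_conj (fun N => hDc cp N) (fun N => hDc cm N) hwp hwm cwp cwm n1 n1
  have Ty := tendsto_eLpNorm_add_conj (fun N => hDc cp N) (fun N => hDc cm N) hwp hwm cwp cwm nI nI
  have Td := tendsto_eLpNorm_add_conj (fun N => memLp_powerSum_dir cp (N + 1))
    (fun N => memLp_powerSum_dir cm (N + 1)) htp htm
    (ctp.comp (tendsto_add_atTop_nat 1)) (ctm.comp (tendsto_add_atTop_nat 1)) n1 n1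
  have hdt : (fun β => d β - (tp β * 1 + conj (tm β * 1))) =ᵐ[angleMeasure] 0 := by
    have hc2 : MemLp (fun β => conj (tm β)) 2 angleMeasure := htm.star
    simp only [mul_one]
    refine ae_eq_zero_of_fourierMode (hd.sub (htp.add hc2)) fun n => ?_
    have i1 := hd.integrable one_le_two
    have i2 := htp.integrable one_le_two
    have i3 := hc2.integrable one_le_two
    have i4 : Integrable (fun β => tp β + conj (tm β)) angleMeasure := i2.add i3
    have := fourierMode_sub i1 i4 n
    have h2 := fourierMode_add i2 i3 n
    change fourierMode (fun β => d β - (tp β + conj (tm β))) n = 0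
    rw [this, h2, fourierMode_conj, fourierMode_limit htp ctp, fourierMode_limit htm ctm]
    rcases lt_trichotomy n 0 with hn | hn | hn
    · rw [if_neg (by omega), if_pos (by omega)]
      simp only [cm]
      rw [if_neg (by omega), Int.toNat_of_nonneg (by omega)]
      simp
    · subst hn; simp [cp, cm]
    · rw [if_pos (by omega), if_neg (by omega)]
      simp only [cp]
      rw [Int.toNat_of_nonneg (by omega)]
      simp
  refine ⟨_, _, _, S, m0, mx, my, IsTrace.of_tendsto hS m0 mx my hd ?_ ?_ ?_ ?_, ?_, hS, ?_, ?_, ?_⟩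
  · simpa only [mul_one] using T0
  · simpa only [hSd] using Tx
  · simpa only [hSd] using Ty
  · refine Td.congr fun N => eLpNorm_congr_ae ?_
    filter_upwards [hdt] with β hβ
    have : d β = tp β * 1 + conj (tm β * 1) := sub_eq_zero.1 hβ
    rw [this]
    simp only [S, mul_one]
  · rw [h1NormSq]
    calc _ ≤ 32 * halfNormSq d + 32 * halfNormSq d + 32 * halfNormSq d := add_le_add (add_le_add
          (nrm hvp hvm (nvp.trans np) (nvm.trans nm) n1) (nrm hwp hwm (nwp.trans np) (nwm.trans nm) n1))
          (nrm hwp hwm (nwp.trans np) (nwm.trans nm) nI)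
      _ = 96 * halfNormSq d := by rw [← add_mul, ← add_mul]; norm_num
  · simpa only [mul_one] using T0
  · simpa only [hSd] using Tx
  · simpa only [hSd] using Ty

/-! ### Convolution of sequences of functions -/

/-- `(act γ p)_j = ∑_k γ_k p_{j+k}`. -/
def act (γ p : ℕ → ℂ → ℂ) (j : ℕ) (z : ℂ) : ℂ := ∑' k, γ k z * p (j + k) z

/-- Sequences in `l²(ℕ; L²(Ω))`. -/
structure IsL2Seq (p : ℕ → ℂ → ℂ) : Prop where
  memLp : ∀ j, MemLp (p j) 2 discMeasure
  tsum_lt_top : ∑' j, nsq (p j) < ⊤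

/-- Continuous coefficients in `ℓ¹`, uniformly on the disc. -/
structure IsL1Coeff (γ : ℕ → ℂ → ℂ) (C : ℝ≥0∞) : Prop where
  continuous : ∀ k, Continuous (γ k)
  bound : ∀ z ∈ disc, ∑' k, ‖γ k z‖ₑ ≤ C
  lt_top : C < ⊤

theorem two_mul_mul_le_add_sq (x y : ℝ≥0∞) : 2 * (x * y) ≤ x ^ 2 + y ^ 2 := by
  wlog h : x ≤ y generalizing x y
  · rw [mul_comm x, add_comm]; exact this y x (le_of_not_ge h)
  obtain ⟨t, rfl⟩ := exists_add_of_le h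
  calc 2 * (x * (x + t)) ≤ 2 * (x * (x + t)) + t ^ 2 := le_self_add
    _ = x ^ 2 + (x + t) ^ 2 := by ring

/-- Cauchy–Schwarz with weights `a`. Expanding twice both sides as double sums reduces it to 2 b_k
b_l ≤ b_k² + b_l², so infinite values need no separate treatment. -/
theorem sq_tsum_mul_le (a b : ℕ → ℝ≥0∞) :
    (∑' k, a k * b k) ^ 2 ≤ (∑' k, a k) * ∑' k, a k * b k ^ 2 := by
  have h1 : 2 * (∑' k, a k * b k) ^ 2 = ∑' k, ∑' l, 2 * ((a k * b k) * (a l * b l)) := by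
    simp_rw [ENNReal.tsum_mul_left, ENNReal.tsum_mul_right]
    rw [sq]
  have h2 : 2 * ((∑' k, a k) * ∑' k, a k * b k ^ 2) =
      ∑' k, ∑' l, (a k * a l) * (b k ^ 2 + b l ^ 2) := by
    have e : ∀ k l, (a k * a l) * (b k ^ 2 + b l ^ 2) =
        (a k * b k ^ 2) * a l + a k * (a l * b l ^ 2) := fun k l => by ring
    simp_rw [e, ENNReal.tsum_add, ENNReal.tsum_mul_left, ENNReal.tsum_mul_right]
    ring
  have h3 : 2 * (∑' k, a k * b k) ^ 2 ≤ 2 * ((∑' k, a k) * ∑' k, a k * b k ^ 2) := by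
    rw [h1, h2]
    refine ENNReal.tsum_le_tsum fun k => ENNReal.tsum_le_tsum fun l => ?_
    calc 2 * ((a k * b k) * (a l * b l)) = (a k * a l) * (2 * (b k * b l)) := by ring
      _ ≤ _ := by gcongr; exact two_mul_mul_le_add_sq _ _
  exact (ENNReal.mul_le_mul_iff_right (by simp) (by simp)).1 h3

theorem enorm_tsum_le (f : ℕ → ℂ) : ‖∑' k, f k‖ₑ ≤ ∑' k, ‖f k‖ₑ := by
  by_cases h : ∑' k, ‖f k‖ₑ = ⊤
  · rw [h]; exact le_top
  · have hs : Summable fun k => ‖f k‖ := by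
      have := ENNReal.summable_toReal h
      exact this.congr fun k => toReal_enorm _
    rw [← ofReal_norm]
    refine (ENNReal.ofReal_le_ofReal (norm_tsum_le_tsum_norm hs)).trans (le_of_eq ?_)
    rw [ENNReal.ofReal_tsum_of_nonneg (fun _ => norm_nonneg _) hs]
    simp_rw [ofReal_norm]

section

variable {γ p : ℕ → ℂ → ℂ} {C : ℝ≥0∞}

theorem ae_disc {P : ℂ → Prop} (h : ∀ z ∈ disc, P z) : ∀ᵐ z ∂discMeasure, P z := by
  rw [discMeasure]
  filter_upwards [ae_restrict_mem measurableSet_disc] with z hz using h z hz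

theorem aemeasurable_enorm_sq {v : ℂ → ℂ} (h : MemLp v 2 discMeasure) :
    AEMeasurable (fun z => ‖v z‖ₑ ^ 2) discMeasure := h.1.enorm.pow_const 2

theorem lintegral_tsum_nsq {p : ℕ → ℂ → ℂ} (hp : ∀ j, MemLp (p j) 2 discMeasure) :
    ∫⁻ z, ∑' j, ‖p j z‖ₑ ^ 2 ∂discMeasure = ∑' j, nsq (p j) :=
  lintegral_tsum fun j => aemeasurable_enorm_sq (hp j)

theorem IsL2Seq.ae_lt_top (hp : IsL2Seq p) : ∀ᵐ z ∂discMeasure, ∑' j, ‖p j z‖ₑ ^ 2 < ⊤ := by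
  refine ae_lt_top' (AEMeasurable.tsum fun j => aemeasurable_enorm_sq (hp.memLp j)) ?_
  rw [lintegral_tsum_nsq hp.memLp]
  exact hp.tsum_lt_top.ne

theorem IsL2Seq.shift (hp : IsL2Seq p) (n : ℕ) : IsL2Seq fun j => p (n + j) :=
  ⟨fun _ => hp.memLp _, (ENNReal.tsum_comp_le_tsum_of_injective (add_right_injective n)
    fun j => nsq (p j)).trans_lt hp.tsum_lt_top⟩

theorem IsL1Coeff.tsum_mul_sq_le (hγ : IsL1Coeff γ C) {z : ℂ} (hz : z ∈ disc) (b : ℕ → ℝ≥0∞) :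
    (∑' k, ‖γ k z‖ₑ * b k) ^ 2 ≤ C * ∑' k, ‖γ k z‖ₑ * b k ^ 2 :=
  (sq_tsum_mul_le _ _).trans (by gcongr; exact hγ.bound z hz)

theorem IsL1Coeff.enorm_le (hγ : IsL1Coeff γ C) {z : ℂ} (hz : z ∈ disc) (k : ℕ) : ‖γ k z‖ₑ ≤ C :=
  (ENNReal.le_tsum k).trans (hγ.bound z hz)

theorem summable_act_of_lt_top (hγ : IsL1Coeff γ C) {z : ℂ} (hz : z ∈ disc)
    (h : ∑' j, ‖p j z‖ₑ ^ 2 < ⊤) (j : ℕ) : Summable fun k => γ k z * p (j + k) z := by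
  have h1 : (∑' k, ‖γ k z‖ₑ * ‖p (j + k) z‖ₑ) ^ 2 < ⊤ := by
    refine (hγ.tsum_mul_sq_le hz _).trans_lt (ENNReal.mul_lt_top hγ.lt_top ?_)
    calc _ ≤ ∑' k, C * ‖p (j + k) z‖ₑ ^ 2 :=
          ENNReal.tsum_le_tsum fun k => by gcongr; exact hγ.enorm_le hz k
      _ ≤ C * ∑' j, ‖p j z‖ₑ ^ 2 := by
          rw [ENNReal.tsum_mul_left]
          exact mul_le_mul_right (ENNReal.tsum_comp_le_tsum_of_injective (add_right_injective j)
            fun j => ‖p j z‖ₑ ^ 2) C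
      _ < ⊤ := ENNReal.mul_lt_top hγ.lt_top h
  have h2 : ∑' k, ‖γ k z * p (j + k) z‖ₑ ≠ ⊤ := by
    simp_rw [enorm_mul]
    intro h
    rw [h] at h1
    simp at h1
  refine Summable.of_norm ?_
  exact (ENNReal.summable_toReal h2).congr fun k => toReal_enorm _

theorem ae_summable_act (hγ : IsL1Coeff γ C) (hp : IsL2Seq p) :
    ∀ᵐ z ∂discMeasure, ∀ j, Summable fun k => γ k z * p (j + k) z := by
  filter_upwards [hp.ae_lt_top, ae_disc fun z hz => hz] with z h hz j
  exact summable_act_of_lt_top hγ hz h j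

theorem enorm_act_sq_le (hγ : IsL1Coeff γ C) {z : ℂ} (hz : z ∈ disc) (p : ℕ → ℂ → ℂ) (j : ℕ) :
    ‖act γ p j z‖ₑ ^ 2 ≤ C * ∑' k, ‖γ k z‖ₑ * ‖p (j + k) z‖ₑ ^ 2 := by
  refine le_trans ?_ (hγ.tsum_mul_sq_le hz _)
  gcongr
  refine (enorm_tsum_le _).trans (le_of_eq ?_)
  simp_rw [enorm_mul]

theorem nsq_act_le (hγ : IsL1Coeff γ C) (hp : ∀ j, MemLp (p j) 2 discMeasure) (j : ℕ) :
    nsq (act γ p j) ≤ C ^ 2 * ∑' k, nsq (p (j + k)) := by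
  rw [← lintegral_tsum_nsq fun k => hp (j + k), ← lintegral_const_mul' _ _ (by
    exact (ENNReal.pow_lt_top hγ.lt_top).ne), nsq]
  refine lintegral_mono_ae (ae_disc fun z hz => (enorm_act_sq_le hγ hz p j).trans ?_)
  rw [sq, mul_assoc]
  refine mul_le_mul_right ?_ C
  rw [← ENNReal.tsum_mul_left]
  exact ENNReal.tsum_le_tsum fun k => mul_le_mul_left (hγ.enorm_le hz k) _

theorem aestronglyMeasurable_act (hγ : IsL1Coeff γ C) (hp : IsL2Seq p) (j : ℕ) :
    AEStronglyMeasurable (act γ p j) discMeasure := by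
  refine aestronglyMeasurable_of_tendsto_ae atTop (f := fun N z => ∑ k ∈ Finset.range N,
    γ k z * p (j + k) z) (fun N => ?_) ?_
  · exact (memLp_finsetSum _ fun k _ => memLp_continuous_mul (hp.memLp (j + k)) (hγ.continuous k)).1
  · filter_upwards [ae_summable_act hγ hp] with z hz
    exact (hz j).hasSum.tendsto_sum_nat

theorem memLp_of_nsq_lt_top {v : ℂ → ℂ} (h : AEStronglyMeasurable v discMeasure) (hv : nsq v < ⊤) :
    MemLp v 2 discMeasure := by
  rw [nsq_eq_eLpNorm_sq] at hv
  refine ⟨h, lt_of_not_ge fun h' => ?_⟩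
  rw [top_le_iff.1 h'] at hv
  simp at hv

theorem IsL2Seq.memLp_act (hγ : IsL1Coeff γ C) (hp : IsL2Seq p) (j : ℕ) :
    MemLp (act γ p j) 2 discMeasure :=
  memLp_of_nsq_lt_top (aestronglyMeasurable_act hγ hp j) ((nsq_act_le hγ hp.memLp j).trans_lt
    (ENNReal.mul_lt_top (ENNReal.pow_lt_top hγ.lt_top) (hp.shift j).tsum_lt_top))

/-- Entry j of `act γ p` involves only the entries p_{j+k}, whose weights are at least as large.
Hence the Young inequality for ℓ¹ coefficients persists with any nondecreasing weight. -/
theorem tsum_weight_nsq_act_le (hγ : IsL1Coeff γ C) (hp : IsL2Seq p) {wt : ℕ → ℝ≥0∞}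
    (hwt : Monotone wt) : ∑' j, wt j * nsq (act γ p j) ≤ C ^ 2 * ∑' j, wt j * nsq (p j) := by
  have h1 : ∀ v : ℕ → ℂ → ℂ, (∀ j, MemLp (v j) 2 discMeasure) →
      ∑' j, wt j * nsq (v j) = ∫⁻ z, ∑' j, wt j * ‖v j z‖ₑ ^ 2 ∂discMeasure := fun v hv => by
    rw [lintegral_tsum fun j => (aemeasurable_enorm_sq (hv j)).const_mul _]
    refine tsum_congr fun j => ?_
    rw [lintegral_const_mul'' _ (aemeasurable_enorm_sq (hv j)), nsq]
  rw [h1 _ (hp.memLp_act hγ), h1 _ hp.memLp,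
    ← lintegral_const_mul' _ _ (ENNReal.pow_lt_top hγ.lt_top).ne]
  refine lintegral_mono_ae (ae_disc fun z hz => ?_)
  calc ∑' j, wt j * ‖act γ p j z‖ₑ ^ 2
      ≤ ∑' j, ∑' k, C * (‖γ k z‖ₑ * (wt (j + k) * ‖p (j + k) z‖ₑ ^ 2)) := by
        refine ENNReal.tsum_le_tsum fun j => ?_
        calc _ ≤ wt j * (C * ∑' k, ‖γ k z‖ₑ * ‖p (j + k) z‖ₑ ^ 2) := by
              gcongr; exact enorm_act_sq_le hγ hz p j
          _ = ∑' k, C * (‖γ k z‖ₑ * (wt j * ‖p (j + k) z‖ₑ ^ 2)) := by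
              rw [← ENNReal.tsum_mul_left, ← ENNReal.tsum_mul_left]
              exact tsum_congr fun k => by ring
          _ ≤ _ := by
              gcongr with k
              exact hwt (Nat.le_add_right j k)
    _ = C * ∑' k, ‖γ k z‖ₑ * ∑' j, wt (j + k) * ‖p (j + k) z‖ₑ ^ 2 := by
        rw [ENNReal.tsum_comm]
        simp_rw [ENNReal.tsum_mul_left]
    _ ≤ C * ∑' k, ‖γ k z‖ₑ * ∑' j, wt j * ‖p j z‖ₑ ^ 2 := by
        refine mul_le_mul_right (ENNReal.tsum_le_tsum fun k => mul_le_mul_right ?_ _) C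
        exact ENNReal.tsum_comp_le_tsum_of_injective (add_left_injective k)
          fun j => wt j * ‖p j z‖ₑ ^ 2
    _ ≤ C ^ 2 * ∑' j, wt j * ‖p j z‖ₑ ^ 2 := by
        rw [ENNReal.tsum_mul_right, ← mul_assoc, sq]
        gcongr
        exact hγ.bound z hz

theorem IsL2Seq.act (hγ : IsL1Coeff γ C) (hp : IsL2Seq p) : IsL2Seq (act γ p) :=
  ⟨hp.memLp_act hγ, by
    have := tsum_weight_nsq_act_le hγ hp (wt := fun _ => 1) monotone_const
    simp only [one_mul] at this
    exact this.trans_lt (ENNReal.mul_lt_top (ENNReal.pow_lt_top hγ.lt_top) hp.tsum_lt_top)⟩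

/-- The remainder after N terms is itself a convolution, with the coefficients γ_{k+N} acting on a
shifted sequence, so it is bounded by a tail of the convergent sum of squared norms. -/
theorem tendsto_partial_act (hγ : IsL1Coeff γ C) (hp : IsL2Seq p) (j : ℕ) :
    Tendsto (fun N => eLpNorm (fun z => ∑ k ∈ Finset.range N, γ k z * p (j + k) z - act γ p j z) 2
      discMeasure) atTop (𝓝 0) := by
  have hle : ∀ N, eLpNorm (fun z => ∑ k ∈ Finset.range N, γ k z * p (j + k) z - SourceRec.act γ p j z) 2
      discMeasure ^ 2 ≤ C ^ 2 * ∑' k, nsq (p (j + (k + N))) := fun N => by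
    have hγN : IsL1Coeff (fun k => γ (k + N)) C := ⟨fun k => hγ.continuous _, fun z hz =>
      (ENNReal.tsum_comp_le_tsum_of_injective (add_left_injective N) fun k => ‖γ k z‖ₑ).trans
        (hγ.bound z hz), hγ.lt_top⟩
    refine le_trans (le_of_eq ?_) ((nsq_act_le hγN (p := fun k => p (j + N + k))
      (fun k => hp.memLp _) 0).trans (le_of_eq ?_))
    · rw [← nsq_eq_eLpNorm_sq]
      unfold nsq
      refine lintegral_congr_ae ?_
      filter_upwards [ae_summable_act hγ hp] with z hz
      have h1 := (hz j).sum_add_tsum_nat_add N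
      have h2 : SourceRec.act (fun k => γ (k + N)) (fun k => p (j + N + k)) 0 z =
          ∑' k, γ (k + N) z * p (j + (k + N)) z := by
        unfold SourceRec.act
        refine tsum_congr fun k => ?_
        beta_reduce
        rw [show j + N + (0 + k) = j + (k + N) by ring]
      rw [h2, SourceRec.act, ← h1, sub_add_cancel_left, enorm_neg]
    · congr 1
      exact tsum_congr fun k => by rw [show j + N + (0 + k) = j + (k + N) by ring]
  have h0 : Tendsto (fun N => C ^ 2 * ∑' k, nsq (p (j + (k + N)))) atTop (𝓝 0) := by
    have := ENNReal.tendsto_sum_nat_add (fun k => nsq (p (j + k))) (hp.shift j).tsum_lt_top.ne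
    simpa using ENNReal.Tendsto.const_mul this (Or.inr (ENNReal.pow_lt_top hγ.lt_top).ne)
  have h1 := tendsto_of_tendsto_of_tendsto_of_le_of_le tendsto_const_nhds h0 (fun _ => zero_le) hle
  have h2 := ((ENNReal.continuous_rpow_const (y := (1 / 2 : ℝ))).tendsto 0).comp h1
  rw [ENNReal.zero_rpow_of_pos (by norm_num)] at h2
  refine h2.congr fun N => ?_
  rw [Function.comp_apply, ← ENNReal.rpow_natCast, ← ENNReal.rpow_mul]
  norm_num

end

/-! ### Conjugation by the integrating factor -/

/-- The partial derivative of a sequence of coefficients in the direction `e`. -/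
def dCoeff (α : ℕ → ℂ → ℂ) (e : ℂ) (k : ℕ) (z : ℂ) : ℂ := fderiv ℝ (α k) z e

/-- The derivative of `act α q`, if `qe` is that of `q`. -/
def actD (α : ℕ → ℂ → ℂ) (e : ℂ) (q qe : ℕ → ℂ → ℂ) (j : ℕ) (z : ℂ) : ℂ :=
  act α qe j z + act (dCoeff α e) q j z

section

variable {a : ℂ → ℝ} {α β : ℕ → ℂ → ℂ} {C : ℝ}

theorem isL1Coeff_of_sum_le {γ : ℕ → ℂ → ℂ} (hc : ∀ k, Continuous (γ k))
    (h : ∀ z ∈ disc, ∀ N, ∑ k ∈ Finset.range N, ‖γ k z‖ ≤ C) : IsL1Coeff γ (ENNReal.ofReal C) := by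
  refine ⟨hc, fun z hz => ?_, ENNReal.ofReal_lt_top⟩
  refine ENNReal.tsum_le_of_sum_range_le fun N => ?_
  simp_rw [← ofReal_norm]
  rw [← ENNReal.ofReal_sum_of_nonneg fun _ _ => norm_nonneg _]
  exact ENNReal.ofReal_le_ofReal (h z hz N)

theorem IsIntegratingPair.left (h : IsIntegratingPair a α β C) : IsL1Coeff α (ENNReal.ofReal C) :=
  isL1Coeff_of_sum_le (fun k => (h.contDiff_left k).continuous) fun z hz N =>
    (Finset.sum_le_sum fun n _ => by
      linarith [norm_nonneg (fderiv ℝ (α n) z 1), norm_nonneg (fderiv ℝ (α n) z Complex.I)]).trans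
      (h.bound_left z hz N)

theorem IsIntegratingPair.right (h : IsIntegratingPair a α β C) : IsL1Coeff β (ENNReal.ofReal C) :=
  isL1Coeff_of_sum_le (fun k => (h.contDiff_right k).continuous) fun z hz N =>
    (Finset.sum_le_sum fun n _ => by
      linarith [norm_nonneg (fderiv ℝ (β n) z 1), norm_nonneg (fderiv ℝ (β n) z Complex.I)]).trans
      (h.bound_right z hz N)

theorem IsIntegratingPair.left_dx (h : IsIntegratingPair a α β C) :
    IsL1Coeff (dCoeff α 1) (ENNReal.ofReal C) :=
  isL1Coeff_of_sum_le (fun k => ((h.contDiff_left k).continuous_fderiv one_ne_zero).clm_apply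
    continuous_const) fun z hz N => (Finset.sum_le_sum fun n _ => by
      simp only [dCoeff]
      linarith [norm_nonneg (α n z), norm_nonneg (fderiv ℝ (α n) z Complex.I)]).trans
      (h.bound_left z hz N)

theorem IsIntegratingPair.left_dy (h : IsIntegratingPair a α β C) :
    IsL1Coeff (dCoeff α Complex.I) (ENNReal.ofReal C) :=
  isL1Coeff_of_sum_le (fun k => ((h.contDiff_left k).continuous_fderiv one_ne_zero).clm_apply
    continuous_const) fun z hz N => (Finset.sum_le_sum fun n _ => by
      simp only [dCoeff]
      linarith [norm_nonneg (α n z), norm_nonneg (fderiv ℝ (α n) z 1)]).trans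
      (h.bound_left z hz N)

theorem IsL2Seq.actD {γ q qe : ℕ → ℂ → ℂ} {e : ℂ} {K : ℝ≥0∞} (hγ : IsL1Coeff γ K)
    (hγe : IsL1Coeff (dCoeff γ e) K) (hq : IsL2Seq q) (hqe : IsL2Seq qe) (j : ℕ) :
    MemLp (actD γ e q qe j) 2 discMeasure :=
  (hqe.memLp_act hγ j).add (hq.memLp_act hγe j)

theorem tendsto_partial_actD {γ q qe : ℕ → ℂ → ℂ} {e : ℂ} {K : ℝ≥0∞} (hγ : IsL1Coeff γ K)
    (hγe : IsL1Coeff (dCoeff γ e) K) (hq : IsL2Seq q) (hqe : IsL2Seq qe) (j : ℕ) :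
    Tendsto (fun N => eLpNorm (fun z => ∑ k ∈ Finset.range N,
      (γ k z * qe (j + k) z + fderiv ℝ (γ k) z e * q (j + k) z) - actD γ e q qe j z) 2
      discMeasure) atTop (𝓝 0) := by
  have h1 := tendsto_partial_act hγ hqe j
  have h2 := tendsto_partial_act hγe hq j
  have hle : ∀ N, eLpNorm (fun z => ∑ k ∈ Finset.range N,
      (γ k z * qe (j + k) z + fderiv ℝ (γ k) z e * q (j + k) z) - SourceRec.actD γ e q qe j z) 2
      discMeasure ≤ eLpNorm (fun z => ∑ k ∈ Finset.range N, γ k z * qe (j + k) z - act γ qe j z) 2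
      discMeasure + eLpNorm (fun z => ∑ k ∈ Finset.range N, dCoeff γ e k z * q (j + k) z -
        act (dCoeff γ e) q j z) 2 discMeasure := fun N => by
    have m1 : MemLp (fun z => ∑ k ∈ Finset.range N, γ k z * qe (j + k) z - act γ qe j z) 2
      discMeasure := (memLp_finsetSum _ fun k _ => memLp_continuous_mul (hqe.memLp (j + k))
        (hγ.continuous k)).sub (hqe.memLp_act hγ j)
    have m2 : MemLp (fun z => ∑ k ∈ Finset.range N, dCoeff γ e k z * q (j + k) z -
        act (dCoeff γ e) q j z) 2 discMeasure := (memLp_finsetSum _ fun k _ =>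
        memLp_continuous_mul (hq.memLp (j + k)) (hγe.continuous k)).sub (hq.memLp_act hγe j)
    refine le_trans (le_of_eq ?_) (eLpNorm_add_le m1.1 m2.1 one_le_two)
    congr 1
    ext z
    simp only [Pi.add_apply, Finset.sum_add_distrib, SourceRec.actD, dCoeff]
    ring
  refine tendsto_of_tendsto_of_tendsto_of_le_of_le tendsto_const_nhds ?_ (fun _ => zero_le) hle
  simpa using h1.add h2

theorem IsZeroTrace.act (h : IsIntegratingPair a α β C) {p px py : ℕ → ℂ → ℂ}
    (hz : ∀ j, IsZeroTrace (p j) (px j) (py j)) (hp : IsL2Seq p) (hpx : IsL2Seq px)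
    (hpy : IsL2Seq py) (j : ℕ) :
    IsZeroTrace (act α p j) (actD α 1 p px j) (actD α Complex.I p py j) :=
  IsZeroTrace.of_tendsto (fun N => IsZeroTrace.sum
      (fun k => (hz (j + k)).contDiff_mul (h.contDiff_left k)) N)
    (hp.memLp_act h.left j) (IsL2Seq.actD h.left h.left_dx hp hpx j)
    (IsL2Seq.actD h.left h.left_dy hp hpy j) (tendsto_partial_act h.left hp j)
    (tendsto_partial_actD h.left h.left_dx hp hpx j) (tendsto_partial_actD h.left h.left_dy hp hpy j)

/-- `v` is a limit in `H¹(Ω)` of continuously differentiable functions on the plane. -/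
def HasSmoothApprox (v vx vy : ℂ → ℂ) : Prop :=
  ∃ S : ℕ → ℂ → ℂ, (∀ N, ContDiff ℝ 1 (S N)) ∧
    Tendsto (fun N => eLpNorm (fun z => S N z - v z) 2 discMeasure) atTop (𝓝 0) ∧
    Tendsto (fun N => eLpNorm (fun z => fderiv ℝ (S N) z 1 - vx z) 2 discMeasure) atTop (𝓝 0) ∧
    Tendsto (fun N => eLpNorm (fun z => fderiv ℝ (S N) z Complex.I - vy z) 2 discMeasure) atTop (𝓝 0)

theorem tendsto_eLpNorm_continuous_mul {φ : ℂ → ℂ} (hφ : Continuous φ) {F : ℕ → ℂ → ℂ}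
    (h : Tendsto (fun N => eLpNorm (F N) 2 discMeasure) atTop (𝓝 0)) :
    Tendsto (fun N => eLpNorm (fun z => φ z * F N z) 2 discMeasure) atTop (𝓝 0) := by
  obtain ⟨K, hK⟩ := (isCompact_closedBall (0 : ℂ) 1).exists_bound_of_continuousOn hφ.continuousOn
  have hle : ∀ N, eLpNorm (fun z => φ z * F N z) 2 discMeasure ≤
      ENNReal.ofReal K * eLpNorm (F N) 2 discMeasure := fun N =>
    eLpNorm_le_mul_eLpNorm_of_ae_le_mul (ae_disc fun z hz => by
      rw [norm_mul]
      exact mul_le_mul_of_nonneg_right (hK z (Metric.ball_subset_closedBall hz)) (norm_nonneg _)) 2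
  refine tendsto_of_tendsto_of_tendsto_of_le_of_le tendsto_const_nhds ?_ (fun _ => zero_le) hle
  simpa using ENNReal.Tendsto.const_mul h (Or.inr ENNReal.ofReal_ne_top)

/-- The cross identity is known for `C¹` functions and survives limits of gradients. For this reason
the lift is kept together with an approximating sequence. -/
theorem HasSmoothApprox.crossIdentity_mul {v vx vy φ : ℂ → ℂ} (h : HasSmoothApprox v vx vy)
    (hv : MemLp v 2 discMeasure) (hvx : MemLp vx 2 discMeasure) (hvy : MemLp vy 2 discMeasure)
    (hφ : ContDiff ℝ 1 φ) : CrossIdentity (fun z => φ z * vx z + fderiv ℝ φ z 1 * v z)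
      (fun z => φ z * vy z + fderiv ℝ φ z Complex.I * v z) := by
  obtain ⟨S, hS, t, tx, ty⟩ := h
  have hd : ∀ (N : ℕ) (z e : ℂ), fderiv ℝ (fun z => φ z * S N z) z e =
      φ z * fderiv ℝ (S N) z e + fderiv ℝ φ z e * S N z := fun N z e => by
    rw [fderiv_fun_mul ((hφ.differentiable one_ne_zero) z) (((hS N).differentiable one_ne_zero) z),
      add_apply, smul_apply, smul_apply, smul_eq_mul, smul_eq_mul]
    ring
  have hφe : ∀ e, Continuous fun z => fderiv ℝ φ z e := fun e =>
    (hφ.continuous_fderiv one_ne_zero).clm_apply continuous_const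
  have hSe : ∀ N e, Continuous fun z => fderiv ℝ (S N) z e := fun N e =>
    ((hS N).continuous_fderiv one_ne_zero).clm_apply continuous_const
  have memS : ∀ N e, MemLp (fun z => fderiv ℝ (fun z => φ z * S N z) z e) 2 discMeasure :=
    fun N e => memLp_disc_of_continuous
      (((hφ.mul (hS N)).continuous_fderiv one_ne_zero).clm_apply continuous_const)
  have T : ∀ (e : ℂ) (ve : ℂ → ℂ), MemLp ve 2 discMeasure →
      Tendsto (fun N => eLpNorm (fun z => fderiv ℝ (S N) z e - ve z) 2 discMeasure) atTop (𝓝 0) →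
      Tendsto (fun N => eLpNorm (fun z => fderiv ℝ (fun z => φ z * S N z) z e -
        (φ z * ve z + fderiv ℝ φ z e * v z)) 2 discMeasure) atTop (𝓝 0) := by
    intro e ve hve te
    have h1 := tendsto_eLpNorm_continuous_mul hφ.continuous te
    have h2 := tendsto_eLpNorm_continuous_mul (hφe e) t
    have h3 := h1.add h2
    rw [add_zero] at h3
    refine tendsto_of_tendsto_of_tendsto_of_le_of_le tendsto_const_nhds h3 (fun _ => zero_le)
      fun N => ?_
    have m1 : MemLp (fun z => φ z * (fderiv ℝ (S N) z e - ve z)) 2 discMeasure :=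
      memLp_continuous_mul ((memLp_disc_of_continuous (hSe N e)).sub hve) hφ.continuous
    have m2 : MemLp (fun z => fderiv ℝ φ z e * (S N z - v z)) 2 discMeasure :=
      memLp_continuous_mul ((memLp_disc_of_continuous (hS N).continuous).sub hv) (hφe e)
    refine le_trans (le_of_eq ?_) (eLpNorm_add_le m1.1 m2.1 one_le_two)
    congr 1
    ext z
    rw [hd, Pi.add_apply]
    ring
  exact CrossIdentity.of_tendsto (fun N => crossIdentity_of_contDiff (hφ.mul (hS N)))
    (fun N => memS N 1) (fun N => memS N Complex.I)
    ((memLp_continuous_mul hvx hφ.continuous).add (memLp_continuous_mul hv (hφe 1)))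
    ((memLp_continuous_mul hvy hφ.continuous).add (memLp_continuous_mul hv (hφe Complex.I)))
    (T 1 vx hvx tx) (T Complex.I vy hvy ty)

theorem crossIdentity_act (h : IsIntegratingPair a α β C) {p px py : ℕ → ℂ → ℂ}
    (hs : ∀ j, HasSmoothApprox (p j) (px j) (py j)) (hp : IsL2Seq p) (hpx : IsL2Seq px)
    (hpy : IsL2Seq py) (j : ℕ) : CrossIdentity (actD α 1 p px j) (actD α Complex.I p py j) := by
  have hx : ∀ k, MemLp (fun z => α k z * px (j + k) z + fderiv ℝ (α k) z 1 * p (j + k) z) 2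
      discMeasure := fun k => (memLp_continuous_mul (hpx.memLp _) (h.left.continuous k)).add
    (memLp_continuous_mul (hp.memLp _) (h.left_dx.continuous k))
  have hy : ∀ k, MemLp (fun z => α k z * py (j + k) z + fderiv ℝ (α k) z Complex.I * p (j + k) z) 2
      discMeasure := fun k => (memLp_continuous_mul (hpy.memLp _) (h.left.continuous k)).add
    (memLp_continuous_mul (hp.memLp _) (h.left_dy.continuous k))
  exact CrossIdentity.of_tendsto (fun N => CrossIdentity.sum (fun k =>
      (hs (j + k)).crossIdentity_mul (hp.memLp _) (hpx.memLp _) (hpy.memLp _) (h.contDiff_left k))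
      hx hy N)
    (fun N => memLp_finsetSum _ fun k _ => hx k) (fun N => memLp_finsetSum _ fun k _ => hy k)
    (IsL2Seq.actD h.left h.left_dx hp hpx j) (IsL2Seq.actD h.left h.left_dy hp hpy j)
    (tendsto_partial_actD h.left h.left_dx hp hpx j) (tendsto_partial_actD h.left h.left_dy hp hpy j)

end

/-! ### Pointwise identities for convolutions -/

/-- The double sum converges absolutely and is rearranged along k + l = n, where the coefficient of
q_{j+n} is the n-th entry of the Cauchy product of `b` and `a`: 1 for n = 0 and 0 otherwise. -/
theorem tsum_tsum_mul_of_inverse {b a q : ℕ → ℂ} (hb : Summable fun k => ‖b k‖)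
    (ha : Summable fun k => ‖a k‖) {K : ℝ} (hq : ∀ m, ‖q m‖ ≤ K) (h0 : b 0 * a 0 = 1)
    (h1 : ∀ n, ∑ k ∈ Finset.range (n + 2), b k * a (n + 1 - k) = 0) (j : ℕ) :
    ∑' k, b k * ∑' l, a l * q (j + k + l) = q j := by
  let F : ℕ × ℕ → ℂ := fun x => b x.1 * (a x.2 * q (j + x.1 + x.2))
  have hF : Summable F := by
    refine Summable.of_norm_bounded ((hb.mul_of_nonneg ha (fun _ => norm_nonneg _)
      fun _ => norm_nonneg _).mul_right K) fun x => ?_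
    rw [norm_mul, norm_mul, ← mul_assoc]
    gcongr
    exact hq _
  have h2 : ∀ k, b k * ∑' l, a l * q (j + k + l) = ∑' l, F (k, l) := fun k => by
    rw [← tsum_mul_left]
  have hF2 : Summable (F ∘ Finset.HasAntidiagonal.sigmaAntidiagonalEquivProd) :=
    (Equiv.summable_iff _).2 hF
  have h3 : ∑' k, b k * ∑' l, a l * q (j + k + l) = ∑' n, ∑' x : ↥(Finset.HasAntidiagonal.antidiagonal (n : ℕ)), F x.1 := by
    simp_rw [h2]
    rw [← hF.tsum_prod, ← Finset.HasAntidiagonal.sigmaAntidiagonalEquivProd.tsum_eq F]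
    exact hF2.tsum_sigma
  have h4 : ∀ n, ∑' x : ↥(Finset.HasAntidiagonal.antidiagonal (n : ℕ)), F x.1 = if n = 0 then q j else 0 := fun n => by
    rw [Finset.tsum_subtype ((Finset.HasAntidiagonal.antidiagonal n)) F]
    have : ∑ x ∈ (Finset.HasAntidiagonal.antidiagonal n), F x =
        (∑ k ∈ Finset.range (n + 1), b k * a (n - k)) * q (j + n) := by
      rw [Finset.sum_mul, ← Finset.Nat.sum_antidiagonal_eq_sum_range_succ
        (fun k l => b k * a l * q (j + n))]
      refine Finset.sum_congr rfl fun x hx => ?_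
      rw [← Finset.HasAntidiagonal.mem_antidiagonal.1 hx, mul_assoc, ← add_assoc]
    rw [this]
    cases n with
    | zero => simp [h0]
    | succ n => rw [h1, zero_mul, if_neg (Nat.succ_ne_zero n)]
  rw [h3]
  simp_rw [h4]
  exact tsum_ite_eq 0 (fun _ => q j)

/-- Besides the convolved equation, Leibniz produces the terms in which the coefficients are
differentiated. There Q_{j+k+2} has the factor ∂̄A_{k+2} + ∂A_k = cA_{k+1}, which is exactly its
factor in the convolved zero-order term. So the attenuation drops out. -/
theorem tsum_conjugated_equation {A Ax Ay Q Qx Qy G : ℕ → ℂ} {c : ℂ}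
    (hA : ∀ j, Summable fun k => A k * Q (j + k)) (hAx : ∀ j, Summable fun k => A k * Qx (j + k))
    (hAy : ∀ j, Summable fun k => A k * Qy (j + k)) (hx : ∀ j, Summable fun k => Ax k * Q (j + k))
    (hy : ∀ j, Summable fun k => Ay k * Q (j + k))
    (hQ : ∀ j, delBar (Qx j) (Qy j) + del (Qx (j + 2)) (Qy (j + 2)) + c * Q (j + 1) = G j)
    (h0 : delBar (Ax 0) (Ay 0) = 0) (h1 : delBar (Ax 1) (Ay 1) = c * A 0)
    (h2 : ∀ n, delBar (Ax (n + 2)) (Ay (n + 2)) + del (Ax n) (Ay n) = c * A (n + 1)) (j : ℕ) :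
    delBar (∑' k, A k * Qx (j + k) + ∑' k, Ax k * Q (j + k))
        (∑' k, A k * Qy (j + k) + ∑' k, Ay k * Q (j + k)) +
      del (∑' k, A k * Qx (j + 2 + k) + ∑' k, Ax k * Q (j + 2 + k))
        (∑' k, A k * Qy (j + 2 + k) + ∑' k, Ay k * Q (j + 2 + k)) = ∑' k, A k * G (j + k) := by
  have comb {u v : ℕ → ℂ} (hu : Summable u) (hv : Summable v) (t : ℂ) :
      HasSum (fun k => (u k + t * v k) / 2) ((∑' k, u k + t * ∑' k, v k) / 2) :=
    (hu.hasSum.add (hv.hasSum.mul_left t)).div_const 2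
  have s1 := comb (hAx j) (hAy j) Complex.I
  have s2 := comb (hx j) (hy j) Complex.I
  have s3 := comb (hAx (j + 2)) (hAy (j + 2)) (-Complex.I)
  have s4 := comb (hx (j + 2)) (hy (j + 2)) (-Complex.I)
  have s5 := (hA (j + 1)).hasSum.mul_left c
  -- The two derivative sums run with an offset of two indices; `h0` and `h1` account for the two
  -- initial terms left over.
  have e2 : ∑' k, (Ax k * Q (j + k) + Complex.I * (Ay k * Q (j + k))) / 2 =
      c * ∑' k, A k * Q (j + 1 + k) -
        ∑' k, (Ax k * Q (j + 2 + k) + -Complex.I * (Ay k * Q (j + 2 + k))) / 2 := by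
    rw [← s2.summable.sum_add_tsum_nat_add 2, ← s5.tsum_eq, ← s5.summable.sum_add_tsum_nat_add 1]
    have s6 := (summable_nat_add_iff 1).2 s5.summable
    rw [add_sub_assoc, ← s6.tsum_sub s4.summable]
    simp only [Finset.sum_range_succ, Finset.sum_range_zero, zero_add, add_zero]
    have e3 : ∀ k, (Ax (k + 2) * Q (j + (k + 2)) + Complex.I * (Ay (k + 2) * Q (j + (k + 2)))) / 2 =
        c * (A (k + 1) * Q (j + 1 + (k + 1))) -
          (Ax k * Q (j + 2 + k) + -Complex.I * (Ay k * Q (j + 2 + k))) / 2 := fun k => by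
      have := h2 k
      rw [delBar, del] at this
      rw [show j + 1 + (k + 1) = j + (k + 2) by ring, show j + 2 + k = j + (k + 2) by ring]
      linear_combination Q (j + (k + 2)) * this
    rw [tsum_congr e3]
    rw [delBar] at h0 h1
    linear_combination Q j * h0 + Q (j + 1) * h1
  have key : HasSum (fun k => A k * G (j + k)) ((∑' k, A k * Qx (j + k) +
      Complex.I * ∑' k, A k * Qy (j + k)) / 2 + (∑' k, A k * Qx (j + 2 + k) +
      -Complex.I * ∑' k, A k * Qy (j + 2 + k)) / 2 + c * ∑' k, A k * Q (j + 1 + k)) := by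
    have e : (fun k => A k * G (j + k)) = fun k =>
        (A k * Qx (j + k) + Complex.I * (A k * Qy (j + k))) / 2 + (A k * Qx (j + 2 + k) +
        -Complex.I * (A k * Qy (j + 2 + k))) / 2 + c * (A k * Q (j + 1 + k)) := by
      ext k
      rw [← hQ (j + k), delBar, del, show j + 2 + k = j + k + 2 by ring,
        show j + 1 + k = j + k + 1 by ring]
      ring
    rw [e]
    exact (s1.add s3).add s5
  rw [key.tsum_eq]
  rw [s2.tsum_eq, s4.tsum_eq] at e2
  rw [delBar, del]
  linear_combination e2

/-! ### Estimates for sequences of extended nonnegative numbers -/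

theorem sq_add_le (x y : ℝ≥0∞) : (x + y) ^ 2 ≤ 2 * x ^ 2 + 2 * y ^ 2 := by
  calc (x + y) ^ 2 = x ^ 2 + 2 * (x * y) + y ^ 2 := by ring
    _ ≤ x ^ 2 + (x ^ 2 + y ^ 2) + y ^ 2 := by gcongr; exact two_mul_mul_le_add_sq x y
    _ = 2 * x ^ 2 + 2 * y ^ 2 := by ring

theorem tsum_add_le (b : ℕ → ℝ≥0∞) (j i : ℕ) : ∑' m, b (j + i + m) ≤ ∑' m, b (j + m) := by
  simp_rw [add_assoc]
  exact ENNReal.tsum_comp_le_tsum_of_injective (add_right_injective i) fun m => b (j + m)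

theorem add_tsum_add_two_le (b : ℕ → ℝ≥0∞) (j : ℕ) :
    ∑' m, b (j + 2 + m) + b j ≤ ∑' m, b (j + m) := by
  have h := tsum_eq_zero_add' (f := fun m => b (j + m)) ENNReal.summable
  rw [h, add_zero, add_comm]
  gcongr ?_ + ?_
  · exact le_rfl
  · rw [show (∑' m, b (j + (m + 1))) = ∑' m, b (j + 1 + m) from
      tsum_congr fun m => by rw [add_comm m, add_assoc]]
    exact tsum_add_le b (j + 1) 1

theorem le_of_sq_le_sq {x y : ℝ≥0∞} (h : x ^ 2 ≤ y ^ 2) : x ≤ y :=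
  (ENNReal.pow_le_pow_left_iff two_ne_zero).1 h

/-- A two-step recursion, solved backwards from infinity. -/
theorem le_add_tsum_of_sq_le {x f b : ℕ → ℝ≥0∞} (h : ∀ j, x j ^ 2 ≤ (x (j + 2) + f j) ^ 2 + b j)
    (hx : Tendsto x atTop (𝓝 0)) (j : ℕ) :
    x j ^ 2 ≤ 2 * (∑' m, b (j + m)) + 2 * (∑' m, f (j + m)) ^ 2 := by
  let r : ℕ → ℝ≥0∞ := fun j => (∑' m, b (j + m)) ^ (1 / 2 : ℝ)
  have hr : ∀ j, r j ^ 2 = ∑' m, b (j + m) := fun j => by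
    rw [← ENNReal.rpow_natCast, ← ENNReal.rpow_mul]; norm_num
  -- Up to ε the bound r_j + Σ f is stable under a backward step: r_{j+2}² + b_j ≤ r_j² takes in
  -- b_j, and f_j is added linearly. The induction starts where x_j ≤ ε and goes down two indices at
  -- a time.
  have main : ∀ ε : ℝ≥0∞, 0 < ε → x j ≤ r j + ∑' m, f (j + m) + ε := fun ε hε => by
    obtain ⟨N, hN⟩ := eventually_atTop.1 (hx.eventually (ge_mem_nhds hε))
    have claim : ∀ i j, N ≤ j + 2 * i → x j ≤ r j + ∑' m, f (j + m) + ε := by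
      intro i
      induction i with
      | zero => exact fun j hj => (hN j (by omega)).trans le_add_self
      | succ i ih =>
        intro j hj
        have h1 := ih (j + 2) (by omega)
        refine le_of_sq_le_sq ((h j).trans ?_)
        have h2 := add_tsum_add_two_le f j
        have h3 : r (j + 2) ^ 2 + b j ≤ r j ^ 2 := by rw [hr, hr]; exact add_tsum_add_two_le b j
        have h4 : r (j + 2) ≤ r j := le_of_sq_le_sq (le_self_add.trans h3)
        have h5 : x (j + 2) + f j ≤ r (j + 2) + (∑' m, f (j + m) + ε) := by
          calc x (j + 2) + f j ≤ r (j + 2) + ∑' m, f (j + 2 + m) + ε + f j := by gcongr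
            _ = r (j + 2) + ((∑' m, f (j + 2 + m) + f j) + ε) := by ring
            _ ≤ _ := by gcongr
        rw [add_assoc (r j)]
        generalize (∑' m, f (j + m) + ε) = T at h5
        calc (x (j + 2) + f j) ^ 2 + b j ≤ (r (j + 2) + T) ^ 2 + b j := by gcongr
          _ = (r (j + 2) ^ 2 + b j) + (2 * r (j + 2) * T + T ^ 2) := by ring
          _ ≤ r j ^ 2 + (2 * r j * T + T ^ 2) := by gcongr
          _ = (r j + T) ^ 2 := by ring
    exact claim N j (by omega)
  have h1 : x j ≤ r j + ∑' m, f (j + m) := le_of_forall_pos_le_add main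
  calc x j ^ 2 ≤ (r j + ∑' m, f (j + m)) ^ 2 := by gcongr
    _ ≤ _ := by rw [← hr]; exact sq_add_le _ _

/-- Each b_n is counted once for every j ≤ n. -/
theorem tsum_tsum_add_le (b : ℕ → ℝ≥0∞) :
    ∑' j, ∑' m, b (j + m) ≤ ∑' n : ℕ, ((n : ℝ≥0∞) + 1) * b n := by
  have h1 : ∀ j, ∑' m, b (j + m) ≤ ∑' n, if j ≤ n then b n else 0 := fun j => by
    have := ENNReal.tsum_comp_le_tsum_of_injective (add_right_injective j)
      fun n => if j ≤ n then b n else 0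
    simpa using this
  refine (ENNReal.tsum_le_tsum h1).trans ?_
  rw [ENNReal.tsum_comm]
  refine ENNReal.tsum_le_tsum fun n => ?_
  rw [tsum_eq_sum (s := Finset.range (n + 1)) fun j hj => by
    rw [if_neg]; simpa [Nat.lt_succ_iff] using hj]
  refine (Finset.sum_le_card_nsmul _ _ (b n) fun j _ => by split_ifs <;> simp).trans ?_
  simp

/-- Finitely many backward steps lose only a constant. -/
theorem exists_descent_bound {A : ℝ≥0∞} (hA : A < ⊤) (J : ℕ) : ∃ D : ℝ≥0∞, D < ⊤ ∧
    ∀ (d : ℕ → ℝ≥0∞) (X : ℝ≥0∞), (∀ j, J ≤ j → d j ≤ X) →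
      (∀ j < J, d j ≤ A * (d (j + 1) + d (j + 2) + X)) → ∀ j, d j ≤ D * X := by
  induction J with
  | zero => exact ⟨1, ENNReal.one_lt_top, fun d X h _ j => by rw [one_mul]; exact h j (zero_le)⟩
  | succ J ih =>
    obtain ⟨D, hD, h⟩ := ih
    -- The recursion at index J gives d_J ≤ 3A X, so the induction hypothesis applies with X
    -- enlarged by the factor 1 + 3A.
    refine ⟨D * (1 + A * 3), ENNReal.mul_lt_top hD (ENNReal.add_lt_top.2
      ⟨ENNReal.one_lt_top, ENNReal.mul_lt_top hA (by norm_num)⟩), fun d X h1 h2 j => ?_⟩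
    have hX : X ≤ (1 + A * 3) * X := by
      calc X = 1 * X := (one_mul X).symm
        _ ≤ _ := by gcongr; exact le_self_add
    rw [mul_assoc]
    refine h d ((1 + A * 3) * X) (fun i hi => ?_) (fun i hi => (h2 i (by omega)).trans ?_) j
    · rcases hi.eq_or_lt with rfl | hi
      · refine (h2 J (Nat.lt_succ_self J)).trans ?_
        calc A * (d (J + 1) + d (J + 2) + X) ≤ A * (X + X + X) := by
              gcongr
              · exact h1 _ le_rfl
              · exact h1 _ (by omega)
          _ = A * 3 * X := by ring
          _ ≤ _ := by gcongr; exact le_add_self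
      · exact (h1 i hi).trans hX
    · gcongr

theorem tendsto_zero_of_tsum_lt_top {x : ℕ → ℝ≥0∞} (h : ∑' j, x j ^ 2 < ⊤) :
    Tendsto x atTop (𝓝 0) := by
  have h1 := ENNReal.tendsto_atTop_zero_of_tsum_ne_top h.ne
  have h2 := (ENNReal.continuous_rpow_const (y := (1 / 2 : ℝ))).continuousAt.tendsto.comp h1
  have e : x = (fun a : ℝ≥0∞ => a ^ (1 / 2 : ℝ)) ∘ fun j => x j ^ 2 := by
    ext j
    rw [Function.comp_apply, ← ENNReal.rpow_natCast, ← ENNReal.rpow_mul]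
    norm_num
  rw [e]
  simpa using h2

theorem tendsto_tsum_indicator {x : ℕ → ℝ≥0∞} (h : ∑' j, x j < ⊤) :
    Tendsto (fun M => ∑' j, if M < j then x j else 0) atTop (𝓝 0) := by
  have h1 := ENNReal.tendsto_sum_nat_add x h.ne
  refine tendsto_of_tendsto_of_tendsto_of_le_of_le tendsto_const_nhds h1 (fun _ => zero_le)
    fun M => ?_
  have e := ENNReal.summable.sum_add_tsum_nat_add' (f := fun j => if M < j then x j else 0) (k := M)
  rw [← e, Finset.sum_eq_zero fun j hj => by rw [if_neg (not_lt.2 (Finset.mem_range.1 hj).le)],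
    zero_add]
  exact ENNReal.tsum_le_tsum fun j => by split_ifs <;> simp

/-- For 1/2 < t < s the power (j+m+2)^{-(1+s)} is at most (j+1)^{-t}(m+1)^{-(1+s-t)}. The second
factor is summable because t < s, the first is square summable because t > 1/2. -/
theorem tsum_sq_tail_lt_top {s : ℝ} (hs : 1 / 2 < s) (c : ℝ) :
    ∑' j : ℕ, (∑' m : ℕ, ENNReal.ofReal (c * (((j + m : ℕ) : ℝ) + 2) ^ (-(1 + s)))) ^ 2 < ⊤ := by
  wlog hc : 0 ≤ c generalizing c
  · refine lt_of_le_of_lt (ENNReal.tsum_le_tsum fun j => ?_) (this (-c) (by linarith))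
    gcongr ?_ ^ 2
    refine ENNReal.tsum_le_tsum fun m => ENNReal.ofReal_le_ofReal ?_
    gcongr
    linarith
  obtain ⟨t, ht1, ht2⟩ := exists_between hs
  have sum : ∀ p : ℝ, 1 < p → Summable fun n : ℕ => ((n : ℝ) + 1) ^ (-p) := fun p hp => by
    have := (summable_nat_add_iff 1).2 (Real.summable_nat_rpow.2 (show -p < -1 by linarith))
    simpa using this
  have hle : ∀ j m : ℕ, ENNReal.ofReal (c * (((j + m : ℕ) : ℝ) + 2) ^ (-(1 + s))) ≤
      ENNReal.ofReal (c * ((j : ℝ) + 1) ^ (-t)) *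
        ENNReal.ofReal (((m : ℝ) + 1) ^ (-(1 + s - t))) := fun j m => by
    rw [← ENNReal.ofReal_mul (by positivity)]
    refine ENNReal.ofReal_le_ofReal ?_
    rw [show -(1 + s) = -t + -(1 + s - t) by ring, Real.rpow_add (by positivity), mul_assoc]
    push_cast
    gcongr c * (?_ * ?_)
    · exact Real.rpow_le_rpow_of_nonpos (by positivity) (by linarith [(Nat.cast_nonneg m : (0:ℝ) ≤ m)])
        (by linarith)
    · exact Real.rpow_le_rpow_of_nonpos (by positivity) (by linarith [(Nat.cast_nonneg j : (0:ℝ) ≤ j)])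
        (by linarith)
  set Z : ℝ≥0∞ := ∑' m : ℕ, ENNReal.ofReal (((m : ℝ) + 1) ^ (-(1 + s - t)))
  have hZ : Z < ⊤ := (sum _ (by linarith)).tsum_ofReal_lt_top
  have h2 : ∀ j : ℕ, (∑' m : ℕ, ENNReal.ofReal (c * (((j + m : ℕ) : ℝ) + 2) ^ (-(1 + s)))) ^ 2 ≤
      Z ^ 2 * ENNReal.ofReal (c ^ 2 * ((j : ℝ) + 1) ^ (-(2 * t))) := fun j => by
    have h3 := ENNReal.tsum_le_tsum (hle j)
    rw [ENNReal.tsum_mul_left] at h3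
    refine (pow_le_pow_left' h3 2).trans (le_of_eq ?_)
    rw [mul_pow, mul_comm, ← ENNReal.ofReal_pow (by positivity), mul_pow,
      ← Real.rpow_natCast (((j : ℝ) + 1) ^ (-t)), ← Real.rpow_mul (by positivity)]
    congr 4
    push_cast; ring
  refine (ENNReal.tsum_le_tsum h2).trans_lt ?_
  rw [ENNReal.tsum_mul_left]
  exact ENNReal.mul_lt_top (ENNReal.pow_lt_top hZ)
    ((sum _ (by linarith)).mul_left _).tsum_ofReal_lt_top

/-! ### Elementary estimates for `nsq` -/

theorem nsq_const_mul_le {v w : ℂ → ℂ} {c : ℝ≥0∞} (hc : c < ⊤)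
    (h : ∀ᵐ z ∂discMeasure, ‖v z‖ₑ ≤ c * ‖w z‖ₑ) : nsq v ≤ c ^ 2 * nsq w := by
  rw [nsq, nsq, ← lintegral_const_mul' _ _ (ENNReal.pow_lt_top hc).ne]
  refine lintegral_mono_ae (h.mono fun z hz => ?_)
  rw [← mul_pow]
  gcongr

theorem nsq_add_le_of_memLp {v w : ℂ → ℂ} (hv : MemLp v 2 discMeasure) :
    nsq (fun z => v z + w z) ≤ 2 * nsq v + 2 * nsq w := by
  have h2 : (2 : ℝ≥0∞) ≠ ⊤ := by norm_num
  rw [nsq, nsq, nsq, ← lintegral_const_mul' _ _ h2, ← lintegral_const_mul' _ _ h2,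
    ← lintegral_add_left' ((aemeasurable_enorm_sq hv).const_mul _)]
  refine lintegral_mono fun z => ?_
  refine le_trans ?_ (sq_add_le _ _)
  gcongr
  exact enorm_add_le _ _

theorem nsq_neg (v : ℂ → ℂ) : nsq (fun z => -v z) = nsq v := by simp [nsq]

theorem nsq_sub_le_of_memLp {v w : ℂ → ℂ} (hv : MemLp v 2 discMeasure) :
    nsq (fun z => v z - w z) ≤ 2 * nsq v + 2 * nsq w := by
  have := nsq_add_le_of_memLp (w := fun z => -w z) hv
  rw [nsq_neg] at this
  simpa only [sub_eq_add_neg] using this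

theorem nsq_del_le {v w : ℂ → ℂ} (hv : MemLp v 2 discMeasure) :
    nsq (fun z => del (v z) (w z)) ≤ nsq v + nsq w := by
  have hI : nsq (fun z => Complex.I * w z) = nsq w := by
    have : ‖Complex.I‖ₑ = 1 := by rw [← ofReal_norm, Complex.norm_I, ENNReal.ofReal_one]
    simp [nsq, enorm_mul, this]
  have h1 := nsq_sub_le_of_memLp (w := fun z => Complex.I * w z) hv
  have h2 : nsq (fun z => del (v z) (w z)) ≤ (2⁻¹) ^ 2 * nsq (fun z => v z - Complex.I * w z) :=
    nsq_const_mul_le (by simp) (ae_of_all _ fun z => by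
      rw [del, div_eq_inv_mul, enorm_mul, enorm_inv two_ne_zero]
      simp [enorm_eq_nnnorm])
  refine h2.trans ?_
  rw [hI] at h1
  calc (2⁻¹ : ℝ≥0∞) ^ 2 * nsq (fun z => v z - Complex.I * w z)
      ≤ 2⁻¹ * (2⁻¹ * (2 * nsq v + 2 * nsq w)) := by rw [sq, mul_assoc]; gcongr
    _ = 2⁻¹ * (nsq v + nsq w) := by
        rw [← mul_add, ← mul_assoc (2⁻¹) 2, ENNReal.inv_mul_cancel (by norm_num) (by norm_num),
          one_mul]
    _ ≤ 1 * (nsq v + nsq w) := by gcongr; exact ENNReal.inv_le_one.2 (by norm_num)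
    _ = _ := one_mul _

/-! ### The estimate for the tail of the error -/

section

variable {γ p q : ℕ → ℂ → ℂ} {K : ℝ≥0∞}

theorem IsL2Seq.sub (hp : IsL2Seq p) (hq : IsL2Seq q) : IsL2Seq fun j z => p j z - q j z := by
  refine ⟨fun j => (hp.memLp j).sub (hq.memLp j), ?_⟩
  refine (ENNReal.tsum_le_tsum fun j => nsq_sub_le_of_memLp (hp.memLp j)).trans_lt ?_
  rw [ENNReal.tsum_add, ENNReal.tsum_mul_left, ENNReal.tsum_mul_left]
  exact ENNReal.add_lt_top.2 ⟨ENNReal.mul_lt_top (by norm_num) hp.tsum_lt_top,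
    ENNReal.mul_lt_top (by norm_num) hq.tsum_lt_top⟩

theorem ae_act_sub_add (hγ : IsL1Coeff γ K) (hp : IsL2Seq p) (hq : IsL2Seq q) :
    ∀ᵐ z ∂discMeasure, ∀ j, act γ (fun j z => p j z - q j z) j z + act γ q j z = act γ p j z := by
  filter_upwards [ae_summable_act hγ (hp.sub hq), ae_summable_act hγ hq] with z h1 h2 j
  rw [act, act, act, ← (h1 j).tsum_add (h2 j)]
  exact tsum_congr fun k => by ring

theorem IsL1Coeff.summable_norm (hγ : IsL1Coeff γ K) {z : ℂ} (hz : z ∈ disc) :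
    Summable fun k => ‖γ k z‖ := by
  have h := ((hγ.bound z hz).trans_lt hγ.lt_top).ne
  exact (ENNReal.summable_toReal h).congr fun k => toReal_enorm _

variable {a : ℂ → ℝ} {α β : ℕ → ℂ → ℂ} {C : ℝ}

theorem IsIntegratingPair.ae_act_act (h : IsIntegratingPair a α β C) (hp : IsL2Seq p) :
    ∀ᵐ z ∂discMeasure, ∀ j, act β (act α p) j z = p j z := by
  filter_upwards [hp.ae_lt_top, ae_disc fun z hz => hz] with z h1 hz j
  refine tsum_tsum_mul_of_inverse (q := fun j => p j z) (h.right.summable_norm hz) (h.left.summable_norm hz)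
    (K := √(∑' j, ‖p j z‖ₑ ^ 2).toReal) (fun m => ?_) (h.mul_zero z) (h.mul_succ z) j
  refine Real.le_sqrt_of_sq_le ?_
  have := ENNReal.toReal_mono h1.ne (ENNReal.le_tsum (f := fun j => ‖p j z‖ₑ ^ 2) m)
  simpa [ENNReal.toReal_pow] using this

theorem IsIntegratingPair.tsum_nsq_le (h : IsIntegratingPair a α β C) (hp : IsL2Seq p) :
    ∑' j, nsq (p j) ≤ ENNReal.ofReal C ^ 2 * ∑' j, nsq (act α p j) := by
  have h1 := tsum_weight_nsq_act_le h.right (hp.act h.left) (wt := fun _ => 1) monotone_const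
  simp only [one_mul] at h1
  refine le_trans (le_of_eq (tsum_congr fun j => nsq_congr ?_)) h1
  exact (h.ae_act_act hp).mono fun z hz => (hz j).symm

theorem tsum_nsq_act_le (hγ : IsL1Coeff γ K) (hp : IsL2Seq p) :
    ∑' j, nsq (act γ p j) ≤ K ^ 2 * ∑' j, nsq (p j) := by
  have := tsum_weight_nsq_act_le hγ hp (wt := fun _ => 1) monotone_const
  simpa only [one_mul] using this

end

/-- The error `q` of a reconstruction solves an equation with right-hand side `G`, which is small in
terms of `q` itself and of `ν`, and its boundary values are those of `E`. -/
structure IsErrorSystem (a : ℂ → ℝ) (κ ν : ℕ → ℝ≥0∞) (q qx qy E Ex Ey G : ℕ → ℂ → ℂ) : Prop where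
  l2 : IsL2Seq q
  l2_dx : IsL2Seq qx
  l2_dy : IsL2Seq qy
  lift_l2 : IsL2Seq E
  lift_l2_dx : IsL2Seq Ex
  lift_l2_dy : IsL2Seq Ey
  approx : ∀ j, HasSmoothApprox (E j) (Ex j) (Ey j)
  zeroTrace : ∀ j, IsZeroTrace (fun z => q j z - E j z) (fun z => qx j z - Ex j z)
    (fun z => qy j z - Ey j z)
  memLp_rhs : ∀ j, MemLp (G j) 2 discMeasure
  equation : ∀ᵐ z ∂discMeasure, ∀ j, delBar (qx j z) (qy j z) + del (qx (j + 2) z) (qy (j + 2) z) +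
    a z * q (j + 1) z = G j z
  nsq_rhs_le : ∀ j, nsq (G j) ≤ κ j ^ 2 * (nsq (q (j + 1)) + ν (j + 1))
  antitone : Antitone κ

namespace IsErrorSystem

variable {a : ℂ → ℝ} {κ ν : ℕ → ℝ≥0∞} {q qx qy E Ex Ey G α β : ℕ → ℂ → ℂ} {C : ℝ}

theorem shift (h : IsErrorSystem a κ ν q qx qy E Ex Ey G) (J : ℕ) :
    IsErrorSystem a (fun j => κ (J + j)) (fun j => ν (J + j)) (fun j => q (J + j))
      (fun j => qx (J + j)) (fun j => qy (J + j)) (fun j => E (J + j)) (fun j => Ex (J + j))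
      (fun j => Ey (J + j)) (fun j => G (J + j)) :=
  ⟨h.l2.shift J, h.l2_dx.shift J, h.l2_dy.shift J, h.lift_l2.shift J, h.lift_l2_dx.shift J,
    h.lift_l2_dy.shift J, fun _ => h.approx _, fun _ => h.zeroTrace _, fun _ => h.memLp_rhs _,
    h.equation.mono fun _ hz _ => hz _, fun _ => h.nsq_rhs_le _,
    fun _ _ hij => h.antitone (by omega)⟩

theorem ae_conjugated (h : IsErrorSystem a κ ν q qx qy E Ex Ey G) (hI : IsIntegratingPair a α β C) :
    ∀ᵐ z ∂discMeasure, ∀ j, delBar (actD α 1 q qx j z) (actD α Complex.I q qy j z) +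
      del (actD α 1 q qx (j + 2) z) (actD α Complex.I q qy (j + 2) z) = act α G j z := by
  filter_upwards [h.equation, ae_summable_act hI.left h.l2, ae_summable_act hI.left h.l2_dx,
    ae_summable_act hI.left h.l2_dy, ae_summable_act hI.left_dx h.l2,
    ae_summable_act hI.left_dy h.l2, ae_disc fun z hz => hz] with z e s sx sy tx ty hz j
  exact tsum_conjugated_equation (A := fun k => α k z) (Ax := fun k => dCoeff α 1 k z)
    (Ay := fun k => dCoeff α Complex.I k z) (Q := fun k => q k z) (Qx := fun k => qx k z)
    (Qy := fun k => qy k z) (G := fun k => G k z) (c := a z) s sx sy tx ty e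
    (hI.delBar_zero z hz) (hI.delBar_one z hz) (hI.delBar_add_two z hz) j

/-- As κ is nonincreasing, κ_j dominates all the factors that the convolution at j meets. What
remains is a total sum independent of j. -/
theorem nsq_act_rhs_le (h : IsErrorSystem a κ ν q qx qy E Ex Ey G)
    (hI : IsIntegratingPair a α β C) (j : ℕ) :
    nsq (act α G j) ≤ κ j ^ 2 * (ENNReal.ofReal C ^ 2 * (∑' j, nsq (q j) + ∑' j, ν j)) := by
  refine (nsq_act_le hI.left h.memLp_rhs j).trans ?_
  rw [mul_left_comm]
  gcongr
  calc ∑' k, nsq (G (j + k)) ≤ ∑' k, κ j ^ 2 * (nsq (q (j + k + 1)) + ν (j + k + 1)) :=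
        ENNReal.tsum_le_tsum fun k => (h.nsq_rhs_le _).trans (by
          gcongr; exact h.antitone (Nat.le_add_right j k))
    _ = κ j ^ 2 * (∑' k, nsq (q (j + k + 1)) + ∑' k, ν (j + k + 1)) := by
        rw [ENNReal.tsum_mul_left, ENNReal.tsum_add]
    _ ≤ κ j ^ 2 * (∑' j, nsq (q j) + ∑' j, ν j) := by
        have hinj : Function.Injective fun k => j + k + 1 := fun x y hxy => by
          simpa using hxy
        exact mul_le_mul_right (add_le_add
          (ENNReal.tsum_comp_le_tsum_of_injective hinj fun j => nsq (q j))
          (ENNReal.tsum_comp_le_tsum_of_injective hinj ν)) _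

/-- The energy inequality for the conjugated error. -/
theorem nsq_del_act_le (h : IsErrorSystem a κ ν q qx qy E Ex Ey G)
    (hI : IsIntegratingPair a α β C) (j : ℕ) :
    nsq (fun z => del (actD α 1 q qx j z) (actD α Complex.I q qy j z)) ≤
      nsq (fun z => delBar (actD α 1 q qx j z) (actD α Complex.I q qy j z)) +
        nsq (fun z => del (actD α 1 E Ex j z) (actD α Complex.I E Ey j z)) := by
  have hz := IsZeroTrace.act hI h.zeroTrace (h.l2.sub h.lift_l2) (h.l2_dx.sub h.lift_l2_dx)
    (h.l2_dy.sub h.lift_l2_dy) j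
  have key := hz.nsq_del_add_le (IsL2Seq.actD hI.left hI.left_dx h.lift_l2 h.lift_l2_dx j)
    (IsL2Seq.actD hI.left hI.left_dy h.lift_l2 h.lift_l2_dy j)
    (crossIdentity_act hI h.approx h.lift_l2 h.lift_l2_dx h.lift_l2_dy j)
  have ex : ∀ᵐ z ∂discMeasure, actD α 1 (fun j z => q j z - E j z) (fun j z => qx j z - Ex j z) j z +
      actD α 1 E Ex j z = actD α 1 q qx j z := by
    filter_upwards [ae_act_sub_add hI.left h.l2_dx h.lift_l2_dx,
      ae_act_sub_add hI.left_dx h.l2 h.lift_l2] with z h1 h2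
    rw [actD, actD, actD, ← h1, ← h2]; ring
  have ey : ∀ᵐ z ∂discMeasure, actD α Complex.I (fun j z => q j z - E j z)
      (fun j z => qy j z - Ey j z) j z + actD α Complex.I E Ey j z = actD α Complex.I q qy j z := by
    filter_upwards [ae_act_sub_add hI.left h.l2_dy h.lift_l2_dy,
      ae_act_sub_add hI.left_dy h.l2 h.lift_l2] with z h1 h2
    rw [actD, actD, actD, ← h1, ← h2]; ring
  refine le_trans (le_of_eq (nsq_congr ?_)) (key.trans (add_le_add (le_of_eq (nsq_congr ?_)) le_rfl))
  · filter_upwards [ex, ey] with z h1 h2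
    rw [h1, h2]
  · filter_upwards [ex, ey] with z h1 h2
    rw [h1, h2]

/-- Poincaré needs zero trace, so the lift is split off first and added back afterwards. The factor
is 64 = 2 · 16 · 2: two splittings and the square of the Poincaré constant 4. -/
theorem nsq_act_le_nsq_del (h : IsErrorSystem a κ ν q qx qy E Ex Ey G)
    (hI : IsIntegratingPair a α β C) (j : ℕ) :
    nsq (act α q j) ≤ 64 * nsq (fun z => del (actD α 1 q qx j z) (actD α Complex.I q qy j z)) +
      64 * nsq (fun z => del (actD α 1 E Ex j z) (actD α Complex.I E Ey j z)) +
        2 * nsq (act α E j) := by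
  have hz := IsZeroTrace.act hI h.zeroTrace (h.l2.sub h.lift_l2) (h.l2_dx.sub h.lift_l2_dx)
    (h.l2_dy.sub h.lift_l2_dy) j
  have h1 : nsq (act α (fun j z => q j z - E j z) j) ≤ 16 * nsq (fun z =>
      del (actD α 1 (fun j z => q j z - E j z) (fun j z => qx j z - Ex j z) j z)
        (actD α Complex.I (fun j z => q j z - E j z) (fun j z => qy j z - Ey j z) j z)) := by
    rw [nsq_eq_eLpNorm_sq, nsq_eq_eLpNorm_sq]
    refine (pow_le_pow_left' hz.eLpNorm_le 2).trans (le_of_eq ?_)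
    rw [mul_pow]; norm_num
  have h2 : nsq (act α q j) ≤ 2 * nsq (act α (fun j z => q j z - E j z) j) + 2 * nsq (act α E j) := by
    refine le_trans (le_of_eq (nsq_congr ?_)) (nsq_add_le_of_memLp hz.memLp)
    filter_upwards [ae_act_sub_add hI.left h.l2 h.lift_l2] with z h1 using (h1 j).symm
  have h3 : nsq (fun z =>
      del (actD α 1 (fun j z => q j z - E j z) (fun j z => qx j z - Ex j z) j z)
        (actD α Complex.I (fun j z => q j z - E j z) (fun j z => qy j z - Ey j z) j z)) ≤
      2 * nsq (fun z => del (actD α 1 q qx j z) (actD α Complex.I q qy j z)) +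
      2 * nsq (fun z => del (actD α 1 E Ex j z) (actD α Complex.I E Ey j z)) := by
    refine le_trans (le_of_eq (nsq_congr ?_)) (nsq_sub_le_of_memLp (memLp_del
      (IsL2Seq.actD hI.left hI.left_dx h.l2 h.l2_dx j)
      (IsL2Seq.actD hI.left hI.left_dy h.l2 h.l2_dy j)))
    filter_upwards [ae_act_sub_add hI.left h.l2_dx h.lift_l2_dx,
      ae_act_sub_add hI.left_dx h.l2 h.lift_l2, ae_act_sub_add hI.left h.l2_dy h.lift_l2_dy,
      ae_act_sub_add hI.left_dy h.l2 h.lift_l2] with z h1 h2 h3 h4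
    simp only [actD, del, ← h1 j, ← h2 j, ← h3 j, ← h4 j]
    ring
  calc nsq (act α q j) ≤ 2 * (16 * (2 * nsq (fun z => del (actD α 1 q qx j z)
        (actD α Complex.I q qy j z)) + 2 * nsq (fun z => del (actD α 1 E Ex j z)
        (actD α Complex.I E Ey j z)))) + 2 * nsq (act α E j) := by
          refine h2.trans ?_
          gcongr
          exact h1.trans (by gcongr)
    _ = _ := by ring

/-- The weight n + 1 is nondecreasing, hence survives convolution with the integrating factor and
with its derivatives. -/
theorem tsum_nsq_del_lift_le (h : IsErrorSystem a κ ν q qx qy E Ex Ey G)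
    (hI : IsIntegratingPair a α β C) :
    ∑' n : ℕ, ((n : ℝ≥0∞) + 1) * nsq (fun z => del (actD α 1 E Ex n z) (actD α Complex.I E Ey n z)) ≤
      4 * (ENNReal.ofReal C ^ 2 * ∑' n : ℕ, ((n : ℝ≥0∞) + 1) * h1NormSq (E n) (Ex n) (Ey n)) := by
  have hwt : Monotone fun n : ℕ => (n : ℝ≥0∞) + 1 := fun m n hmn => by
    have : (m : ℝ≥0∞) ≤ n := by exact_mod_cast hmn
    beta_reduce
    gcongr
  have h1 : ∀ n : ℕ, ((n : ℝ≥0∞) + 1) *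
      nsq (fun z => del (actD α 1 E Ex n z) (actD α Complex.I E Ey n z)) ≤
      2 * (((n : ℝ≥0∞) + 1) * nsq (act α Ex n)) + 2 * (((n : ℝ≥0∞) + 1) * nsq (act (dCoeff α 1) E n)) +
      (2 * (((n : ℝ≥0∞) + 1) * nsq (act α Ey n)) +
        2 * (((n : ℝ≥0∞) + 1) * nsq (act (dCoeff α Complex.I) E n))) := fun n => by
    have hx := nsq_add_le_of_memLp (w := act (dCoeff α 1) E n) (h.lift_l2_dx.memLp_act hI.left n)
    have hy := nsq_add_le_of_memLp (w := act (dCoeff α Complex.I) E n)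
      (h.lift_l2_dy.memLp_act hI.left n)
    have hd := nsq_del_le (w := actD α Complex.I E Ey n)
      (IsL2Seq.actD hI.left hI.left_dx h.lift_l2 h.lift_l2_dx n)
    calc _ ≤ ((n : ℝ≥0∞) + 1) * ((2 * nsq (act α Ex n) + 2 * nsq (act (dCoeff α 1) E n)) +
          (2 * nsq (act α Ey n) + 2 * nsq (act (dCoeff α Complex.I) E n))) :=
          mul_le_mul_right (hd.trans (add_le_add hx hy)) _
      _ = _ := by ring
  refine (ENNReal.tsum_le_tsum h1).trans ?_
  simp only [ENNReal.tsum_add, ENNReal.tsum_mul_left]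
  have b1 := tsum_weight_nsq_act_le hI.left h.lift_l2_dx hwt
  have b2 := tsum_weight_nsq_act_le hI.left_dx h.lift_l2 hwt
  have b3 := tsum_weight_nsq_act_le hI.left h.lift_l2_dy hwt
  have b4 := tsum_weight_nsq_act_le hI.left_dy h.lift_l2 hwt
  have e : ∑' n : ℕ, ((n : ℝ≥0∞) + 1) * h1NormSq (E n) (Ex n) (Ey n) =
      ∑' n : ℕ, ((n : ℝ≥0∞) + 1) * nsq (E n) + ∑' n : ℕ, ((n : ℝ≥0∞) + 1) * nsq (Ex n) +
        ∑' n : ℕ, ((n : ℝ≥0∞) + 1) * nsq (Ey n) := by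
    simp only [h1NormSq, ← nsq_eq_eLpNorm_sq, mul_add, ENNReal.tsum_add]
  rw [e]
  generalize (∑' n : ℕ, ((n : ℝ≥0∞) + 1) * nsq (E n)) = e0 at *
  generalize (∑' n : ℕ, ((n : ℝ≥0∞) + 1) * nsq (Ex n)) = e1 at *
  generalize (∑' n : ℕ, ((n : ℝ≥0∞) + 1) * nsq (Ey n)) = e2 at *
  calc _ ≤ 2 * (ENNReal.ofReal C ^ 2 * e1) + 2 * (ENNReal.ofReal C ^ 2 * e0) +
        (2 * (ENNReal.ofReal C ^ 2 * e2) + 2 * (ENNReal.ofReal C ^ 2 * e0)) := by gcongr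
    _ = 4 * (ENNReal.ofReal C ^ 2 * e0) + 2 * (ENNReal.ofReal C ^ 2 * (e1 + e2)) := by ring
    _ ≤ 4 * (ENNReal.ofReal C ^ 2 * e0) + 4 * (ENNReal.ofReal C ^ 2 * (e1 + e2)) := by
        gcongr; norm_num
    _ = _ := by ring

/-- In the energy inequality ∂̄ of the j-th conjugated error is replaced, by the conjugated
equation, with `act α G j` minus ∂ of the error at j+2. This is the two-step recursion with f_j =
κ_j √L. It is solved from infinity and summed over j. -/
theorem tsum_nsq_del_act_le (h : IsErrorSystem a κ ν q qx qy E Ex Ey G)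
    (hI : IsIntegratingPair a α β C) :
    ∑' j, nsq (fun z => del (actD α 1 q qx j z) (actD α Complex.I q qy j z)) ≤
      8 * (ENNReal.ofReal C ^ 2 * ∑' n : ℕ, ((n : ℝ≥0∞) + 1) * h1NormSq (E n) (Ex n) (Ey n)) +
      2 * ((∑' j, (∑' m, κ (j + m)) ^ 2) *
        (ENNReal.ofReal C ^ 2 * (∑' j, nsq (q j) + ∑' j, ν j))) := by
  set L := ENNReal.ofReal C ^ 2 * (∑' j, nsq (q j) + ∑' j, ν j) with hL
  have mx := IsL2Seq.actD hI.left hI.left_dx h.l2 h.l2_dx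
  have my := IsL2Seq.actD hI.left hI.left_dy h.l2 h.l2_dy
  let X : ℕ → ℂ → ℂ := fun j z => del (actD α 1 q qx j z) (actD α Complex.I q qy j z)
  let Y : ℕ → ℂ → ℂ := fun j z => delBar (actD α 1 q qx j z) (actD α Complex.I q qy j z)
  have mX : ∀ j, MemLp (X j) 2 discMeasure := fun j => memLp_del (mx j) (my j)
  have mY : ∀ j, MemLp (Y j) 2 discMeasure := fun j => memLp_delBar (mx j) (my j)
  have hφ : ∀ j, eLpNorm (fun z => Y j z + X (j + 2) z) 2 discMeasure ≤ κ j * L ^ (1 / 2 : ℝ) :=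
    fun j => by
    refine le_of_sq_le_sq ?_
    rw [← nsq_eq_eLpNorm_sq, mul_pow, ← ENNReal.rpow_natCast (L ^ _), ← ENNReal.rpow_mul]
    norm_num only [one_div, Nat.cast_ofNat, ENNReal.rpow_one]
    refine le_trans (le_of_eq (nsq_congr ?_)) (h.nsq_act_rhs_le hI j)
    exact (h.ae_conjugated hI).mono fun z hz => hz j
  have hrec : ∀ j, eLpNorm (X j) 2 discMeasure ^ 2 ≤ (eLpNorm (X (j + 2)) 2 discMeasure +
      κ j * L ^ (1 / 2 : ℝ)) ^ 2 +
      nsq (fun z => del (actD α 1 E Ex j z) (actD α Complex.I E Ey j z)) := fun j => by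
    have h1 := h.nsq_del_act_le hI j
    rw [nsq_eq_eLpNorm_sq, nsq_eq_eLpNorm_sq fun z => delBar _ _] at h1
    refine h1.trans ?_
    gcongr
    have h2 : eLpNorm (Y j) 2 discMeasure ≤ eLpNorm (fun z => Y j z + X (j + 2) z) 2 discMeasure +
        eLpNorm (X (j + 2)) 2 discMeasure := by
      refine le_trans (le_of_eq ?_) (eLpNorm_sub_le ((mY j).add (mX (j + 2))).1 (mX (j + 2)).1
        one_le_two)
      exact congrArg (eLpNorm · 2 discMeasure) (add_sub_cancel_right (Y j) (X (j + 2))).symm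
    refine h2.trans ?_
    rw [add_comm]
    gcongr
    exact hφ j
  -- Only the finiteness matters: it makes the norms tend to zero, which starts the recursion at
  -- infinity.
  have hfin : ∑' j, eLpNorm (X j) 2 discMeasure ^ 2 < ⊤ := by
    simp_rw [← nsq_eq_eLpNorm_sq]
    refine (ENNReal.tsum_le_tsum fun j => (nsq_del_le (mx j)).trans (add_le_add
      (nsq_add_le_of_memLp (h.l2_dx.memLp_act hI.left j))
      (nsq_add_le_of_memLp (h.l2_dy.memLp_act hI.left j)))).trans_lt ?_
    simp only [ENNReal.tsum_add, ENNReal.tsum_mul_left]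
    have two : (2 : ℝ≥0∞) < ⊤ := by norm_num
    exact ENNReal.add_lt_top.2 ⟨ENNReal.add_lt_top.2
      ⟨ENNReal.mul_lt_top two (h.l2_dx.act hI.left).tsum_lt_top,
        ENNReal.mul_lt_top two (h.l2.act hI.left_dx).tsum_lt_top⟩, ENNReal.add_lt_top.2
      ⟨ENNReal.mul_lt_top two (h.l2_dy.act hI.left).tsum_lt_top,
        ENNReal.mul_lt_top two (h.l2.act hI.left_dy).tsum_lt_top⟩⟩
  have hx := le_add_tsum_of_sq_le hrec (tendsto_zero_of_tsum_lt_top hfin)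
  have hsum := ENNReal.tsum_le_tsum hx
  simp_rw [← nsq_eq_eLpNorm_sq, ENNReal.tsum_mul_right, mul_pow] at hsum
  rw [ENNReal.tsum_add, ENNReal.tsum_mul_left, ENNReal.tsum_mul_left, ENNReal.tsum_mul_right,
    ← ENNReal.rpow_natCast (L ^ _), ← ENNReal.rpow_mul] at hsum
  norm_num only [one_div, Nat.cast_ofNat, ENNReal.rpow_one] at hsum
  refine hsum.trans ?_
  refine add_le_add ?_ le_rfl
  calc _ ≤ 2 * (4 * (ENNReal.ofReal C ^ 2 *
        ∑' n : ℕ, ((n : ℝ≥0∞) + 1) * h1NormSq (E n) (Ex n) (Ey n))) :=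
        mul_le_mul_right ((tsum_tsum_add_le _).trans (h.tsum_nsq_del_lift_le hI)) 2
    _ = _ := by ring

end IsErrorSystem

/-! ### Stability -/

theorem le_of_two_mul_le {x y w : ℝ≥0∞} (hx : x < ⊤) (h : 2 * x ≤ y + (x + w)) : x ≤ y + w := by
  have h' : x + x ≤ (y + w) + x := by
    calc x + x = 2 * x := (two_mul x).symm
      _ ≤ y + (x + w) := h
      _ = y + w + x := by ring
  exact (ENNReal.add_le_add_iff_right hx.ne).1 h'

theorem ofReal_mul_nsq_le {a : ℂ → ℝ} {A : ℝ} (hA : ∀ z ∈ disc, |a z| ≤ A) (v : ℂ → ℂ) :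
    nsq (fun z => a z * v z) ≤ ENNReal.ofReal A ^ 2 * nsq v :=
  nsq_const_mul_le ENNReal.ofReal_lt_top (ae_disc fun z hz => by
    rw [enorm_mul, ← ofReal_norm (a z : ℂ), Complex.norm_real, Real.norm_eq_abs]
    gcongr
    exact hA z hz)

section

variable {a : ℂ → ℝ} {α β : ℕ → ℂ → ℂ} {C : ℝ}

/-- With Q = Σ‖q_j‖², undoing the convolution, then Poincaré, then the summed energy estimate bound
Q by the lift plus 128 c⁴K(Q + W). The smallness condition makes the last term at most half of Q +
W, and it is absorbed because Q is finite. -/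
theorem IsIntegratingPair.exists_tail_bound (hI : IsIntegratingPair a α β C) :
    ∃ D : ℝ≥0∞, D < ⊤ ∧ ∀ (κ ν : ℕ → ℝ≥0∞) (q qx qy E Ex Ey G : ℕ → ℂ → ℂ),
      IsErrorSystem a κ ν q qx qy E Ex Ey G →
      256 * ENNReal.ofReal C ^ 4 * (∑' j, (∑' m, κ (j + m)) ^ 2) ≤ 1 →
      ∑' j, nsq (q j) + ∑' j, nsq (fun z => del (qx j z) (qy j z)) ≤
        D * (∑' n : ℕ, ((n : ℝ≥0∞) + 1) * h1NormSq (E n) (Ex n) (Ey n) + ∑' j, ν j) := by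
  set c := ENNReal.ofReal C with hc
  have hct : c < ⊤ := ENNReal.ofReal_lt_top
  refine ⟨(1540 * c ^ 4 + 1) + (16 * c ^ 4 + ((1540 * c ^ 4 + 1) + 1) +
    4 * c ^ 4 * (1540 * c ^ 4 + 1)), ?_, ?_⟩
  · have : c ^ 4 < ⊤ := ENNReal.pow_lt_top hct
    finiteness
  intro κ ν q qx qy E Ex Ey G h hK
  set K := ∑' j, (∑' m, κ (j + m)) ^ 2
  set R := ∑' n : ℕ, ((n : ℝ≥0∞) + 1) * h1NormSq (E n) (Ex n) (Ey n)
  set W := ∑' j, ν j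
  have hX := h.tsum_nsq_del_act_le hI
  have hB : ∑' n : ℕ, nsq (fun z => del (actD α 1 E Ex n z) (actD α Complex.I E Ey n z)) ≤
      4 * (c ^ 2 * R) := by
    refine le_trans (ENNReal.tsum_le_tsum fun n => ?_) (h.tsum_nsq_del_lift_le hI)
    exact le_mul_of_one_le_left' le_add_self
  have hE : ∑' n, nsq (act α E n) ≤ c ^ 2 * R := by
    refine (tsum_nsq_act_le hI.left h.lift_l2).trans ?_
    refine mul_le_mul_right (ENNReal.tsum_le_tsum fun n => ?_) _
    refine le_trans ?_ (le_mul_of_one_le_left' le_add_self)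
    rw [h1NormSq, nsq_eq_eLpNorm_sq, add_assoc]
    exact le_self_add
  have hQ := hI.tsum_nsq_le h.l2
  have hV := ENNReal.tsum_le_tsum fun j => h.nsq_act_le_nsq_del hI j
  simp only [ENNReal.tsum_add, ENNReal.tsum_mul_left] at hV
  -- The convolution of ∂q is ∂ of the convolution of q, minus terms in which the coefficients are
  -- differentiated; these cost only Q. The convolution is then undone.
  have hD : ∑' j, nsq (fun z => del (qx j z) (qy j z)) ≤ c ^ 2 *
      (2 * ∑' j, nsq (fun z => del (actD α 1 q qx j z) (actD α Complex.I q qy j z)) +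
        4 * (c ^ 2 * ∑' j, nsq (q j))) := by
    have l2 : IsL2Seq fun j z => del (qx j z) (qy j z) := by
      refine ⟨fun j => memLp_del (h.l2_dx.memLp j) (h.l2_dy.memLp j), ?_⟩
      refine (ENNReal.tsum_le_tsum fun j => nsq_del_le (h.l2_dx.memLp j)).trans_lt ?_
      rw [ENNReal.tsum_add]
      exact ENNReal.add_lt_top.2 ⟨h.l2_dx.tsum_lt_top, h.l2_dy.tsum_lt_top⟩
    refine (hI.tsum_nsq_le l2).trans (mul_le_mul_right ?_ _)
    have hj : ∀ j, nsq (act α (fun j z => del (qx j z) (qy j z)) j) ≤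
        2 * nsq (fun z => del (actD α 1 q qx j z) (actD α Complex.I q qy j z)) +
        2 * (nsq (act (dCoeff α 1) q j) + nsq (act (dCoeff α Complex.I) q j)) := fun j => by
      refine le_trans (le_of_eq (nsq_congr ?_)) ((nsq_sub_le_of_memLp
        (w := fun z => del (act (dCoeff α 1) q j z) (act (dCoeff α Complex.I) q j z)) (memLp_del
        (IsL2Seq.actD hI.left hI.left_dx h.l2 h.l2_dx j)
        (IsL2Seq.actD hI.left hI.left_dy h.l2 h.l2_dy j))).trans
        (add_le_add le_rfl (mul_le_mul_right (nsq_del_le (h.l2.memLp_act hI.left_dx j)) 2)))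
      filter_upwards [ae_summable_act hI.left h.l2_dx, ae_summable_act hI.left h.l2_dy] with z sx sy
      have hs := ((sx j).hasSum.sub ((sy j).hasSum.mul_left Complex.I)).div_const 2
      have e : act α (fun j z => del (qx j z) (qy j z)) j z = (act α qx j z -
          Complex.I * act α qy j z) / 2 := by
        rw [act, act, act, ← hs.tsum_eq]
        exact tsum_congr fun k => by rw [del]; ring
      rw [e, del, del, actD, actD]
      ring
    refine (ENNReal.tsum_le_tsum hj).trans ?_
    simp only [ENNReal.tsum_add, ENNReal.tsum_mul_left]
    refine add_le_add le_rfl ?_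
    calc _ ≤ 2 * (c ^ 2 * ∑' j, nsq (q j) + c ^ 2 * ∑' j, nsq (q j)) := by
          exact mul_le_mul_right (add_le_add (tsum_nsq_act_le hI.left_dx h.l2)
            (tsum_nsq_act_le hI.left_dy h.l2)) 2
      _ = _ := by ring
  have hQt : ∑' j, nsq (q j) < ⊤ := h.l2.tsum_lt_top
  generalize (∑' j, nsq (q j)) = Q at *
  generalize (∑' j, nsq (fun z => del (actD α 1 q qx j z) (actD α Complex.I q qy j z))) = X at *
  -- 770 = 64 · 8 + 64 · 4 + 2, and 128 = 64 · 2.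
  have hQ2 : Q ≤ 770 * c ^ 4 * R + 128 * c ^ 4 * K * (Q + W) := by
    refine (hQ.trans (mul_le_mul_right hV _)).trans ?_
    calc _ ≤ c ^ 2 * (64 * (8 * (c ^ 2 * R) + 2 * (K * (c ^ 2 * (Q + W)))) + 64 * (4 * (c ^ 2 * R)) +
          2 * (c ^ 2 * R)) := by gcongr
      _ = _ := by ring
  have hQ3 : Q ≤ 1540 * c ^ 4 * R + W := by
    refine le_of_two_mul_le hQt ?_
    calc 2 * Q ≤ 2 * (770 * c ^ 4 * R + 128 * c ^ 4 * K * (Q + W)) := by gcongr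
      _ = 1540 * c ^ 4 * R + 256 * c ^ 4 * K * (Q + W) := by ring
      _ ≤ 1540 * c ^ 4 * R + 1 * (Q + W) := by gcongr
      _ = _ := by rw [one_mul]
  have hQ4 : Q ≤ (1540 * c ^ 4 + 1) * (R + W) := by
    refine hQ3.trans ?_
    calc 1540 * c ^ 4 * R + W ≤ 1540 * c ^ 4 * R + W + (1540 * c ^ 4 * W + R) := le_self_add
      _ = _ := by ring
  have hD2 : c ^ 2 * (2 * X + 4 * (c ^ 2 * Q)) ≤ 16 * c ^ 4 * R + (Q + W) + 4 * c ^ 4 * Q := by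
    calc _ ≤ c ^ 2 * (2 * (8 * (c ^ 2 * R) + 2 * (K * (c ^ 2 * (Q + W)))) + 4 * (c ^ 2 * Q)) := by
          gcongr
      _ = 16 * c ^ 4 * R + 4 * c ^ 4 * K * (Q + W) + 4 * c ^ 4 * Q := by ring
      _ ≤ 16 * c ^ 4 * R + 256 * c ^ 4 * K * (Q + W) + 4 * c ^ 4 * Q := by gcongr; norm_num
      _ ≤ 16 * c ^ 4 * R + 1 * (Q + W) + 4 * c ^ 4 * Q := by gcongr
      _ = _ := by rw [one_mul]
  have hR : R ≤ R + W := le_self_add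
  have hW : W ≤ R + W := le_add_self
  generalize R + W = Y at hQ4 hR hW ⊢
  generalize 1540 * c ^ 4 + 1 = d at hQ4 ⊢
  calc _ ≤ Q + (16 * c ^ 4 * R + (Q + W) + 4 * c ^ 4 * Q) := add_le_add le_rfl (hD.trans hD2)
    _ ≤ d * Y + (16 * c ^ 4 * Y + (d * Y + Y) + 4 * c ^ 4 * (d * Y)) := by gcongr
    _ = _ := by ring

/-- The tail bound applies from the index J on at which the double sum of κ has become small. Below
J the traces vanish, so Poincaré, the equality of the norms of ∂q_j and ∂̄q_j, and the equation
bound q_j and ∂q_j by the next two indices. -/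
theorem IsIntegratingPair.exists_error_bound (hI : IsIntegratingPair a α β C) {A : ℝ}
    (hA : ∀ z ∈ disc, |a z| ≤ A) {κ : ℕ → ℝ≥0∞} (hκ0 : κ 0 < ⊤)
    (hκ : ∑' j, (∑' m, κ (j + m)) ^ 2 < ⊤) :
    ∃ (J : ℕ) (D : ℝ≥0∞), D < ⊤ ∧ ∀ (ν : ℕ → ℝ≥0∞) (q qx qy E Ex Ey G : ℕ → ℂ → ℂ),
      IsErrorSystem a κ ν q qx qy E Ex Ey G → (∀ j < J, IsZeroTrace (q j) (qx j) (qy j)) →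
      ∀ j, nsq (q j) + nsq (fun z => del (qx j z) (qy j z)) ≤
        D * (∑' n : ℕ, ((n : ℝ≥0∞) + 1) * h1NormSq (E n) (Ex n) (Ey n) + ∑' j, ν j) := by
  obtain ⟨D, hD, hbound⟩ := hI.exists_tail_bound
  have hlim : Tendsto (fun J => 256 * ENNReal.ofReal C ^ 4 *
      (∑' j, (∑' m, κ (j + J + m)) ^ 2)) atTop (𝓝 0) := by
    have := ENNReal.Tendsto.const_mul (a := 256 * ENNReal.ofReal C ^ 4)
      (ENNReal.tendsto_sum_nat_add (fun j => (∑' m, κ (j + m)) ^ 2) hκ.ne)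
      (Or.inr (ENNReal.mul_lt_top (by norm_num) (ENNReal.pow_lt_top ENNReal.ofReal_lt_top)).ne)
    simpa using this
  obtain ⟨J, hJ⟩ := (hlim.eventually (ge_mem_nhds one_pos)).exists
  have hA2 : ENNReal.ofReal A ^ 2 < ⊤ := ENNReal.pow_lt_top ENNReal.ofReal_lt_top
  have hκ2 : κ 0 ^ 2 < ⊤ := ENNReal.pow_lt_top hκ0
  -- 17 = 16 + 1 counts the squared Poincaré constant for q_j and ∂q_j itself; the bracket collects
  -- scattering, ∂q_{j+2} and attenuation.
  obtain ⟨D', hD', hdesc⟩ := exists_descent_bound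
    (A := 17 * (4 * κ 0 ^ 2 + 4 + 2 * ENNReal.ofReal A ^ 2)) (by finiteness) J
  refine ⟨J, D' * (D + 1), ENNReal.mul_lt_top hD' (ENNReal.add_lt_top.2 ⟨hD, ENNReal.one_lt_top⟩),
    fun ν q qx qy E Ex Ey G h hz j => ?_⟩
  rw [mul_assoc]
  set R := ∑' n : ℕ, ((n : ℝ≥0∞) + 1) * h1NormSq (E n) (Ex n) (Ey n)
  set W := ∑' j, ν j
  refine hdesc (fun j => nsq (q j) + nsq (fun z => del (qx j z) (qy j z))) ((D + 1) * (R + W))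
    (fun i hi => ?_) (fun i hi => ?_) j
  · obtain ⟨m, rfl⟩ := Nat.exists_eq_add_of_le hi
    have h1 := hbound _ _ _ _ _ _ _ _ _ (h.shift J) (by
      refine le_trans (le_of_eq ?_) hJ
      simp only [add_assoc, add_comm J])
    calc _ ≤ ∑' j, nsq (q (J + j)) + ∑' j, nsq (fun z => del (qx (J + j) z) (qy (J + j) z)) :=
          add_le_add (ENNReal.le_tsum (f := fun m => nsq (q (J + m))) m)
            (ENNReal.le_tsum (f := fun m => nsq (fun z => del (qx (J + m) z) (qy (J + m) z))) m)
      _ ≤ _ := h1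
      _ ≤ D * (R + W) := by
          refine mul_le_mul_right (add_le_add ?_ ?_) D
          · refine le_trans (ENNReal.tsum_le_tsum fun n => ?_)
              (ENNReal.tsum_comp_le_tsum_of_injective (add_right_injective J)
                fun n : ℕ => ((n : ℝ≥0∞) + 1) * h1NormSq (E n) (Ex n) (Ey n))
            refine mul_le_mul_left ?_ _
            push_cast
            gcongr
            exact le_add_self
          · exact ENNReal.tsum_comp_le_tsum_of_injective (add_right_injective J) ν
      _ ≤ _ := by gcongr; exact le_self_add
  · have hX : ν (i + 1) ≤ (D + 1) * (R + W) := by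
      calc ν (i + 1) ≤ W := ENNReal.le_tsum _
        _ ≤ R + W := le_add_self
        _ = 1 * (R + W) := (one_mul _).symm
        _ ≤ _ := by gcongr; exact le_add_self
    generalize (D + 1) * (R + W) = X at hX ⊢
    have h1 : nsq (q i) ≤ 16 * nsq (fun z => del (qx i z) (qy i z)) := by
      rw [nsq_eq_eLpNorm_sq, nsq_eq_eLpNorm_sq]
      refine (pow_le_pow_left' (hz i hi).eLpNorm_le 2).trans (le_of_eq ?_)
      rw [mul_pow]; norm_num
    have h2 : nsq (fun z => del (qx i z) (qy i z)) ≤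
        2 * (2 * nsq (G i) + 2 * nsq (fun z => del (qx (i + 2) z) (qy (i + 2) z))) +
          2 * (ENNReal.ofReal A ^ 2 * nsq (q (i + 1))) := by
      have m1 := h.memLp_rhs i
      have m2 := memLp_del (h.l2_dx.memLp (i + 2)) (h.l2_dy.memLp (i + 2))
      rw [(hz i hi).nsq_del]
      refine le_trans (le_of_eq (nsq_congr ?_)) ((nsq_sub_le_of_memLp
        (w := fun z => a z * q (i + 1) z) (m1.sub m2)).trans (add_le_add
        (mul_le_mul_right (nsq_sub_le_of_memLp m1) 2)
        (mul_le_mul_right (ofReal_mul_nsq_le hA _) 2)))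
      filter_upwards [h.equation] with z hz
      rw [Pi.sub_apply, ← hz i]; ring
    have h3 : nsq (G i) ≤ κ 0 ^ 2 * (nsq (q (i + 1)) + X) :=
      (h.nsq_rhs_le i).trans (by gcongr; exact h.antitone (zero_le))
    generalize nsq (fun z => del (qx i z) (qy i z)) = d at *
    generalize nsq (fun z => del (qx (i + 2) z) (qy (i + 2) z)) = d2 at *
    generalize nsq (fun z => del (qx (i + 1) z) (qy (i + 1) z)) = d1 at *
    generalize nsq (q (i + 1)) = q1 at *
    generalize nsq (q (i + 2)) = q2 at *
    calc nsq (q i) + d ≤ 16 * d + d := by gcongr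
      _ = 17 * d := by ring
      _ ≤ 17 * (2 * (2 * (κ 0 ^ 2 * (q1 + X)) + 2 * d2) + 2 * (ENNReal.ofReal A ^ 2 * q1)) := by
          gcongr
          exact h2.trans (by gcongr)
      -- Nonnegative terms are added only to complete the multiple of `d (i + 1) + d (i + 2) + X`.
      _ ≤ 17 * (2 * (2 * (κ 0 ^ 2 * (q1 + X)) + 2 * d2) + 2 * (ENNReal.ofReal A ^ 2 * q1)) +
          17 * (4 * κ 0 ^ 2 * (d1 + q2 + d2) + 4 * (q1 + d1 + q2 + X) +
            2 * ENNReal.ofReal A ^ 2 * (d1 + q2 + d2 + X)) := le_self_add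
      _ = _ := by ring

end

/-! ### The error of a reconstruction -/

/-- Bessel's inequality in the angle for almost every z, integrated over z. -/
theorem isL2Seq_angularMode {u : ℂ → ℝ → ℝ}
    (h : MemLp (Function.uncurry u) 2 (discMeasure.prod angleMeasure)) :
    IsL2Seq fun j => angularMode u (-(j : ℤ)) := by
  have hmeas : ∀ n : ℤ, AEStronglyMeasurable (angularMode u n) discMeasure := fun n => by
    have h1 : AEStronglyMeasurable (fun p : ℂ × ℝ => (u p.1 p.2 : ℂ) *
        Complex.exp (-(Complex.I * n * p.2))) (discMeasure.prod angleMeasure) :=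
      (Complex.continuous_ofReal.comp_aestronglyMeasurable h.1).mul
        (Continuous.aestronglyMeasurable (by fun_prop))
    exact h1.integral_prod_right'.const_mul _
  have hfin : ∫⁻ z, ∫⁻ θ, ‖(u z θ : ℂ)‖ₑ ^ 2 ∂angleMeasure ∂discMeasure < ⊤ := by
    have h4 : MemLp (fun p : ℂ × ℝ => ((Function.uncurry u p : ℝ) : ℂ)) 2
      (discMeasure.prod angleMeasure) := h.ofReal
    have h2 : AEMeasurable (fun p : ℂ × ℝ => ‖((Function.uncurry u p : ℝ) : ℂ)‖ₑ ^ 2)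
        (discMeasure.prod angleMeasure) := h4.1.enorm.pow_const 2
    have h3 : ∫⁻ p, ‖((Function.uncurry u p : ℝ) : ℂ)‖ₑ ^ 2 ∂(discMeasure.prod angleMeasure) < ⊤ := by
      have h5 := lintegral_rpow_enorm_lt_top_of_eLpNorm_lt_top two_ne_zero ENNReal.ofNat_ne_top h4.2
      simpa only [ENNReal.toReal_ofNat, ENNReal.rpow_ofNat] using h5
    rw [lintegral_prod _ h2] at h3
    exact h3
  have hsum : ∫⁻ z, ∑' j : ℕ, ‖angularMode u (-(j : ℤ)) z‖ₑ ^ 2 ∂discMeasure < ⊤ := by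
    refine lt_of_le_of_lt (lintegral_mono_ae ?_) hfin
    filter_upwards [ae_memLp_slice h] with z hz
    refine le_trans ?_ (tsum_enorm_fourierMode_sq_le hz)
    exact ENNReal.tsum_comp_le_tsum_of_injective (f := fun j : ℕ => -(j : ℤ))
      (fun m n hmn => by simpa using hmn) fun n : ℤ => ‖fourierMode (fun θ => (u z θ : ℂ)) n‖ₑ ^ 2
  rw [lintegral_tsum fun j => (hmeas _).enorm.pow_const 2] at hsum
  exact ⟨fun j => memLp_of_nsq_lt_top (hmeas _) ((ENNReal.le_tsum j).trans_lt hsum), hsum⟩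

theorem IsTrace.sub {v vx vy w wx wy : ℂ → ℂ} {g d : ℝ → ℂ}
    (hv : MemLp v 2 discMeasure) (hvx : MemLp vx 2 discMeasure) (hvy : MemLp vy 2 discMeasure)
    (hw : MemLp w 2 discMeasure) (hwx : MemLp wx 2 discMeasure) (hwy : MemLp wy 2 discMeasure)
    (hg : IsTrace v vx vy g) (hd : IsTrace w wx wy d) :
    IsTrace (fun z => v z - w z) (fun z => vx z - wx z) (fun z => vy z - wy z)
      fun β => g β - d β := by
  have hint (e : ℂ) (u U : ℂ → ℂ) (hu : MemLp u 2 discMeasure) (hU : MemLp U 2 discMeasure)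
      (ψ : ℂ → ℝ) (hψ : ContDiff ℝ ∞ ψ) :
      Integrable (fun z => U z * (ψ z : ℂ) + u z * (fderiv ℝ ψ z e : ℂ)) discMeasure :=
    (integrable_mul_continuous hU (Complex.continuous_ofReal.comp hψ.continuous)).add
      (integrable_mul_continuous hu (Complex.continuous_ofReal.comp
        ((hψ.continuous_fderiv (by simp)).clm_apply continuous_const)))
  have hbdry (t : ℝ → ℂ) (ht : MemLp t 2 angleMeasure) (ψ : ℂ → ℝ) (hψ : ContDiff ℝ ∞ ψ) (ν : ℝ → ℝ)
      (hν : Continuous ν) (hν1 : ∀ β, |ν β| ≤ 1) : Integrable (fun β => t β *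
        ((ψ (Complex.exp (Complex.I * β)) * ν β : ℝ) : ℂ)) angleMeasure := by
    have hψc := hψ.continuous
    obtain ⟨K, hK⟩ := (isCompact_closedBall (0 : ℂ) 1).exists_bound_of_continuousOn hψc.continuousOn
    refine (ht.integrable one_le_two).mul_bdd (c := K) (Continuous.aestronglyMeasurable
      (by fun_prop)) (ae_of_all _ fun β => ?_)
    have h1 := hK (Complex.exp (Complex.I * β)) (by simp [Complex.norm_exp])
    rw [Complex.norm_real, norm_mul]
    calc _ ≤ K * 1 := mul_le_mul h1 (hν1 β) (abs_nonneg _) ((norm_nonneg _).trans h1)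
      _ = K := mul_one K
  refine ⟨hg.memLp.sub hd.memLp, fun φ hφ => ?_, fun φ hφ => ?_⟩
  · have e := congrArg₂ (· - ·) (hg.green_x φ hφ) (hd.green_x φ hφ)
    beta_reduce at e
    rw [← integral_sub (hint _ _ _ hv hvx φ hφ) (hint _ _ _ hw hwx φ hφ), ← integral_sub
      (hbdry _ hg.memLp φ hφ _ Real.continuous_cos Real.abs_cos_le_one)
      (hbdry _ hd.memLp φ hφ _ Real.continuous_cos Real.abs_cos_le_one)] at e
    refine Eq.trans ?_ (e.trans ?_)
    · congr 1; ext z; ring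
    · congr 1; ext z; ring
  · have e := congrArg₂ (· - ·) (hg.green_y φ hφ) (hd.green_y φ hφ)
    beta_reduce at e
    rw [← integral_sub (hint _ _ _ hv hvy φ hφ) (hint _ _ _ hw hwy φ hφ), ← integral_sub
      (hbdry _ hg.memLp φ hφ _ Real.continuous_sin Real.abs_sin_le_one)
      (hbdry _ hd.memLp φ hφ _ Real.continuous_sin Real.abs_sin_le_one)] at e
    refine Eq.trans ?_ (e.trans ?_)
    · congr 1; ext z; ring
    · congr 1; ext z; ring

theorem memLp_ofReal_mul {a : ℂ → ℝ} {A : ℝ} (hc : ContinuousOn a disc)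
    (hA : ∀ z ∈ disc, |a z| ≤ A) {v : ℂ → ℂ} (hv : MemLp v 2 discMeasure) :
    MemLp (fun z => (a z : ℂ) * v z) 2 discMeasure := by
  have hm : AEStronglyMeasurable a discMeasure := hc.aestronglyMeasurable measurableSet_disc
  refine hv.of_le_mul (c := A) ((Complex.continuous_ofReal.comp_aestronglyMeasurable hm).mul hv.1)
    (ae_disc fun z hz => ?_)
  rw [norm_mul, Complex.norm_real]
  exact mul_le_mul_of_nonneg_right (hA z hz) (norm_nonneg _)

theorem nsq_le_of_norm_le {v w₁ w₂ : ℂ → ℂ} {c : ℝ} (h₁ : MemLp w₁ 2 discMeasure)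
    (h : ∀ᵐ z ∂discMeasure, ‖v z‖ ≤ c * (‖w₁ z‖ + ‖w₂ z‖)) :
    nsq v ≤ ENNReal.ofReal (2 * c) ^ 2 * (nsq w₁ + nsq w₂) := by
  have hn : ∀ w : ℂ → ℂ, nsq (fun z => (‖w z‖ : ℂ)) = nsq w := fun w => by
    simp only [nsq, ← ofReal_norm, Complex.norm_real, norm_norm]
  have h1 : nsq v ≤ ENNReal.ofReal c ^ 2 * nsq (fun z => (‖w₁ z‖ : ℂ) + (‖w₂ z‖ : ℂ)) := by
    refine nsq_const_mul_le ENNReal.ofReal_lt_top (h.mono fun z hz => ?_)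
    rw [← Complex.ofReal_add, ← ofReal_norm, ← ofReal_norm (Complex.ofReal _), Complex.norm_real,
      Real.norm_of_nonneg (by positivity), ← ENNReal.ofReal_mul' (by positivity)]
    exact ENNReal.ofReal_le_ofReal hz
  have h2 := nsq_add_le_of_memLp (v := fun z => (‖w₁ z‖ : ℂ)) (w := fun z => (‖w₂ z‖ : ℂ))
    h₁.norm.ofReal
  rw [hn, hn] at h2
  refine h1.trans ((mul_le_mul_right h2 _).trans ?_)
  rw [ENNReal.ofReal_mul two_pos.le, ENNReal.ofReal_ofNat]
  generalize ENNReal.ofReal c = c'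
  calc c' ^ 2 * (2 * nsq w₁ + 2 * nsq w₂) = 2 * (c' ^ 2 * (nsq w₁ + nsq w₂)) := by ring
    _ ≤ 4 * (c' ^ 2 * (nsq w₁ + nsq w₂)) := by gcongr; norm_num
    _ = _ := by ring

theorem exists_smooth_lift {d : ℝ → ℂ} (hd : MemLp d 2 angleMeasure) (h : halfNormSq d < ⊤) :
    ∃ v vx vy : ℂ → ℂ, MemLp v 2 discMeasure ∧ MemLp vx 2 discMeasure ∧ MemLp vy 2 discMeasure ∧
      IsTrace v vx vy d ∧ h1NormSq v vx vy ≤ 96 * halfNormSq d ∧ HasSmoothApprox v vx vy := by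
  obtain ⟨v, vx, vy, S, m, mx, my, ht, hn, hS⟩ := exists_lift hd h
  exact ⟨v, vx, vy, m, mx, my, ht, hn, S, hS⟩

theorem halfNormSq_eq_zero {d : ℝ → ℂ} (h : d =ᵐ[angleMeasure] fun _ => 0) : halfNormSq d = 0 := by
  have h1 : ∀ n : ℤ, fourierMode d n = 0 := fun n => by
    rw [fourierMode_congr h, fourierMode]; simp
  simp [halfNormSq, h1]

theorem IsNoisyData.halfNormSq_le {g gt : ℕ → ℝ → ℂ} {ρ : ℕ → ℝ≥0∞} {M : ℕ}
    (h : IsNoisyData g ρ M gt) (j : ℕ) :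
    halfNormSq (fun β => gt j β - g j β) ≤ if M < j then ρ j ^ 2 else 0 := by
  split_ifs with hj
  · exact h.noise j hj
  · rw [halfNormSq_eq_zero ((h.exact_modes j (not_lt.1 hj)).mono fun β hβ => by rw [hβ, sub_self])]

theorem tsum_nsq_le_of_h1NormSq {v vx vy : ℕ → ℂ → ℂ} (hv : ∀ j, MemLp (v j) 2 discMeasure)
    (hvx : ∀ j, MemLp (vx j) 2 discMeasure) (hvy : ∀ j, MemLp (vy j) 2 discMeasure)
    (h : ∑' j, h1NormSq (v j) (vx j) (vy j) < ⊤) : IsL2Seq v ∧ IsL2Seq vx ∧ IsL2Seq vy := by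
  simp only [h1NormSq, ← nsq_eq_eLpNorm_sq, ENNReal.tsum_add] at h
  obtain ⟨h1, h2⟩ := ENNReal.add_lt_top.1 h
  obtain ⟨h3, h4⟩ := ENNReal.add_lt_top.1 h1
  exact ⟨⟨hv, h3⟩, ⟨hvx, h4⟩, ⟨hvy, h2⟩⟩

theorem rho_sq_le (ρ : ℕ → ℝ≥0∞) (j : ℕ) :
    ρ j ^ 2 ≤ ENNReal.ofReal (√(1 + (j : ℝ) ^ 2)) * ρ j ^ 2 := by
  refine le_mul_of_one_le_left' ?_
  rw [← ENNReal.ofReal_one]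
  refine ENNReal.ofReal_le_ofReal (Real.le_sqrt_of_sq_le ?_)
  nlinarith [sq_nonneg (j : ℝ)]

theorem natCast_add_one_le (n : ℕ) :
    (n : ℝ≥0∞) + 1 ≤ 2 * ENNReal.ofReal (√(1 + (n : ℝ) ^ 2)) := by
  have h1 : (n : ℝ) + 1 ≤ 2 * √(1 + (n : ℝ) ^ 2) := by
    have h2 : (n : ℝ) ≤ √(1 + (n : ℝ) ^ 2) := Real.le_sqrt_of_sq_le (by linarith)
    have h3 : (1 : ℝ) ≤ √(1 + (n : ℝ) ^ 2) := Real.le_sqrt_of_sq_le (by nlinarith [sq_nonneg (n : ℝ)])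
    linarith
  have h4 := ENNReal.ofReal_le_ofReal h1
  rwa [ENNReal.ofReal_mul two_pos.le, ENNReal.ofReal_ofNat, ENNReal.ofReal_add (Nat.cast_nonneg _)
    zero_le_one, ENNReal.ofReal_natCast, ENNReal.ofReal_one] at h4

/-- The bound for the modes of the scattering kernel in the equation for the error. -/
def kernelWeight (s c : ℝ) (j : ℕ) : ℝ≥0∞ := ENNReal.ofReal (c * ((j : ℝ) + 2) ^ (-(1 + s)))

theorem antitone_kernelWeight {s c : ℝ} (hs : 0 < s) (hc : 0 ≤ c) : Antitone (kernelWeight s c) :=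
  fun i j hij => by
    refine ENNReal.ofReal_le_ofReal (mul_le_mul_of_nonneg_left ?_ hc)
    have : (i : ℝ) ≤ j := by exact_mod_cast hij
    exact Real.rpow_le_rpow_of_nonpos (by positivity) (by linarith) (by linarith)

/-- The right-hand side G is taken to be the differential expression itself, so the equation is a
definition and the content is the bound on G. The lift carries the difference of the data, which
vanishes in the modes that are exact. -/
theorem exists_errorSystem {s c A : ℝ} (hs : 0 < s) {a : ℂ → ℝ} (hac : ContinuousOn a disc)
    (hA : ∀ z ∈ disc, |a z| ≤ A) {k : ℂ → ℝ → ℝ} (hk : IsC1HolderKernel s k) (hc : 0 ≤ c)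
    (hkc : ∀ n : ℕ, ∀ z ∈ disc, ‖kernelMode k (-(n : ℤ)) z‖ ≤ c * ((n : ℝ) + 1) ^ (-(1 + s)))
    {f : ℂ → ℝ} {u ux uy uθ : ℂ → ℝ → ℝ} (hu : IsH1Phase u ux uy uθ)
    (hfu : IsTransportSolution a k f u ux uy) {g : ℕ → ℝ → ℂ}
    (hg : ∀ j : ℕ, IsTrace (angularMode u (-(j : ℤ))) (angularMode ux (-(j : ℤ)))
      (angularMode uy (-(j : ℤ))) (g j)) {ρ : ℕ → ℝ≥0∞}
    (hρ : ∑' j : ℕ, ENNReal.ofReal (√(1 + (j : ℝ) ^ 2)) * ρ j ^ 2 < ⊤) {M : ℕ} {gt : ℕ → ℝ → ℂ}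
    {F : ℂ → ℂ} (hgt : IsNoisyData g ρ M gt) (hF : IsReconstruction a k M gt F) :
    ∃ q qx qy E Ex Ey G : ℕ → ℂ → ℂ,
      IsErrorSystem a (kernelWeight s (2 * c))
        (fun j => if M < j then nsq (angularMode u (-(j : ℤ))) else 0) q qx qy E Ex Ey G ∧
      (∀ j ≤ M, IsZeroTrace (q j) (qx j) (qy j)) ∧
      (∀ j, h1NormSq (E j) (Ex j) (Ey j) ≤ 96 * if M < j then ρ j ^ 2 else 0) ∧
      nsq (fun z => F z - (f z : ℂ)) ≤ ENNReal.ofReal (2 * (2 + A + c)) ^ 2 *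
        (nsq (fun z => del (qx 1 z) (qy 1 z)) + nsq (q 0)) := by
  obtain ⟨U, Ux, Uy, hU, hUsum, hUt, hUeq, hFU⟩ := hF
  obtain ⟨lU, lUx, lUy⟩ := tsum_nsq_le_of_h1NormSq (fun j => (hU j).memLp)
    (fun j => (hU j).memLp_dx) (fun j => (hU j).memLp_dy) hUsum
  have lu := isL2Seq_angularMode hu.memLp
  have lux := isL2Seq_angularMode hu.memLp_dx
  have luy := isL2Seq_angularMode hu.memLp_dy
  have hρt : ∀ j, ρ j ^ 2 < ⊤ := fun j =>
    (rho_sq_le ρ j).trans_lt ((ENNReal.le_tsum j).trans_lt hρ)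
  have hhalf : ∀ j, halfNormSq (fun β => gt j β - g j β) < ⊤ := fun j =>
    (hgt.halfNormSq_le j).trans_lt (by split_ifs; exacts [hρt j, ENNReal.zero_lt_top])
  choose E Ex Ey mE mEx mEy tE nE sE using fun j =>
    exists_smooth_lift ((hUt j).memLp.sub (hg j).memLp) (hhalf j)
  have nE' : ∀ j, h1NormSq (E j) (Ex j) (Ey j) ≤ 96 * if M < j then ρ j ^ 2 else 0 := fun j =>
    (nE j).trans (mul_le_mul_right (hgt.halfNormSq_le j) _)
  obtain ⟨lE, lEx, lEy⟩ := tsum_nsq_le_of_h1NormSq mE mEx mEy (by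
    refine (ENNReal.tsum_le_tsum nE').trans_lt ?_
    rw [ENNReal.tsum_mul_left]
    refine ENNReal.mul_lt_top (by norm_num) (lt_of_le_of_lt (ENNReal.tsum_le_tsum fun j => ?_) hρ)
    split_ifs
    exacts [rho_sq_le ρ j, zero_le])
  refine ⟨fun j z => U j z - angularMode u (-(j : ℤ)) z,
    fun j z => Ux j z - angularMode ux (-(j : ℤ)) z, fun j z => Uy j z - angularMode uy (-(j : ℤ)) z,
    E, Ex, Ey, fun j z => delBar (Ux j z - angularMode ux (-(j : ℤ)) z)
      (Uy j z - angularMode uy (-(j : ℤ)) z) +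
      del (Ux (j + 2) z - angularMode ux (-((j + 2 : ℕ) : ℤ)) z)
      (Uy (j + 2) z - angularMode uy (-((j + 2 : ℕ) : ℤ)) z) +
      a z * (U (j + 1) z - angularMode u (-((j + 1 : ℕ) : ℤ)) z),
    ⟨lU.sub lu, lUx.sub lux, lUy.sub luy, lE, lEx, lEy, sE, fun j => ?_, fun j => ?_,
      ae_of_all _ fun z j => rfl, fun j => ?_,
      antitone_kernelWeight hs (by positivity)⟩, fun j hj => ?_, nE', ?_⟩
  · exact isZeroTrace_of_isTrace ((lU.memLp j).sub (lu.memLp j)) ((lUx.memLp j).sub (lux.memLp j))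
      ((lUy.memLp j).sub (luy.memLp j)) (mE j) (mEx j) (mEy j)
      (IsTrace.sub (lU.memLp j) (lUx.memLp j) (lUy.memLp j) (lu.memLp j) (lux.memLp j) (luy.memLp j)
        (hUt j) (hg j)) (tE j) EventuallyEq.rfl
  · exact ((memLp_delBar ((lUx.memLp j).sub (lux.memLp j)) ((lUy.memLp j).sub (luy.memLp j))).add
      (memLp_del ((lUx.memLp (j + 2)).sub (lux.memLp (j + 2)))
        ((lUy.memLp (j + 2)).sub (luy.memLp (j + 2))))).add
      (memLp_ofReal_mul hac hA ((lU.memLp (j + 1)).sub (lu.memLp (j + 1))))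
  · have key := nsq_le_of_norm_le (c := c * (((j : ℝ) + 2) ^ (-(1 + s))))
      (v := fun z => delBar (Ux j z - angularMode ux (-(j : ℤ)) z)
        (Uy j z - angularMode uy (-(j : ℤ)) z) +
        del (Ux (j + 2) z - angularMode ux (-((j + 2 : ℕ) : ℤ)) z)
        (Uy (j + 2) z - angularMode uy (-((j + 2 : ℕ) : ℤ)) z) +
        a z * (U (j + 1) z - angularMode u (-((j + 1 : ℕ) : ℤ)) z))
      (w₂ := fun z => if M < j + 1 then angularMode u (-((j + 1 : ℕ) : ℤ)) z else 0)
      ((lU.memLp (j + 1)).sub (lu.memLp (j + 1))) (by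
        filter_upwards [hUeq j, transport_mode_neg hk hu hfu, ae_disc fun z hz => hz]
          with z h1 h2 hz
        have h3 := hkc (j + 1) z hz
        rw [show ((j + 1 : ℕ) : ℝ) + 1 = (j : ℝ) + 2 by push_cast; ring] at h3
        have e : delBar (Ux j z - angularMode ux (-(j : ℤ)) z)
            (Uy j z - angularMode uy (-(j : ℤ)) z) +
            del (Ux (j + 2) z - angularMode ux (-((j + 2 : ℕ) : ℤ)) z)
            (Uy (j + 2) z - angularMode uy (-((j + 2 : ℕ) : ℤ)) z) +
            a z * (U (j + 1) z - angularMode u (-((j + 1 : ℕ) : ℤ)) z) =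
            truncMode k M (j + 1) z * U (j + 1) z -
            kernelMode k (-((j + 1 : ℕ) : ℤ)) z * angularMode u (-((j + 1 : ℕ) : ℤ)) z := by
          rw [← h1, ← h2 j]
          simp only [del, delBar]
          ring
        -- For j + 1 ≤ M both equations contain the kernel mode, and q_{j+1} factors out. For j + 1
        -- > M the reconstruction has no scattering, and the exact mode remains; this is the part
        -- recorded in ν.
        rw [e, Pi.sub_apply, truncMode]
        generalize kernelMode k (-((j + 1 : ℕ) : ℤ)) z = κ at h3
        generalize angularMode u (-((j + 1 : ℕ) : ℤ)) z = v
        split_ifs with h4 h5 h5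
        · omega
        · rw [← mul_sub, norm_mul, norm_zero, add_zero]
          exact mul_le_mul_of_nonneg_right h3 (norm_nonneg _)
        · rw [zero_mul, zero_sub, norm_neg, norm_mul]
          exact mul_le_mul h3 (le_add_of_nonneg_left (norm_nonneg _)) (norm_nonneg _) (by positivity)
        · omega)
    refine key.trans (le_of_eq ?_)
    rw [kernelWeight, mul_assoc 2]
    congr 2
    split_ifs
    · rfl
    · simp [nsq]
  · exact isZeroTrace_of_isTrace (lU.memLp j) (lUx.memLp j) (lUy.memLp j) (lu.memLp j)
      (lux.memLp j) (luy.memLp j) (hUt j) (hg j) (hgt.exact_modes j hj)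
  · refine nsq_le_of_norm_le (memLp_del ((lUx.memLp 1).sub (lux.memLp 1))
      ((lUy.memLp 1).sub (luy.memLp 1))) ?_
    filter_upwards [hFU, transport_mode_zero hk hu hfu, ae_disc fun z hz => hz] with z h1 h2 hz
    have hk0 := hkc 0 z hz
    simp only [Nat.cast_zero, neg_zero, zero_add, Real.one_rpow, mul_one] at hk0
    have ha : ‖(a z : ℂ)‖ ≤ A := by rw [Complex.norm_real]; exact hA z hz
    have e : F z - (f z : ℂ) = 2 * ((del (Ux 1 z - angularMode ux (-((1 : ℕ) : ℤ)) z)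
        (Uy 1 z - angularMode uy (-((1 : ℕ) : ℤ)) z)).re : ℂ) +
        (a z - kernelMode k 0 z) * (U 0 z - angularMode u (-((0 : ℕ) : ℤ)) z) := by
      have hd : del (Ux 1 z - angularMode ux (-((1 : ℕ) : ℤ)) z)
          (Uy 1 z - angularMode uy (-((1 : ℕ) : ℤ)) z) = del (Ux 1 z) (Uy 1 z) -
          del (angularMode ux (-((1 : ℕ) : ℤ)) z) (angularMode uy (-((1 : ℕ) : ℤ)) z) := by
        simp only [del]; ring
      rw [h1, h2, hd, Complex.sub_re]
      push_cast
      ring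
    rw [e]
    generalize del (Ux 1 z - angularMode ux (-((1 : ℕ) : ℤ)) z)
      (Uy 1 z - angularMode uy (-((1 : ℕ) : ℤ)) z) = x
    generalize U 0 z - angularMode u (-((0 : ℕ) : ℤ)) z = y
    have b1 : ‖2 * (x.re : ℂ)‖ ≤ 2 * ‖x‖ := by
      rw [norm_mul, Complex.norm_real, Complex.norm_ofNat]
      exact mul_le_mul_of_nonneg_left (Complex.abs_re_le_norm x) two_pos.le
    have b2 : ‖((a z : ℂ) - kernelMode k 0 z) * y‖ ≤ (A + c) * ‖y‖ := by
      rw [norm_mul]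
      exact mul_le_mul_of_nonneg_right ((norm_sub_le _ _).trans (add_le_add ha hk0)) (norm_nonneg _)
    have hAc : 0 ≤ A + c := add_nonneg ((norm_nonneg _).trans ha) hc
    refine (norm_add_le _ _).trans ((add_le_add b1 b2).trans ?_)
    nlinarith [mul_nonneg hAc (norm_nonneg x), norm_nonneg y]

/-! ### Convergence of the reconstruction -/

/-- Stability of the reconstruction under noise in the high modes of the data. -/
theorem exists_forall_eLpNorm_reconstruction_sub_le {s : ℝ} (hs : 1 / 2 < s) {a : ℂ → ℝ}
    (ha : IsC2Holder s a) {k : ℂ → ℝ → ℝ} (hk : IsC1HolderKernel s k) {f : ℂ → ℝ}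
    {u ux uy uθ : ℂ → ℝ → ℝ} (hu : IsH1Phase u ux uy uθ) (hfu : IsTransportSolution a k f u ux uy)
    {g : ℕ → ℝ → ℂ} (hg : ∀ j : ℕ, IsTrace (angularMode u (-(j : ℤ))) (angularMode ux (-(j : ℤ)))
      (angularMode uy (-(j : ℤ))) (g j)) {ρ : ℕ → ℝ≥0∞}
    (hρ : ∑' j : ℕ, ENNReal.ofReal (√(1 + (j : ℝ) ^ 2)) * ρ j ^ 2 < ⊤) :
    ∀ ε : ℝ≥0∞, 0 < ε → ∃ M₀ : ℕ, ∀ M ≥ M₀, ∀ (gt : ℕ → ℝ → ℂ) (fM : ℂ → ℂ),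
      IsNoisyData g ρ M gt → IsReconstruction a k M gt fM →
        eLpNorm (fun z => fM z - (f z : ℂ)) 2 discMeasure ≤ ε := by
  intro ε hε
  obtain ⟨haC, A, hA⟩ := ha
  obtain ⟨α, β, C, hI⟩ := exists_isIntegratingPair ⟨haC, A, hA⟩
  have hs0 : 0 < s := by linarith
  obtain ⟨c, hc, hkc⟩ := exists_kernelMode_bound hs0 hk
  obtain ⟨J, D, hD, hbound⟩ := hI.exists_error_bound (fun z hz => (hA z hz).1)
    (κ := kernelWeight s (2 * c)) ENNReal.ofReal_lt_top (tsum_sq_tail_lt_top hs (2 * c))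
  -- The factor 2D occurs because the error bound is used twice, for ∂q_1 and for q_0.
  set B := ENNReal.ofReal (2 * (2 + A + c)) ^ 2 * (2 * D)
  have hB : B < ⊤ := ENNReal.mul_lt_top (ENNReal.pow_lt_top ENNReal.ofReal_lt_top)
    (ENNReal.mul_lt_top (by norm_num) hD)
  have hlim := ENNReal.Tendsto.const_mul (a := B)
    ((ENNReal.Tendsto.const_mul (a := 192) (tendsto_tsum_indicator hρ)
      (Or.inr (by norm_num))).add
      (tendsto_tsum_indicator (isL2Seq_angularMode hu.memLp).tsum_lt_top)) (Or.inr hB.ne)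
  simp only [mul_zero, add_zero] at hlim
  obtain ⟨M₁, hM₁⟩ := eventually_atTop.1 (hlim.eventually (ge_mem_nhds (ENNReal.pow_pos hε 2)))
  -- M ≥ J makes the traces below J vanish, and M ≥ M₁ makes the two tails small. Neither depends on
  -- the noisy data.
  refine ⟨max J M₁, fun M hM gt fM hgt hfM => ?_⟩
  obtain ⟨q, qx, qy, E, Ex, Ey, G, hsys, hz, hE, hdiff⟩ := exists_errorSystem hs0
    haC.continuousOn (fun z hz => (hA z hz).1) hk hc hkc hu hfu hg hρ hgt hfM
  have hb := hbound _ q qx qy E Ex Ey G hsys fun j hj => hz j (by omega)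
  -- 192 = 2 · 96, from n + 1 ≤ 2√(1 + n²) and the norm of the lift.
  have hR : ∑' n : ℕ, ((n : ℝ≥0∞) + 1) * h1NormSq (E n) (Ex n) (Ey n) ≤
      192 * ∑' n : ℕ, if M < n then ENNReal.ofReal (√(1 + (n : ℝ) ^ 2)) * ρ n ^ 2 else 0 := by
    rw [← ENNReal.tsum_mul_left]
    refine ENNReal.tsum_le_tsum fun n => (mul_le_mul' (natCast_add_one_le n) (hE n)).trans ?_
    split_ifs
    · exact le_of_eq (by ring)
    · simp
  refine le_of_sq_le_sq ?_
  rw [← nsq_eq_eLpNorm_sq]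
  refine hdiff.trans (le_trans ?_ (hM₁ M (by omega)))
  rw [mul_assoc]
  refine mul_le_mul_right ?_ _
  calc _ ≤ D * (∑' n : ℕ, ((n : ℝ≥0∞) + 1) * h1NormSq (E n) (Ex n) (Ey n) +
        ∑' j, if M < j then nsq (angularMode u (-(j : ℤ))) else 0) +
        D * (∑' n : ℕ, ((n : ℝ≥0∞) + 1) * h1NormSq (E n) (Ex n) (Ey n) +
        ∑' j, if M < j then nsq (angularMode u (-(j : ℤ))) else 0) :=
        add_le_add (le_add_self.trans (hb 1)) (le_self_add.trans (hb 0))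
    _ = 2 * D * (∑' n : ℕ, ((n : ℝ≥0∞) + 1) * h1NormSq (E n) (Ex n) (Ey n) +
        ∑' j, if M < j then nsq (angularMode u (-(j : ℤ))) else 0) := by ring
    _ ≤ _ := by gcongr

end SourceRec

end

theorem theorem5p3
    (s : ℝ) (hs : 1 / 2 < s)
    (a : ℂ → ℝ) (ha : SourceRec.IsC2Holder s a)
    (k : ℂ → ℝ → ℝ) (hk : SourceRec.IsC1HolderKernel s k)
    (hγ : SourceRec.gammaConst k <
      ENNReal.ofReal ((√2 - 1) / (2 * √SourceRec.muConst)) / SourceRec.sigmaConst a ^ 2)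
    (f : ℂ → ℝ) (hf : ∃ fx fy, SourceRec.IsH1 (fun z => (f z : ℂ)) fx fy)
    (u ux uy uθ : ℂ → ℝ → ℝ) (hu : SourceRec.IsH1Phase u ux uy uθ)
    (hfu : SourceRec.IsTransportSolution a k f u ux uy)
    (g : ℕ → ℝ → ℂ)
    (hg : ∀ j : ℕ, SourceRec.IsTrace (SourceRec.angularMode u (-(j : ℤ)))
      (SourceRec.angularMode ux (-(j : ℤ))) (SourceRec.angularMode uy (-(j : ℤ))) (g j))
    (ρ : ℕ → ℝ≥0∞)
    (hρ : ∑' j : ℕ, ENNReal.ofReal (√(1 + (j : ℝ) ^ 2)) * ρ j ^ 2 < ⊤) :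
    ∀ ε : ℝ≥0∞, 0 < ε → ∃ M₀ : ℕ, ∀ M ≥ M₀, ∀ (gt : ℕ → ℝ → ℂ) (fM : ℂ → ℂ),
      SourceRec.IsNoisyData g ρ M gt → SourceRec.IsReconstruction a k M gt fM →
        eLpNorm (fun z => fM z - (f z : ℂ)) 2 SourceRec.discMeasure ≤ ε :=
  SourceRec.exists_forall_eLpNorm_reconstruction_sub_le hs ha hk hu hfu hg hρ
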